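/- Let $d\in\{2,3\}$, let $\Omega\subset\mathbb R^d$ be a bounded domain (open, connected, non-empty) and $B\subset\mathbb R^d$ an open set, let $\overline X\in W^{1,\infty}(B)^d$ map $B$ into $\Omega$ with $|\overline X(s)-\overline X(t)|\ge m|s-t|$ for all $s,t\in B$ and some $m>0$, let $\nu\in L^\infty(\Omega)$ with $\nu\ge\nu_0>0$ a.e., and let $\alpha>0$, $\beta\ge 0$, $\gamma>0$. Write $\varepsilon(u)=\tfrac12(\nabla u+\nabla u^{\top})$ and $$a_f(u,v)=\alpha(u,v)_\Omega+(\nu\,\varepsilon(u),\varepsilon(v))_\Omega,\qquad a_s(X,Y)=\beta(X,Y)_{B}+\gamma(\nabla X,\nabla Y)_{B}.$$ Let $\Lambda$ and $c:\Lambda\times H^1(B)^d\to\mathbb R$ be one of the following: (a) $\Lambda=(H^1(B)^d)'$ and $c(\mu,Y)=\langle\mu,Y\rangle$; (b) $\Lambda=H^1(B)^d$ and $c(\mu,Y)=(\nabla\mu,\nabla Y)_{B}+(\mu,Y)_{B}$. Let $\mathbb V=H^1_0(\Omega)^d\times H^1(B)^d\times\Lambda$ with the norm $|||(v,Y,\mu)|||=(\|v\|_1^2+\|Y\|_{1,B}^2+\|\mu\|_\Lambda^2)^{1/2}$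 and, for $U=(u,X,\lambda)$, $V=(v,Y,\mu)$ in $\mathbb V$ and $q\in L^2_0(\Omega)$ (square integrable functions with zero mean), let $$\mathcal A(U,V)=a_f(u,v)+a_s(X,Y)+c(\lambda,v\circ\overline X-Y)-c(\mu,u\circ\overline X-X),\qquad \mathcal B(V,q)=(\operatorname{div}v,q)_\Omega,$$ $$\mathbb K=\{V\in\mathbb V:\ \mathcal B(V,q)=0\ \ \forall q\in L^2_0(\Omega)\}.$$ Then, in both cases (a) and (b): 1. For every $v\in H^1_0(\Omega)^d$ the composition $v\circ\overline X$ is a well-defined element of $H^1(B)^d$, and there is a constant $\kappa_0>0$ such that $$\inf_{0\ne U\in\mathbb K}\ \sup_{0\ne V\in\mathbb K}\frac{\mathcal A(U,V)}{|||U|||\,|||V|||}\ \ge\ \kappa_0 .$$ 2. If the divergence inf-sup condition holds on $\Omega$, that is, if there is $\beta_{\rm div}>0$ with $$\sup_{0\ne v\in H^1_0(\Omega)^d}\frac{(\operatorname{div}v,q)_\Omega}{\|v\|_1}\ \ge\ \beta_{\rm div}\|q\|_0\qquad\forall q\in L^2_0(\Omega),$$ then the stationary fluid–solid saddle point problem is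 well posed: there is a constant $C$ such that for all $f\in L^2(\Omega)^d$, $g\in L^2(B)^d$, $\delta\in H^1(B)^d$ there is exactly one $(u,X,\lambda,p)\in\mathbb V\times L^2_0(\Omega)$ with $$\begin{aligned} &a_f(u,v)-(\operatorname{div}v,p)_\Omega+c(\lambda,v\circ\overline X)=(f,v)_\Omega &&\forall v\in H^1_0(\Omega)^d,\\ &(\operatorname{div}u,q)_\Omega=0&&\forall q\in L^2_0(\Omega),\\ &a_s(X,Y)-c(\lambda,Y)=(g,Y)_{B}&&\forall Y\in H^1(B)^d,\\ &c(\mu,u\circ\overline X-X)=c(\mu,\delta)&&\forall\mu\in\Lambda, \end{aligned}$$ and it satisfies $|||(u,X,\lambda)|||+\|p\|_0\le C(\|f\|_0+\|g\|_{0,B}+\|\delta\|_{1,B})$. 3. The divergence inf-sup condition does hold, so that the problem is well posed, whenever $\Omega$ satisfies the interior cone condition, in particular whenever $\Omega$ is a bounded Lipschitz domain. (Interior cone condition: there are $h>0$ and $\kappa\in(0,1)$ such that for every $x\in\Omega$ there is a unit vector $e$ with $x+y\in\Omega$ for all $|y|<h$ with $e\cdot y\ge\kappa|y|$.) -/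

import Mathlib

open MeasureTheory Set
open scoped ENNReal ContDiff

noncomputable section

namespace FSI

/-- Euclidean space of dimension `d`. -/
abbrev E (d : ℕ) : Type := EuclideanSpace ℝ (Fin d)

/-- `d × d` tensors with the Frobenius scalar product `D : E = ∑ D_{ij} E_{ij}`. -/
abbrev Tensor (d : ℕ) : Type := EuclideanSpace ℝ (Fin d × Fin d)

/-- `L²(S)`. -/
abbrev L2 {d : ℕ} (S : Set (E d)) : Type := Lp ℝ 2 (volume.restrict S)

/-- `L²(S)^d`. -/
abbrev L2V {d : ℕ} (S : Set (E d)) : Type := Lp (E d) 2 (volume.restrict S)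

/-- `L²(S)^{d × d}`. -/
abbrev L2T {d : ℕ} (S : Set (E d)) : Type := Lp (Tensor d) 2 (volume.restrict S)

/-- `G` is the weak (distributional) gradient of the vector field `u` on the open set `S`:
`G x (i, j)` is the weak derivative of the component `u_i` in the direction `x_j`. -/
def HasWeakGrad {d : ℕ} (S : Set (E d)) (u : E d → E d) (G : E d → Tensor d) : Prop :=
  ∀ φ : E d → ℝ, ContDiff ℝ ∞ φ → HasCompactSupport φ → tsupport φ ⊆ S → ∀ i j : Fin d,
    ∫ x in S, u x i * fderiv ℝ φ x (EuclideanSpace.single j 1) = - ∫ x in S, G x (i, j) * φ x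

lemma integrable_coord_mul {d : ℕ} {ι : Type*} [Fintype ι] {S : Set (E d)}
    (u : Lp (EuclideanSpace ℝ ι) 2 (volume.restrict S)) (i : ι)
    {ψ : E d → ℝ} (hψ : Continuous ψ) (hc : HasCompactSupport ψ) :
    IntegrableOn (fun x => u x i * ψ x) S := by
  have h1 : MemLp (fun x => u x i) 2 (volume.restrict S) :=
    (EuclideanSpace.proj (𝕜 := ℝ) i).comp_memLp' (Lp.memLp u)
  have h2 : MemLp ψ 2 (volume.restrict S) := (hψ.memLp_of_hasCompactSupport hc).restrict S
  exact h1.integrable_mul h2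

lemma continuous_partial {d : ℕ} {φ : E d → ℝ} (hφ : ContDiff ℝ ∞ φ) (j : Fin d) :
    Continuous fun x => fderiv ℝ φ x (EuclideanSpace.single j 1) :=
  (hφ.continuous_fderiv (by simp)).clm_apply continuous_const

lemma hasCompactSupport_partial {d : ℕ} {φ : E d → ℝ} (hφ : HasCompactSupport φ) (j : Fin d) :
    HasCompactSupport fun x => fderiv ℝ φ x (EuclideanSpace.single j 1) :=
  hφ.fderiv_apply ℝ _

/-- The Sobolev space `H¹(S)^d`, realised as the space of pairs `(u, ∇u)` with `u ∈ L²(S)^d` and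
weak gradient `∇u ∈ L²(S)^{d × d}`, so that the norm inherited from the Hilbert sum is
`‖u‖₁² = ‖u‖₀² + ‖∇u‖₀²`. -/
def H1 {d : ℕ} (S : Set (E d)) : Submodule ℝ (WithLp 2 (L2V S × L2T S)) where
  carrier := {w | HasWeakGrad S w.fst w.snd}
  zero_mem' := by
    intro φ _ _ _ i j
    have h1 : ∀ᵐ x ∂(volume.restrict S), (0 : L2V S) x = 0 := Lp.coeFn_zero _ _ _
    have h2 : ∀ᵐ x ∂(volume.restrict S), (0 : L2T S) x = 0 := Lp.coeFn_zero _ _ _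
    have e1 : ∫ x in S, (0 : L2V S) x i * fderiv ℝ φ x (EuclideanSpace.single j 1) = 0 := by
      apply integral_eq_zero_of_ae
      filter_upwards [h1] with x hx
      rw [hx]
      simp
    have e2 : ∫ x in S, (0 : L2T S) x (i, j) * φ x = 0 := by
      apply integral_eq_zero_of_ae
      filter_upwards [h2] with x hx
      rw [hx]
      simp
    change ∫ x in S, (0 : L2V S) x i * fderiv ℝ φ x (EuclideanSpace.single j 1)
      = - ∫ x in S, (0 : L2T S) x (i, j) * φ x
    rw [e1, e2, neg_zero]
  add_mem' := by
    intro v w hv hw φ hφ hc hs i j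
    have e1 : ∫ x in S, (v.fst + w.fst) x i * fderiv ℝ φ x (EuclideanSpace.single j 1)
        = (∫ x in S, v.fst x i * fderiv ℝ φ x (EuclideanSpace.single j 1))
          + ∫ x in S, w.fst x i * fderiv ℝ φ x (EuclideanSpace.single j 1) := by
      rw [← integral_add
        (integrable_coord_mul v.fst i (continuous_partial hφ j) (hasCompactSupport_partial hc j))
        (integrable_coord_mul w.fst i (continuous_partial hφ j) (hasCompactSupport_partial hc j))]
      apply integral_congr_ae
      filter_upwards [Lp.coeFn_add v.fst w.fst] with x hx
      rw [hx]
      simp [add_mul]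
    have e2 : ∫ x in S, (v.snd + w.snd) x (i, j) * φ x
        = (∫ x in S, v.snd x (i, j) * φ x) + ∫ x in S, w.snd x (i, j) * φ x := by
      rw [← integral_add (integrable_coord_mul v.snd (i, j) hφ.continuous hc)
        (integrable_coord_mul w.snd (i, j) hφ.continuous hc)]
      apply integral_congr_ae
      filter_upwards [Lp.coeFn_add v.snd w.snd] with x hx
      rw [hx]
      simp [add_mul]
    change ∫ x in S, (v.fst + w.fst) x i * fderiv ℝ φ x (EuclideanSpace.single j 1)
      = - ∫ x in S, (v.snd + w.snd) x (i, j) * φ x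
    rw [e1, e2, hv φ hφ hc hs i j, hw φ hφ hc hs i j]
    ring
  smul_mem' := by
    intro a w hw φ hφ hc hs i j
    have e1 : ∫ x in S, (a • w.fst) x i * fderiv ℝ φ x (EuclideanSpace.single j 1)
        = a * ∫ x in S, w.fst x i * fderiv ℝ φ x (EuclideanSpace.single j 1) := by
      rw [← integral_const_mul]
      apply integral_congr_ae
      filter_upwards [Lp.coeFn_smul a w.fst] with x hx
      rw [hx]
      simp [mul_assoc]
    have e2 : ∫ x in S, (a • w.snd) x (i, j) * φ x = a * ∫ x in S, w.snd x (i, j) * φ x := by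
      rw [← integral_const_mul]
      apply integral_congr_ae
      filter_upwards [Lp.coeFn_smul a w.snd] with x hx
      rw [hx]
      simp [mul_assoc]
    change ∫ x in S, (a • w.fst) x i * fderiv ℝ φ x (EuclideanSpace.single j 1)
      = - ∫ x in S, (a • w.snd) x (i, j) * φ x
    rw [e1, e2, hw φ hφ hc hs i j]
    ring

/-- The function `u ∈ L²(S)^d` underlying an element of `H¹(S)^d`. -/
def fn {d : ℕ} {S : Set (E d)} (u : H1 S) : L2V S := u.1.fst

/-- The weak gradient `∇u ∈ L²(S)^{d × d}` of an element of `H¹(S)^d`. -/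
def grad {d : ℕ} {S : Set (E d)} (u : H1 S) : L2T S := u.1.snd

/-- `H¹₀(S)^d`: the closure in `H¹(S)^d` of the smooth vector fields with compact support
in `S`. -/
def H10 {d : ℕ} (S : Set (E d)) : Submodule ℝ (H1 S) :=
  (Submodule.span ℝ {w : H1 S | ∃ φ : E d → E d, ContDiff ℝ ∞ φ ∧ HasCompactSupport φ ∧
    tsupport φ ⊆ S ∧ fn w =ᵐ[volume.restrict S] φ}).topologicalClosure

/-- `L²₀(S)`: the square integrable functions with zero mean value (`S` bounded). -/
def L20 {d : ℕ} (S : Set (E d)) : Set (L2 S) := {q | ∫ x in S, q x = 0}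

/-- `X ∈ W^{1,∞}(S)^d`. -/
def MemW1inf {d : ℕ} (S : Set (E d)) (X : E d → E d) : Prop :=
  MemLp X ∞ (volume.restrict S) ∧
    ∃ G : E d → Tensor d, MemLp G ∞ (volume.restrict S) ∧ HasWeakGrad S X G

/-- The interior cone condition: every point of `Ω` is the vertex of a finite cone contained
in `Ω` and congruent to a fixed one (of height `h` and half-opening `arccos κ`). Bounded Lipschitz
domains satisfy it. -/
def ConeCondition {d : ℕ} (Ω : Set (E d)) : Prop :=
  ∃ h κ : ℝ, 0 < h ∧ 0 < κ ∧ κ < 1 ∧ ∀ x ∈ Ω, ∃ e : E d, ‖e‖ = 1 ∧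
    ∀ y : E d, ‖y‖ < h → κ * ‖y‖ ≤ inner ℝ e y → x + y ∈ Ω

/-- `w ∈ H¹(B)^d` is the composition `v(X̄)`. -/
def IsComp {d : ℕ} {Ω B : Set (E d)} (Xb : E d → E d) (v : H1 Ω) (w : H1 B) : Prop :=
  fn w =ᵐ[volume.restrict B] fun s => fn v (Xb s)

open Classical in
/-- The composition `v(X̄)` as an element of `H¹(B)^d` (the value `0` is taken if `v(X̄)` is not in
`H¹(B)^d`). -/
def comp {d : ℕ} {Ω : Set (E d)} (B : Set (E d)) (Xb : E d → E d) (v : H1 Ω) : H1 B :=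
  if h : ∃ w : H1 B, IsComp Xb v w then h.choose else 0

/-- `(div v, q)`. -/
def divForm {d : ℕ} {Ω : Set (E d)} (v : H1 Ω) (q : L2 Ω) : ℝ :=
  ∫ x in Ω, (∑ i : Fin d, grad v x (i, i)) * q x

/-- The entry `(i, j)` of the symmetric gradient `(∇u + ∇uᵀ) / 2` at `x`. -/
def symGrad {d : ℕ} {Ω : Set (E d)} (u : H1 Ω) (x : E d) (i j : Fin d) : ℝ :=
  (1 / 2) * (grad u x (i, j) + grad u x (j, i))

/-- `a_f(u, v) = α (u, v) + (ν ε(u), ε(v))`, with `ε` the symmetric gradient. -/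
def aF {d : ℕ} {Ω : Set (E d)} (α : ℝ) (ν : E d → ℝ) (u v : H1 Ω) : ℝ :=
  α * inner ℝ (fn u) (fn v) +
    ∫ x in Ω, ν x * ∑ i : Fin d, ∑ j : Fin d, symGrad u x i j * symGrad v x i j

/-- `a_s(X, Y) = β (X, Y)_B + γ (∇X, ∇Y)_B`. -/
def aS {d : ℕ} {B : Set (E d)} (β γ : ℝ) (X Y : H1 B) : ℝ :=
  β * inner ℝ (fn X) (fn Y) + γ * inner ℝ (grad X) (grad Y)

/-- The first choice of multiplier space, the dual of `H¹(B)^d` with the dual norm. -/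
abbrev DualH1 {d : ℕ} (B : Set (E d)) : Type := StrongDual ℝ (H1 B)

/-- The first choice of `c`: the duality pairing. -/
def cDual {d : ℕ} {B : Set (E d)} (μ : DualH1 B) (Y : H1 B) : ℝ := μ Y

/-- The second choice of `c`, with multiplier space `H¹(B)^d`: the scalar product of `H¹(B)^d`. -/
def cInner {d : ℕ} {B : Set (E d)} (μ Y : H1 B) : ℝ :=
  inner ℝ (grad μ) (grad Y) + inner ℝ (fn μ) (fn Y)

section Mixed

variable {d : ℕ} {Ω B : Set (E d)} {Λ : Type} [NormedAddCommGroup Λ] [NormedSpace ℝ Λ]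

/-- `V = H¹₀(Ω)^d × H¹(B)^d × Λ`, with the norm
`(‖v‖₁² + ‖Y‖²_{1,B} + ‖μ‖²_Λ)^{1/2}`. -/
abbrev VV {d : ℕ} (Ω B : Set (E d)) (Λ : Type) [NormedAddCommGroup Λ] [NormedSpace ℝ Λ] : Type :=
  WithLp 2 (H10 Ω × WithLp 2 (H1 B × Λ))

/-- The velocity component `v ∈ H¹₀(Ω)^d` of `(v, Y, μ)`. -/
def vel (V : VV Ω B Λ) : H10 Ω := V.fst

/-- The solid component `Y ∈ H¹(B)^d` of `(v, Y, μ)`. -/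
def pos (V : VV Ω B Λ) : H1 B := V.snd.fst

/-- The multiplier component `μ ∈ Λ` of `(v, Y, μ)`. -/
def mult (V : VV Ω B Λ) : Λ := V.snd.snd

/-- The bilinear form `𝒜(U, V) = a_f(u, v) + a_s(X, Y) + c(λ, v(X̄) - Y) - c(μ, u(X̄) - X)`. -/
def formA (c : Λ → H1 B → ℝ) (Xb : E d → E d) (ν : E d → ℝ) (α β γ : ℝ) (U V : VV Ω B Λ) : ℝ :=
  aF α ν (vel U : H1 Ω) (vel V) + aS β γ (pos U) (pos V)
    + c (mult U) (comp B Xb (vel V : H1 Ω) - pos V)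
    - c (mult V) (comp B Xb (vel U : H1 Ω) - pos U)

/-- The bilinear form `ℬ(V, q) = (div v, q)`. -/
def formB (V : VV Ω B Λ) (q : L2 Ω) : ℝ := divForm (vel V : H1 Ω) q

/-- The kernel of `ℬ`. -/
def kerB {d : ℕ} (Ω B : Set (E d)) (Λ : Type) [NormedAddCommGroup Λ] [NormedSpace ℝ Λ] :
    Set (VV Ω B Λ) :=
  {V | ∀ q ∈ L20 Ω, formB V q = 0}

/-- The inf-sup condition for `𝒜` on the kernel of `ℬ`; infimum and supremum are over nonzero
elements and are taken in the extended reals. -/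
def InfSupA (c : Λ → H1 B → ℝ) (Ω : Set (E d)) (Xb : E d → E d) (ν : E d → ℝ) (α β γ : ℝ) :
    Prop :=
  ∃ κ₀ : ℝ, 0 < κ₀ ∧ (κ₀ : EReal) ≤
    ⨅ U : {U : VV Ω B Λ // U ∈ kerB Ω B Λ ∧ U ≠ 0},
      ⨆ V : {V : VV Ω B Λ // V ∈ kerB Ω B Λ ∧ V ≠ 0},
        ((formA c Xb ν α β γ U.1 V.1 / (‖U.1‖ * ‖V.1‖) : ℝ) : EReal)

/-- The stationary problem: `(U, p) = ((u, X, λ), p)` solves the four variational equations with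
data `f`, `g`, `D`. -/
structure IsSolution (c : Λ → H1 B → ℝ) (Xb : E d → E d) (ν : E d → ℝ) (α β γ : ℝ)
    (f : L2V Ω) (g : L2V B) (D : H1 B) (s : VV Ω B Λ × L2 Ω) : Prop where
  pressure_mem : s.2 ∈ L20 Ω
  fluid : ∀ v : H10 Ω, aF α ν (vel s.1 : H1 Ω) v - divForm (v : H1 Ω) s.2
    + c (mult s.1) (comp B Xb (v : H1 Ω)) = inner ℝ f (fn (v : H1 Ω))
  incompressible : ∀ q ∈ L20 Ω, divForm (vel s.1 : H1 Ω) q = 0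
  solid : ∀ Y : H1 B, aS β γ (pos s.1) Y - c (mult s.1) Y = inner ℝ g (fn Y)
  coupling : ∀ μ : Λ, c μ (comp B Xb (vel s.1 : H1 Ω) - pos s.1) = c μ D

/-- Well-posedness of the stationary problem: existence, uniqueness and continuous dependence on
the data. -/
def WellPosed (c : Λ → H1 B → ℝ) (Ω : Set (E d)) (Xb : E d → E d) (ν : E d → ℝ) (α β γ : ℝ) :
    Prop :=
  ∃ C : ℝ, ∀ (f : L2V Ω) (g : L2V B) (D : H1 B), ∃ s : VV Ω B Λ × L2 Ω,
    IsSolution c Xb ν α β γ f g D s ∧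
    (∀ s' : VV Ω B Λ × L2 Ω, IsSolution c Xb ν α β γ f g D s' → s' = s) ∧
    ‖s.1‖ + ‖s.2‖ ≤ C * (‖f‖ + ‖g‖ + ‖D‖)

end Mixed

/-- The inf-sup condition for the divergence on `H¹₀(Ω)^d × L²₀(Ω)`. -/
def InfSupDiv {d : ℕ} (Ω : Set (E d)) : Prop :=
  ∃ b : ℝ, 0 < b ∧ ∀ q ∈ L20 Ω, ((b * ‖q‖ : ℝ) : EReal) ≤
    ⨆ v : {v : H10 Ω // v ≠ 0}, ((divForm (v.1 : H1 Ω) q / ‖v.1‖ : ℝ) : EReal)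

end FSI

end

open MeasureTheory Set
open scoped ENNReal ContDiff

noncomputable section

namespace FSI

/-! Composition. An expanding map has a Lipschitz inverse, so it pulls volumes back with factor at
most m⁻ᵈ (`volume_le_of_expanding`), and composition with X̄ is bounded on L². For a test field φ
the chain rule for φ ∘ X̄ follows by mollifying X̄ (`weak_chain_rule`). As `H1 B` is closed in the
Hilbert sum, density carries it to all of H¹₀(Ω)^d (`exists_comp`).

Inf-sup for 𝒜. Integrating by parts twice turns ∑ (∂ⱼvᵢ, ∂ᵢvⱼ) into ‖div v‖², which gives Korn's
inequality and coercivity of a_f on H¹₀. In both cases Riesz identifies Λ isometrically with H¹(B)^d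
and c with the scalar product. For U = (u, X, λ) the test function (u, X - δ₂λ, λ + δ₁X) has the
same velocity, hence lies in the kernel with U, and small weights give 𝒜(U, V) ≥ κ|||U|||²
(`formA_test`, `exists_weights`).

Well-posedness. The coupling determines X from u, and the solid equation then determines λ. What
remains is a Stokes-type system for (u, p) with the coercive operator A + K*SK; its pressure Schur
complement is coercive by the divergence inf-sup condition (`exists_solution_operator`).

Divergence inf-sup. For q with zero mean let u ∈ H¹₀ solve (∇u, ∇v) = (div v, q), so that (div u, q)
= ‖∇u‖². It suffices to show ‖q‖ ≤ C‖∇u‖, that is, to bound g = q - div u. By the same double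
integration by parts, (g, div v) pairs ∇u with the curl of v only (`isResidual_of_variational`).
Curl-free radial fields show that the means of g around a point do not depend on the scale, so g has
a C¹ representative; testing with a kernel times a constant vector bounds dist(x, ∂Ω)|∇g(x)| by a
mean of |∇u| over a ball of radius comparable to that distance. Hence the weighted energy of g is at
most C‖∇u‖² (`wEnergy_smoothRep_le`). The improved Poincaré inequality then bounds g itself; it
rests on Hardy's inequality along finitely many cone directions and on chains of balls inside Ω
(`improved_poincare`). -/

/-- Smooth functions with compact support in `S`. -/
structure IsTest {d : ℕ} (S : Set (E d)) {F : Type*} [NormedAddCommGroup F] [NormedSpace ℝ F]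
    (φ : E d → F) : Prop where
  smooth : ContDiff ℝ ∞ φ
  compact : HasCompactSupport φ
  supp : tsupport φ ⊆ S

/-- The partial derivative in the direction of the `j`-th basis vector. -/
abbrev pd {d : ℕ} {F : Type*} [NormedAddCommGroup F] [NormedSpace ℝ F] (j : Fin d) (φ : E d → F)
    (x : E d) : F :=
  fderiv ℝ φ x (EuclideanSpace.single j 1)

/-! ### Calculus of test functions -/

section Test

variable {d : ℕ} {S : Set (E d)} {F : Type*} [NormedAddCommGroup F] [NormedSpace ℝ F]

lemma IsTest.continuous {φ : E d → F} (h : IsTest S φ) : Continuous φ := h.smooth.continuous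

lemma IsTest.differentiable {φ : E d → F} (h : IsTest S φ) : Differentiable ℝ φ :=
  h.smooth.differentiable (by simp)

lemma IsTest.zero_of_notMem {φ : E d → F} (h : IsTest S φ) {x : E d} (hx : x ∉ S) : φ x = 0 :=
  image_eq_zero_of_notMem_tsupport fun h' => hx (h.supp h')

lemma IsTest.clm_comp {G : Type*} [NormedAddCommGroup G] [NormedSpace ℝ G] {φ : E d → F}
    (h : IsTest S φ) (L : F →L[ℝ] G) : IsTest S fun x => L (φ x) := by
  refine ⟨L.contDiff.comp h.smooth, h.compact.comp_left (map_zero L), ?_⟩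
  exact (tsupport_comp_subset (map_zero L) φ).trans h.supp

lemma IsTest.fderiv {φ : E d → F} (h : IsTest S φ) : IsTest S (fderiv ℝ φ) :=
  ⟨h.smooth.fderiv_right (by simp), h.compact.fderiv ℝ,
    (tsupport_fderiv_subset ℝ).trans h.supp⟩

lemma IsTest.pd {φ : E d → F} (h : IsTest S φ) (j : Fin d) : IsTest S (pd j φ) :=
  h.fderiv.clm_comp (ContinuousLinearMap.apply ℝ F (EuclideanSpace.single j (1 : ℝ)))

lemma IsTest.coord {ι : Type*} [Fintype ι] {φ : E d → EuclideanSpace ℝ ι} (h : IsTest S φ)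
    (i : ι) : IsTest S fun x => φ x i :=
  h.clm_comp (EuclideanSpace.proj (𝕜 := ℝ) i)

lemma IsTest.add {φ ψ : E d → F} (h : IsTest S φ) (h' : IsTest S ψ) :
    IsTest S fun x => φ x + ψ x :=
  ⟨h.smooth.add h'.smooth, h.compact.add h'.compact,
    (tsupport_add φ ψ).trans (union_subset h.supp h'.supp)⟩

lemma IsTest.const_smul {φ : E d → F} (h : IsTest S φ) (a : ℝ) : IsTest S fun x => a • φ x :=
  h.clm_comp (a • ContinuousLinearMap.id ℝ F)

lemma IsTest.zero : IsTest S fun _ : E d => (0 : F) :=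
  ⟨contDiff_const, HasCompactSupport.zero, by
    rw [show tsupport (fun _ : E d => (0 : F)) = ∅ from tsupport_eq_empty_iff.2 rfl]
    exact empty_subset _⟩

lemma IsTest.smul_const {φ : E d → ℝ} (h : IsTest S φ) (v : F) : IsTest S fun x => φ x • v :=
  h.clm_comp ((ContinuousLinearMap.id ℝ ℝ).smulRight v)

lemma IsTest.memLp {φ : E d → F} (h : IsTest S φ) (p : ℝ≥0∞) : MemLp φ p (volume.restrict S) :=
  (h.continuous.memLp_of_hasCompactSupport h.compact).restrict S

lemma IsTest.setIntegral_eq {φ : E d → F} (h : IsTest S φ) : ∫ x in S, φ x = ∫ x, φ x :=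
  setIntegral_eq_integral_of_forall_compl_eq_zero fun _ hx => h.zero_of_notMem hx

lemma fderiv_coord {ι : Type*} [Fintype ι] {φ : E d → EuclideanSpace ℝ ι} (i : ι) {x : E d}
    (h : DifferentiableAt ℝ φ x) (v : E d) :
    fderiv ℝ (fun y => φ y i) x v = fderiv ℝ φ x v i := by
  have := ((EuclideanSpace.proj (𝕜 := ℝ) i).hasFDerivAt.comp x h.hasFDerivAt).fderiv
  have e : (fun y => φ y i) = (EuclideanSpace.proj (𝕜 := ℝ) i) ∘ φ := rfl
  rw [e, this]
  rfl

lemma pd_comm {φ : E d → F} (h : IsTest S φ) (i j : Fin d) (x : E d) :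
    pd i (pd j φ) x = pd j (pd i φ) x := by
  have hd : ∀ k : Fin d, ∀ v : E d, fderiv ℝ (pd k φ) x v
      = fderiv ℝ (fderiv ℝ φ) x v (EuclideanSpace.single k 1) := by
    intro k v
    have h1 : HasFDerivAt (fderiv ℝ φ) (fderiv ℝ (fderiv ℝ φ) x) x :=
      h.fderiv.differentiable.differentiableAt.hasFDerivAt
    have := (h1.clm_apply (hasFDerivAt_const (EuclideanSpace.single k (1 : ℝ)) x)).fderiv
    change fderiv ℝ (fun y => fderiv ℝ φ y (EuclideanSpace.single k 1)) x v = _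
    rw [this]
    simp
  have hs : IsSymmSndFDerivAt ℝ φ x :=
    h.smooth.contDiffAt.isSymmSndFDerivAt
      (by simpa using WithTop.coe_le_coe.2 (le_top : (2 : ℕ∞) ≤ ⊤))
  change fderiv ℝ (pd j φ) x _ = fderiv ℝ (pd i φ) x _
  rw [hd, hd]
  exact hs _ _

lemma IsTest.integral_pd_mul {φ ψ : E d → ℝ} (h : IsTest S φ) (h' : IsTest S ψ) (j : Fin d) :
    ∫ x in S, φ x * FSI.pd j ψ x = - ∫ x in S, FSI.pd j φ x * ψ x := by
  have hc : ∀ {f g : E d → ℝ}, IsTest S f → Continuous g →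
      Integrable (fun x => f x * g x) := fun hf hg =>
    (hf.continuous.mul hg).integrable_of_hasCompactSupport hf.compact.mul_right
  have hz : ∀ {f g : E d → ℝ}, IsTest S f → ∫ x in S, f x * g x = ∫ x, f x * g x := fun hf =>
    setIntegral_eq_integral_of_forall_compl_eq_zero fun x hx => by simp [hf.zero_of_notMem hx]
  rw [hz h, hz (h.pd j)]
  exact integral_mul_fderiv_eq_neg_fderiv_mul_of_integrable (hc (h.pd j) h'.continuous)
    (hc h (h'.pd j).continuous) (hc h h'.continuous)
    (fun x _ => h.differentiable.differentiableAt) (fun x _ => h'.differentiable.differentiableAt)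

lemma IsTest.integral_pd {φ : E d → ℝ} (h : IsTest S φ) (j : Fin d) :
    ∫ x, FSI.pd j φ x = 0 := by
  have := integral_mul_fderiv_eq_neg_fderiv_mul_of_integrable (μ := (volume : Measure (E d)))
    (f := fun _ => (1 : ℝ)) (g := φ) (v := EuclideanSpace.single j 1)
    (by simp) (by simpa using (h.pd j).continuous.integrable_of_hasCompactSupport (h.pd j).compact)
    (by simpa using h.continuous.integrable_of_hasCompactSupport h.compact)
    (fun x _ => differentiableAt_const _) (fun x _ => h.differentiable.differentiableAt)
  simpa using this

end Test

/-! ### Components of vector-valued L² functions -/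

section Coord

variable {d : ℕ} {S : Set (E d)} {ι : Type*} [Fintype ι]

/-- The `i`-th component of a vector-valued `L²` function. -/
def coordL (S : Set (E d)) (i : ι) : Lp (EuclideanSpace ℝ ι) 2 (volume.restrict S) →L[ℝ] L2 S :=
  (EuclideanSpace.proj (𝕜 := ℝ) i).compLpL 2 (volume.restrict S)

lemma coordL_coe (u : Lp (EuclideanSpace ℝ ι) 2 (volume.restrict S)) (i : ι) :
    coordL S i u =ᵐ[volume.restrict S] fun x => u x i :=
  ContinuousLinearMap.coeFn_compLpL _ _

lemma inner_coordL (u : Lp (EuclideanSpace ℝ ι) 2 (volume.restrict S)) (i : ι) (q : L2 S) :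
    inner ℝ (coordL S i u) q = ∫ x in S, u x i * q x := by
  rw [L2.inner_def]
  apply integral_congr_ae
  filter_upwards [coordL_coe u i] with x hx
  rw [hx]
  simp [mul_comm]

lemma inner_eq_sum_coordL (u v : Lp (EuclideanSpace ℝ ι) 2 (volume.restrict S)) :
    inner ℝ u v = ∑ i, inner ℝ (coordL S i u) (coordL S i v) := by
  simp only [L2.inner_def]
  rw [← integral_finsetSum _ fun i _ => L2.integrable_inner _ _]
  apply integral_congr_ae
  have h : ∀ᵐ x ∂(volume.restrict S), ∀ i, coordL S i u x = u x i ∧ coordL S i v x = v x i := by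
    rw [ae_all_iff]
    intro i
    filter_upwards [coordL_coe u i, coordL_coe v i] with x h1 h2 using ⟨h1, h2⟩
  filter_upwards [h] with x hx
  simp only [PiLp.inner_apply]
  exact Finset.sum_congr rfl fun i _ => by rw [(hx i).1, (hx i).2]

lemma ext_coordL {u v : Lp (EuclideanSpace ℝ ι) 2 (volume.restrict S)}
    (h : ∀ i, coordL S i u = coordL S i v) : u = v := by
  apply Lp.ext
  have h' : ∀ᵐ x ∂(volume.restrict S), ∀ i, u x i = v x i := by
    rw [ae_all_iff]
    intro i
    filter_upwards [coordL_coe u i, coordL_coe v i] with x h1 h2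
    rw [← h1, ← h2, h i]
  filter_upwards [h'] with x hx
  ext i
  exact hx i

/-- The class of a test function in `L²`. -/
def IsTest.toL2 {F : Type*} [NormedAddCommGroup F] [NormedSpace ℝ F] {φ : E d → F}
    (h : IsTest S φ) : Lp F 2 (volume.restrict S) := (h.memLp 2).toLp φ

lemma IsTest.coe_toL2 {F : Type*} [NormedAddCommGroup F] [NormedSpace ℝ F] {φ : E d → F}
    (h : IsTest S φ) : h.toL2 =ᵐ[volume.restrict S] φ := MemLp.coeFn_toLp _

lemma inner_coordL_toL2 (u : Lp (EuclideanSpace ℝ ι) 2 (volume.restrict S)) (i : ι)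
    {φ : E d → ℝ} (h : IsTest S φ) :
    inner ℝ (coordL S i u) h.toL2 = ∫ x in S, u x i * φ x := by
  rw [inner_coordL]
  apply integral_congr_ae
  filter_upwards [h.coe_toL2] with x hx
  rw [hx]

lemma coordL_toL2 {φ : E d → EuclideanSpace ℝ ι} (h : IsTest S φ) (i : ι) :
    coordL S i h.toL2 = (h.coord i).toL2 := by
  apply Lp.ext
  filter_upwards [coordL_coe h.toL2 i, h.coe_toL2, (h.coord i).coe_toL2] with x h1 h2 h3
  rw [h1, h2, h3]

lemma ae_eq_zero_of_test (hS : IsOpen S) {q : L2 S}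
    (h : ∀ φ : E d → ℝ, ∀ hφ : IsTest S φ, inner ℝ q hφ.toL2 = 0) : q = 0 := by
  apply Lp.ext
  have hl : LocallyIntegrableOn (q : E d → ℝ) S volume := by
    have h1 : LocallyIntegrable (q : E d → ℝ) (volume.restrict S) :=
      (Lp.memLp q).locallyIntegrable (by norm_num)
    intro x hx
    obtain ⟨t, ht, hi⟩ := h1 x
    exact ⟨S ∩ t, Filter.inter_mem self_mem_nhdsWithin (mem_nhdsWithin_of_mem_nhds ht), by
      rw [inter_comm]
      rwa [IntegrableOn, Measure.restrict_restrict' hS.measurableSet] at hi⟩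
  have h2 := hS.ae_eq_zero_of_integral_contDiff_smul_eq_zero hl (fun g hg hc hs => by
    have := h g ⟨hg, hc, hs⟩
    rw [L2.inner_def] at this
    rw [← setIntegral_eq_integral_of_forall_compl_eq_zero (s := S) (fun x hx => by
      rw [image_eq_zero_of_notMem_tsupport (f := g) fun h' => hx (hs h'), zero_smul]), ← this]
    apply integral_congr_ae
    filter_upwards [(IsTest.mk hg hc hs : IsTest S g).coe_toL2] with x hx
    rw [hx]
    simp)
  filter_upwards [(ae_restrict_iff' hS.measurableSet).2 h2, Lp.coeFn_zero ℝ 2 (volume.restrict S)]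
    with x h3 h4
  rw [h3, h4]
  rfl

end Coord

/-! ### The Sobolev spaces H¹ and H¹₀ -/

section Sobolev

variable {d : ℕ} {S : Set (E d)}

/-- Pairings with fixed L² classes are continuous in the pair, so in this form each test function
imposes a closed condition. Closedness and completeness of `H1 S` follow. -/
lemma hasWeakGrad_iff (w : WithLp 2 (L2V S × L2T S)) : HasWeakGrad S w.fst w.snd ↔
    ∀ φ : E d → ℝ, ∀ h : IsTest S φ, ∀ i j : Fin d,
      inner ℝ (coordL S i w.fst) (h.pd j).toL2 = - inner ℝ (coordL S (i, j) w.snd) h.toL2 := by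
  constructor
  · intro H φ h i j
    rw [inner_coordL_toL2, inner_coordL_toL2]
    exact H φ h.smooth h.compact h.supp i j
  · intro H φ h1 h2 h3 i j
    have := H φ ⟨h1, h2, h3⟩ i j
    rwa [inner_coordL_toL2, inner_coordL_toL2] at this

lemma isClosed_H1 : IsClosed (H1 S : Set (WithLp 2 (L2V S × L2T S))) := by
  have : (H1 S : Set (WithLp 2 (L2V S × L2T S))) = ⋂ (φ : E d → ℝ) (h : IsTest S φ) (i : Fin d)
      (j : Fin d), {w | inner ℝ (coordL S i w.fst) (h.pd j).toL2
        = - inner ℝ (coordL S (i, j) w.snd) h.toL2} := by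
    ext w
    simp only [mem_iInter]
    exact hasWeakGrad_iff w
  rw [this]
  refine isClosed_iInter fun φ => isClosed_iInter fun h => isClosed_iInter fun i =>
    isClosed_iInter fun j => ?_
  have c1 : Continuous fun w : WithLp 2 (L2V S × L2T S) => w.fst :=
    (WithLp.fstL 2 ℝ (L2V S) (L2T S)).continuous
  have c2 : Continuous fun w : WithLp 2 (L2V S × L2T S) => w.snd :=
    (WithLp.sndL 2 ℝ (L2V S) (L2T S)).continuous
  exact isClosed_eq (((coordL S i).continuous.comp c1).inner continuous_const)
    (((coordL S (i, j)).continuous.comp c2).inner continuous_const).neg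

scoped instance instNormedAddCommGroupH1 : NormedAddCommGroup (H1 S) := Submodule.normedAddCommGroup _

scoped instance instInnerProductSpaceH1 : InnerProductSpace ℝ (H1 S) := Submodule.innerProductSpace _

scoped instance instNormedAddCommGroupH10 : NormedAddCommGroup (H10 S) := Submodule.normedAddCommGroup _

scoped instance instInnerProductSpaceH10 : InnerProductSpace ℝ (H10 S) := Submodule.innerProductSpace _

instance : CompleteSpace (H1 S) := isClosed_H1.completeSpace_coe

instance : CompleteSpace (H10 S) :=
  (Submodule.isClosed_topologicalClosure _).completeSpace_coe

/-- `u ↦ u` from `H¹(S)^d` to `L²(S)^d`. -/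
def fnL (S : Set (E d)) : H1 S →L[ℝ] L2V S := (WithLp.fstL 2 ℝ (L2V S) (L2T S)).comp (H1 S).subtypeL

/-- `u ↦ ∇u` from `H¹(S)^d` to `L²(S)^{d × d}`. -/
def gradL (S : Set (E d)) : H1 S →L[ℝ] L2T S :=
  (WithLp.sndL 2 ℝ (L2V S) (L2T S)).comp (H1 S).subtypeL

@[simp] lemma fnL_apply (u : H1 S) : fnL S u = fn u := rfl

@[simp] lemma gradL_apply (u : H1 S) : gradL S u = grad u := rfl

lemma inner_H1 (u v : H1 S) :
    inner ℝ u v = inner ℝ (fn u) (fn v) + inner ℝ (grad u) (grad v) :=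
  WithLp.prod_inner_apply _ _

lemma norm_sq_H1 (u : H1 S) : ‖u‖ ^ 2 = ‖fn u‖ ^ 2 + ‖grad u‖ ^ 2 := by
  simp only [← real_inner_self_eq_norm_sq, inner_H1]

lemma norm_fn_le (u : H1 S) : ‖fn u‖ ≤ ‖u‖ := by
  apply le_of_sq_le_sq _ (norm_nonneg _)
  rw [norm_sq_H1]; nlinarith [sq_nonneg ‖grad u‖]

lemma norm_grad_le (u : H1 S) : ‖grad u‖ ≤ ‖u‖ := by
  apply le_of_sq_le_sq _ (norm_nonneg _)
  rw [norm_sq_H1]; nlinarith [sq_nonneg ‖fn u‖]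

lemma weak_grad (u : H1 S) {φ : E d → ℝ} (h : IsTest S φ) (i j : Fin d) :
    inner ℝ (coordL S i (fn u)) (h.pd j).toL2 = - inner ℝ (coordL S (i, j) (grad u)) h.toL2 :=
  (hasWeakGrad_iff u.1).1 u.2 φ h i j

/-- The weak identities determine the pairing of every gradient component with every test function,
and on an open set these pairings determine the component. -/
lemma H1_ext (hS : IsOpen S) {u v : H1 S} (h : fn u = fn v) : u = v := by
  have hg : grad u = grad v := by
    apply ext_coordL
    rintro ⟨i, j⟩
    rw [← sub_eq_zero]
    apply ae_eq_zero_of_test hS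
    intro φ hφ
    have h1 := weak_grad u hφ i j
    have h2 := weak_grad v hφ i j
    rw [h] at h1
    rw [inner_sub_left]
    linarith
  apply Subtype.ext
  exact (WithLp.equiv 2 (L2V S × L2T S)).injective (Prod.ext h hg)

/-- The gradient of a smooth vector field. -/
def gradFun (φ : E d → E d) (x : E d) : Tensor d :=
  WithLp.toLp 2 fun ij => pd ij.2 φ x ij.1

lemma IsTest.gradFun {φ : E d → E d} (h : IsTest S φ) : IsTest S (gradFun φ) := by
  let L : (E d →L[ℝ] E d) →L[ℝ] Tensor d :=
    LinearMap.toContinuousLinearMap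
      { toFun := fun A => WithLp.toLp 2 fun ij : Fin d × Fin d =>
          A (EuclideanSpace.single ij.2 1) ij.1
        map_add' := by intro A A'; ext ij; simp
        map_smul' := by intro a A; ext ij; simp }
  exact h.fderiv.clm_comp L

/-- A test vector field as an element of `H¹(S)^d`. -/
def ofTest {φ : E d → E d} (h : IsTest S φ) : H1 S :=
  ⟨WithLp.toLp 2 (h.toL2, h.gradFun.toL2), by
    refine (hasWeakGrad_iff _).2 fun ψ hψ i j => ?_
    change inner ℝ (coordL S i h.toL2) _ = - inner ℝ (coordL S (i, j) h.gradFun.toL2) _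
    rw [inner_coordL_toL2, inner_coordL_toL2]
    have e := (h.coord i).integral_pd_mul hψ j
    have e1 : ∫ x in S, h.toL2 x i * pd j ψ x = ∫ x in S, φ x i * pd j ψ x := by
      apply integral_congr_ae
      filter_upwards [h.coe_toL2] with x hx
      rw [hx]
    have e2 : ∫ x in S, h.gradFun.toL2 x (i, j) * ψ x
        = ∫ x in S, pd j (fun y => φ y i) x * ψ x := by
      apply integral_congr_ae
      filter_upwards [h.gradFun.coe_toL2] with x hx
      rw [hx]
      exact congrArg (· * ψ x) (fderiv_coord i h.differentiable.differentiableAt _).symm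
    rw [e1, e2, e]⟩

lemma fn_ofTest {φ : E d → E d} (h : IsTest S φ) : fn (ofTest h) = h.toL2 := rfl

lemma grad_ofTest {φ : E d → E d} (h : IsTest S φ) : grad (ofTest h) = h.gradFun.toL2 := rfl

lemma coordL_grad_ofTest {φ : E d → E d} (h : IsTest S φ) (i j : Fin d) :
    coordL S (i, j) (grad (ofTest h)) = ((h.coord i).pd j).toL2 := by
  rw [grad_ofTest, coordL_toL2]
  apply Lp.ext
  filter_upwards [(h.gradFun.coord (i, j)).coe_toL2, ((h.coord i).pd j).coe_toL2] with x h1 h2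
  rw [h1, h2]
  exact (fderiv_coord i h.differentiable.differentiableAt _).symm

lemma ofTest_mem {φ : E d → E d} (h : IsTest S φ) : ofTest h ∈ H10 S := by
  apply Submodule.le_topologicalClosure
  apply Submodule.subset_span
  exact ⟨φ, h.smooth, h.compact, h.supp, h.coe_toL2⟩

/-- Closed properties which hold for test vector fields hold on `H¹₀(S)^d`. -/
lemma H10_induction (hS : IsOpen S) {P : H1 S → Prop} (hP : IsClosed {v | P v})
    (h : ∀ (φ : E d → E d) (hφ : IsTest S φ), P (ofTest hφ)) {v : H1 S} (hv : v ∈ H10 S) : P v := by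
  -- The generating family is already stable under sums and multiples, so the span adds nothing to
  -- it; by `H1_ext` each of its elements is an `ofTest`.
  have key : ∀ w ∈ Submodule.span ℝ {w : H1 S | ∃ φ : E d → E d, ContDiff ℝ ∞ φ ∧
      HasCompactSupport φ ∧ tsupport φ ⊆ S ∧ fn w =ᵐ[volume.restrict S] φ},
      ∃ (φ : E d → E d), IsTest S φ ∧ fn w =ᵐ[volume.restrict S] φ := by
    intro w hw
    induction hw using Submodule.span_induction with
    | mem x hx =>
      obtain ⟨φ, h1, h2, h3, h4⟩ := hx
      exact ⟨φ, ⟨h1, h2, h3⟩, h4⟩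
    | zero => exact ⟨fun _ => 0, IsTest.zero, Lp.coeFn_zero _ _ _⟩
    | add x y _ _ hx hy =>
      obtain ⟨φ, h1, h2⟩ := hx
      obtain ⟨ψ, h3, h4⟩ := hy
      refine ⟨_, h1.add h3, ?_⟩
      change (fn x + fn y : L2V S) =ᵐ[_] _
      filter_upwards [h2, h4, Lp.coeFn_add (fn x) (fn y)] with z e1 e2 e3
      rw [e3, Pi.add_apply, e1, e2]
    | smul a x _ hx =>
      obtain ⟨φ, h1, h2⟩ := hx
      refine ⟨_, h1.const_smul a, ?_⟩
      change (a • fn x : L2V S) =ᵐ[_] _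
      filter_upwards [h2, Lp.coeFn_smul a (fn x)] with z e1 e2
      rw [e2, Pi.smul_apply, e1]
  have hsub : ∀ w ∈ Submodule.span ℝ {w : H1 S | ∃ φ : E d → E d, ContDiff ℝ ∞ φ ∧
      HasCompactSupport φ ∧ tsupport φ ⊆ S ∧ fn w =ᵐ[volume.restrict S] φ}, P w := by
    intro w hw
    obtain ⟨φ, h1, h2⟩ := key w hw
    have : w = ofTest h1 := by
      apply H1_ext hS
      apply Lp.ext
      rw [fn_ofTest]
      exact h2.trans h1.coe_toL2.symm
    rw [this]
    exact h φ h1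
  exact closure_minimal (s := (Submodule.span ℝ {w : H1 S | ∃ φ : E d → E d, ContDiff ℝ ∞ φ ∧
      HasCompactSupport φ ∧ tsupport φ ⊆ S ∧ fn w =ᵐ[volume.restrict S] φ} : Set (H1 S)))
      (t := {v | P v}) hsub hP hv

end Sobolev

/-! ### Mollification and the weak chain rule -/

section Mollify

variable {d : ℕ} {S : Set (E d)}

/-- Mollification of `g` by the normalised bump function `ρ`. -/
def mollify (ρ : ContDiffBump (0 : E d)) (g : E d → ℝ) : E d → ℝ :=
  convolution (ρ.normed volume) g (ContinuousLinearMap.lsmul ℝ ℝ) volume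

lemma mollify_apply (ρ : ContDiffBump (0 : E d)) (g : E d → ℝ) (s : E d) :
    mollify ρ g s = ∫ t, ρ.normed volume (s - t) * g t := by
  rw [mollify, convolution_lsmul_swap]
  rfl

lemma contDiff_mollify (ρ : ContDiffBump (0 : E d)) {g : E d → ℝ}
    (hg : LocallyIntegrable g volume) : ContDiff ℝ ∞ (mollify ρ g) :=
  ρ.hasCompactSupport_normed.contDiff_convolution_left _ ρ.contDiff_normed hg

lemma isTest_translate (ρ : ContDiffBump (0 : E d)) {s : E d}
    (h : Metric.closedBall s ρ.rOut ⊆ S) : IsTest S fun t => ρ.normed volume (s - t) := by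
  have hsupp : tsupport (fun t => ρ.normed volume (s - t)) ⊆ Metric.closedBall s ρ.rOut := by
    refine closure_minimal (fun t ht => ?_) Metric.isClosed_closedBall
    have : s - t ∈ tsupport (ρ.normed volume) := subset_tsupport _ ht
    rw [ρ.tsupport_normed_eq, mem_closedBall_zero_iff] at this
    rwa [Metric.mem_closedBall, dist_comm, dist_eq_norm]
  exact ⟨ρ.contDiff_normed.comp (contDiff_const.sub contDiff_id),
    HasCompactSupport.of_support_subset_isCompact (isCompact_closedBall s ρ.rOut)
      ((subset_tsupport _).trans hsupp), hsupp.trans h⟩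

/-- When the ball lies in `S`, the translated kernel `t ↦ ρ (s - t)` is itself a test function in
`S`. The derivative falls on the kernel and the weak identity moves it to `x`; the sign from the
reflection cancels the sign from the integration by parts. -/
lemma pd_mollify (hS : IsOpen S) (ρ : ContDiffBump (0 : E d)) {x g : E d → ℝ}
    (hx : LocallyIntegrable (S.indicator x) volume) {j : Fin d}
    (hw : ∀ ψ : E d → ℝ, IsTest S ψ → ∫ t in S, x t * pd j ψ t = - ∫ t in S, g t * ψ t)
    {s : E d} (hs : Metric.closedBall s ρ.rOut ⊆ S) :
    pd j (mollify ρ (S.indicator x)) s = mollify ρ (S.indicator g) s := by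
  have hc : HasCompactSupport (ρ.normed (volume : Measure (E d))) := ρ.hasCompactSupport_normed
  have h1 : ContDiff ℝ 1 (ρ.normed (volume : Measure (E d))) := ρ.contDiff_normed
  have hd := (hc.hasFDerivAt_convolution_left (ContinuousLinearMap.lsmul ℝ ℝ) h1 hx s).fderiv
  have hex := (hc.fderiv ℝ).convolutionExists_left
    (ContinuousLinearMap.precompL (E d) (ContinuousLinearMap.lsmul ℝ ℝ))
    (h1.continuous_fderiv (by simp)) hx s
  have e0 : pd j (mollify ρ (S.indicator x)) s
      = ∫ t, fderiv ℝ (ρ.normed volume) t (EuclideanSpace.single j 1) * S.indicator x (s - t) := by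
    change fderiv ℝ (convolution _ _ _ _) s _ = _
    rw [hd, convolution_def, ContinuousLinearMap.integral_apply hex]
    rfl
  have e1 : ∫ t, fderiv ℝ (ρ.normed volume) t (EuclideanSpace.single j 1) * S.indicator x (s - t)
      = ∫ t, fderiv ℝ (ρ.normed volume) (s - t) (EuclideanSpace.single j 1) * S.indicator x t := by
    rw [← integral_sub_left_eq_self _ _ s]
    simp
  have hpd : ∀ t, pd j (fun t => ρ.normed volume (s - t)) t
      = - fderiv ℝ (ρ.normed volume) (s - t) (EuclideanSpace.single j 1) := by
    intro t
    have := ((h1.differentiable (by simp)).differentiableAt (x := s - t)).hasFDerivAt.comp t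
      ((hasFDerivAt_const s t).sub (hasFDerivAt_id t))
    have h2 := this.fderiv
    change fderiv ℝ (ρ.normed volume ∘ fun t => s - t) t _ = _
    erw [h2]
    simp
  have hi : ∀ f g' : E d → ℝ, ∫ t, f t * S.indicator g' t = ∫ t in S, g' t * f t := by
    intro f g'
    rw [← integral_indicator hS.measurableSet]
    congr 1
    ext t
    by_cases ht : t ∈ S <;> simp [ht, mul_comm]
  rw [e0, e1, mollify_apply, hi, hi, ← neg_neg (∫ t in S, g t * _),
    ← hw _ (isTest_translate ρ hs), ← integral_neg]
  congr 1
  ext t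
  rw [hpd]
  ring

lemma abs_mollify_le (ρ : ContDiffBump (0 : E d)) {g : E d → ℝ} {M : ℝ}
    (hM : ∀ t, |g t| ≤ M) (s : E d) : |mollify ρ g s| ≤ M := by
  have hi : Integrable (fun t => ρ.normed volume (s - t)) (volume : Measure (E d)) :=
    (ρ.integrable_normed (μ := (volume : Measure (E d)))).comp_sub_left s
  rw [mollify_apply, ← Real.norm_eq_abs]
  refine (norm_integral_le_of_norm_le (hi.mul_const M) (ae_of_all _ fun t => ?_)).trans_eq ?_
  · rw [norm_mul, Real.norm_eq_abs, Real.norm_eq_abs, abs_of_nonneg (ρ.nonneg_normed _)]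
    exact mul_le_mul_of_nonneg_left (hM t) (ρ.nonneg_normed _)
  · rw [integral_mul_const, integral_sub_left_eq_self (ρ.normed volume), ρ.integral_normed, one_mul]

/-- Bump functions whose supports shrink to the origin. -/
def bumpSeq (d : ℕ) (n : ℕ) : ContDiffBump (0 : E d) where
  rIn := 1 / ((n : ℝ) + 1)
  rOut := 2 * (1 / ((n : ℝ) + 1))
  rIn_pos := by positivity
  rIn_lt_rOut := by
    have : (0 : ℝ) < 1 / ((n : ℝ) + 1) := by positivity
    linarith

lemma tendsto_bumpSeq : Filter.Tendsto (fun n => (bumpSeq d n).rOut) Filter.atTop (nhds 0) := by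
  simpa [bumpSeq] using (tendsto_one_div_add_atTop_nhds_zero_nat (𝕜 := ℝ)).const_mul 2

/-- The two radii of `bumpSeq` have the fixed ratio 2. Such a bound `K` on the ratio is what
convergence at almost every point requires. -/
lemma mollify_tendsto {g : E d → ℝ} (hg : LocallyIntegrable g volume) :
    ∀ᵐ s : E d, Filter.Tendsto (fun n => mollify (bumpSeq d n) g s) Filter.atTop (nhds (g s)) :=
  ContDiffBump.ae_convolution_tendsto_right_of_locallyIntegrable tendsto_bumpSeq
    (K := 2) (Filter.Eventually.of_forall fun _ => le_rfl) hg

lemma fderiv_eq_sum_pd (f : E d → ℝ) (x v : E d) :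
    fderiv ℝ f x v = ∑ k, v k * pd k f x := by
  have hv : v = ∑ k, v k • EuclideanSpace.single k (1 : ℝ) := by
    ext i
    simp [Finset.sum_apply, Pi.single_apply]
  conv_lhs => rw [hv]
  simp [map_sum]

/-- Chain rule for the composition of a test function with a bounded function with bounded weak
gradient. -/
lemma weak_chain_rule (hS : IsOpen S) {X : E d → E d} (hX : MemLp X ∞ (volume.restrict S))
    {G : E d → Tensor d} (hG : MemLp G ∞ (volume.restrict S)) (hw : HasWeakGrad S X G)
    {f : E d → ℝ} {S' : Set (E d)} (hf : IsTest S' f) {ψ : E d → ℝ} (hψ : IsTest S ψ) (j : Fin d) :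
    ∫ s in S, f (X s) * pd j ψ s = - ∫ s in S, (∑ k, G s (k, j) * pd k f (X s)) * ψ s := by
  obtain ⟨M, hM0, hM⟩ : ∃ M : ℝ, 0 ≤ M ∧ ∀ᵐ s ∂(volume.restrict S), ‖G s‖ ≤ M := by
    refine ⟨(eLpNormEssSup G (volume.restrict S)).toReal, ENNReal.toReal_nonneg, ?_⟩
    filter_upwards [ae_le_eLpNormEssSup (f := G) (μ := volume.restrict S)] with s hs
    have hfin : eLpNormEssSup G (volume.restrict S) ≠ ⊤ := by
      have := hG.2.ne
      rwa [eLpNorm_exponent_top] at this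
    rw [← toReal_enorm]
    exact ENNReal.toReal_mono hfin hs
  -- bounded representatives of the columns of the gradient
  let g : Fin d → E d → ℝ := fun k s => if ‖G s‖ ≤ M then G s (k, j) else 0
  -- The truncation changes `G` only on a null set, but makes the bound hold at every point, as
  -- `abs_mollify_le` needs.
  have hgM : ∀ k s, |S.indicator (g k) s| ≤ M := by
    intro k s
    by_cases hs : s ∈ S
    · simp only [hs, indicator_of_mem, g]
      split_ifs with h
      · exact (PiLp.norm_apply_le (G s) (k, j)).trans h
      · simpa using hM0
    · simpa [hs] using hM0
  have hgG : ∀ᵐ s ∂(volume.restrict S), ∀ k, g k s = G s (k, j) := by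
    filter_upwards [hM] with s hs k
    simp [g, hs]
  have hxl : ∀ k, LocallyIntegrable (S.indicator fun s => X s k) volume := by
    intro k
    have h1 : MemLp (fun s => X s k) ∞ (volume.restrict S) :=
      (EuclideanSpace.proj (𝕜 := ℝ) k).comp_memLp' hX
    exact ((memLp_indicator_iff_restrict hS.measurableSet).2 h1).locallyIntegrable (by simp)
  have hgl : ∀ k, LocallyIntegrable (S.indicator (g k)) volume := by
    intro k
    have h1 : MemLp (fun s => G s (k, j)) ∞ (volume.restrict S) :=
      (EuclideanSpace.proj (𝕜 := ℝ) (k, j)).comp_memLp' hG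
    have h2 : MemLp (g k) ∞ (volume.restrict S) := by
      refine h1.ae_eq ?_
      filter_upwards [hgG] with s hs using (hs k).symm
    exact ((memLp_indicator_iff_restrict hS.measurableSet).2 h2).locallyIntegrable (by simp)
  have hwk : ∀ k, ∀ φ : E d → ℝ, IsTest S φ →
      ∫ t in S, X t k * pd j φ t = - ∫ t in S, g k t * φ t := by
    intro k φ hφ
    rw [hw φ hφ.smooth hφ.compact hφ.supp k j]
    congr 1
    apply integral_congr_ae
    filter_upwards [hgG] with s hs
    rw [hs k]
  -- The inner map is mollified. On the support of `ψ`, for large `n`, the classical chain rule and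
  -- `pd_mollify` give the derivative of `f ∘ Y n` as `H n`; dominated convergence passes to the
  -- limit on both sides of the resulting identity.
  let Y : ℕ → E d → E d := fun n s =>
    WithLp.toLp 2 fun k => mollify (bumpSeq d n) (S.indicator fun s => X s k) s
  have hY : ∀ n, ContDiff ℝ ∞ (Y n) := fun n =>
    contDiff_euclidean.2 fun k => contDiff_mollify _ (hxl k)
  let H : ℕ → E d → ℝ := fun n s =>
    ∑ k, mollify (bumpSeq d n) (S.indicator (g k)) s * pd k f (Y n s)
  -- identity for the mollified functions
  obtain ⟨δ, hδ, hδS⟩ := hψ.compact.isCompact.exists_cthickening_subset_open hS hψ.supp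
  have hev : ∀ᶠ n in Filter.atTop, (bumpSeq d n).rOut ≤ δ :=
    (tendsto_bumpSeq.eventually (gt_mem_nhds hδ)).mono fun n hn => hn.le
  have hYd : ∀ n, (bumpSeq d n).rOut ≤ δ → ∀ s ∈ tsupport ψ,
      pd j (fun s => f (Y n s)) s = H n s := by
    intro n hn s hs
    have hball : Metric.closedBall s (bumpSeq d n).rOut ⊆ S :=
      (Metric.closedBall_subset_closedBall hn).trans
        ((Metric.closedBall_subset_cthickening hs δ).trans hδS)
    have hYn := ((hY n).differentiable (by simp)).differentiableAt (x := s)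
    have h1 := (hf.differentiable.differentiableAt.hasFDerivAt.comp s hYn.hasFDerivAt).fderiv
    change fderiv ℝ (f ∘ Y n) s _ = _
    rw [h1]
    change fderiv ℝ f (Y n s) (fderiv ℝ (Y n) s (EuclideanSpace.single j 1)) = _
    rw [fderiv_eq_sum_pd]
    refine Finset.sum_congr rfl fun k _ => ?_
    rw [← fderiv_coord k hYn]
    congr 1
    exact pd_mollify hS _ (hxl k) (hwk k) hball
  have hid : ∀ᶠ n in Filter.atTop,
      ∫ s in S, f (Y n s) * pd j ψ s = - ∫ s in S, H n s * ψ s := by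
    filter_upwards [hev] with n hn
    have hfY : ContDiff ℝ ∞ fun s => f (Y n s) := hf.smooth.comp (hY n)
    have hz : ∀ {a b : E d → ℝ}, IsTest S b → ∫ x in S, a x * b x = ∫ x, a x * b x := fun hb =>
      setIntegral_eq_integral_of_forall_compl_eq_zero fun x hx => by simp [hb.zero_of_notMem hx]
    have hc : ∀ {a b : E d → ℝ}, Continuous a → IsTest S b → Integrable (fun x => a x * b x) :=
      fun ha hb => (ha.mul hb.continuous).integrable_of_hasCompactSupport hb.compact.mul_left
    rw [hz (hψ.pd j), hz hψ]
    have h1 := integral_mul_fderiv_eq_neg_fderiv_mul_of_integrable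
      (μ := (volume : Measure (E d))) (v := EuclideanSpace.single j 1)
      (hc ((hfY.continuous_fderiv (by simp)).clm_apply continuous_const) hψ)
      (hc hfY.continuous (hψ.pd j)) (hc hfY.continuous hψ)
      (fun x _ => (hfY.differentiable (by simp)).differentiableAt)
      (fun x _ => hψ.differentiable.differentiableAt)
    rw [h1]
    congr 2
    ext s
    by_cases hs : s ∈ tsupport ψ
    · rw [← hYd n hn s hs]
    · simp [image_eq_zero_of_notMem_tsupport hs]
  -- pointwise limits
  have hYlim : ∀ᵐ s ∂(volume.restrict S),
      Filter.Tendsto (fun n => Y n s) Filter.atTop (nhds (X s)) := by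
    have h1 : ∀ᵐ s ∂(volume.restrict S), ∀ k, Filter.Tendsto
        (fun n => mollify (bumpSeq d n) (S.indicator fun s => X s k) s) Filter.atTop
        (nhds (S.indicator (fun s => X s k) s)) :=
      ae_all_iff.2 fun k => ae_restrict_of_ae (mollify_tendsto (hxl k))
    filter_upwards [h1, ae_restrict_mem hS.measurableSet] with s hs hsS
    have h2 : Filter.Tendsto (fun n k => mollify (bumpSeq d n) (S.indicator fun s => X s k) s)
        Filter.atTop (nhds fun k => X s k) := by
      rw [tendsto_pi_nhds]
      intro k
      simpa [hsS] using hs k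
    exact ((PiLp.continuous_toLp 2 (fun _ : Fin d => ℝ)).tendsto _).comp h2
  have hHlim : ∀ᵐ s ∂(volume.restrict S), Filter.Tendsto (fun n => H n s) Filter.atTop
      (nhds (∑ k, G s (k, j) * pd k f (X s))) := by
    have h1 : ∀ᵐ s ∂(volume.restrict S), ∀ k, Filter.Tendsto
        (fun n => mollify (bumpSeq d n) (S.indicator (g k)) s) Filter.atTop
        (nhds (S.indicator (g k) s)) :=
      ae_all_iff.2 fun k => ae_restrict_of_ae (mollify_tendsto (hgl k))
    filter_upwards [h1, hYlim, hgG, ae_restrict_mem hS.measurableSet] with s hs hYs hgs hsS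
    refine tendsto_finsetSum _ fun k _ => ?_
    have h2 := hs k
    rw [indicator_of_mem hsS, hgs k] at h2
    exact h2.mul (((hf.pd k).continuous.tendsto _).comp hYs)
  obtain ⟨C, hC⟩ := hf.continuous.bounded_above_of_compact_support hf.compact
  have hCk : ∀ k, ∃ C, ∀ x, ‖pd k f x‖ ≤ C := fun k =>
    (hf.pd k).continuous.bounded_above_of_compact_support (hf.pd k).compact
  choose D hD using hCk
  have hint : ∀ {a : E d → ℝ}, IsTest S a → Integrable a (volume.restrict S) := fun ha =>
    (ha.continuous.integrable_of_hasCompactSupport ha.compact).restrict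
  have l1 : Filter.Tendsto (fun n => ∫ s in S, f (Y n s) * pd j ψ s) Filter.atTop
      (nhds (∫ s in S, f (X s) * pd j ψ s)) := by
    refine tendsto_integral_of_dominated_convergence (fun s => C * ‖pd j ψ s‖)
      (fun n => ((hf.continuous.comp (hY n).continuous).mul
        (hψ.pd j).continuous).aestronglyMeasurable) ((hint (hψ.pd j)).norm.const_mul C)
      (fun n => ae_of_all _ fun s => ?_) ?_
    · rw [norm_mul]
      exact mul_le_mul_of_nonneg_right (hC _) (norm_nonneg _)
    · filter_upwards [hYlim] with s hs
      exact ((hf.continuous.tendsto _).comp hs).mul_const _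
  have l2 : Filter.Tendsto (fun n => ∫ s in S, H n s * ψ s) Filter.atTop
      (nhds (∫ s in S, (∑ k, G s (k, j) * pd k f (X s)) * ψ s)) := by
    have hHc : ∀ n, Continuous (H n) := fun n => continuous_finsetSum _ fun k _ =>
      (contDiff_mollify _ (hgl k)).continuous.mul ((hf.pd k).continuous.comp (hY n).continuous)
    refine tendsto_integral_of_dominated_convergence (fun s => (∑ k, M * D k) * ‖ψ s‖)
      (fun n => ((hHc n).mul hψ.continuous).aestronglyMeasurable)
      ((hint hψ).norm.const_mul _)
      (fun n => ae_of_all _ fun s => ?_) ?_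
    · rw [norm_mul]
      refine mul_le_mul_of_nonneg_right ?_ (norm_nonneg _)
      refine (norm_sum_le _ _).trans (Finset.sum_le_sum fun k _ => ?_)
      rw [norm_mul]
      exact mul_le_mul (abs_mollify_le _ (hgM k) s) (hD k _) (norm_nonneg _) hM0
    · filter_upwards [hHlim] with s hs
      exact hs.mul_const _
  exact tendsto_nhds_unique (l1.congr' hid) l2.neg

end Mollify

/-! ### Composition with the expanding map -/

section Composition

variable {d : ℕ} {Ω B : Set (E d)}

/-- A map which expands distances by a factor at least `m` pulls volumes back with a factor at
most `m⁻ᵈ`. -/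
lemma volume_le_of_expanding {Xb : E d → E d} {m : ℝ} (hm : 0 < m)
    (hinv : ∀ s ∈ B, ∀ t ∈ B, m * ‖s - t‖ ≤ ‖Xb s - Xb t‖) {T : Set (E d)} (hT : T ⊆ B) :
    volume T ≤ (Real.toNNReal m⁻¹ : ℝ≥0∞) ^ d * volume (Xb '' T) := by
  let f : B → E d := fun s => Xb s
  have hf : AntilipschitzWith (Real.toNNReal m⁻¹) f := by
    refine AntilipschitzWith.of_le_mul_dist fun s t => ?_
    rw [Real.coe_toNNReal _ (inv_nonneg.2 hm.le), Subtype.dist_eq, dist_eq_norm, dist_eq_norm,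
      inv_mul_eq_div, le_div_iff₀ hm, mul_comm]
    exact hinv s s.2 t t.2
  have hfin : (Module.finrank ℝ (E d) : ℝ) = d := by simp
  -- Lebesgue measure is a constant multiple of the d-dimensional Hausdorff measure, for which the
  -- antilipschitz estimate holds on arbitrary sets, so the measurability of the image plays no
  -- role. The multiple appears on both sides.
  have hc := Measure.isAddLeftInvariant_eq_smul (volume : Measure (E d))
    (Measure.hausdorffMeasure (X := E d) (Module.finrank ℝ (E d)))
  have h1 := hf.le_hausdorffMeasure_image (d := (Module.finrank ℝ (E d) : ℝ)) (by positivity)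
    ((↑) ⁻¹' T : Set B)
  have e1 : ((↑) : B → E d) '' ((↑) ⁻¹' T : Set B) = T := by
    rw [Subtype.image_preimage_coe, inter_eq_right.2 hT]
  have e2 : f '' ((↑) ⁻¹' T : Set B) = Xb '' T := by
    conv_rhs => rw [← e1]
    rw [image_image]
  have e3 := isometry_subtype_coe.hausdorffMeasure_image (d := (Module.finrank ℝ (E d) : ℝ))
    (Or.inl (by positivity)) ((↑) ⁻¹' T : Set B)
  rw [← e3, e1, e2] at h1
  rw [hc]
  simp only [Measure.smul_apply]
  have h2 : (Real.toNNReal m⁻¹ : ℝ≥0∞) ^ (Module.finrank ℝ (E d) : ℝ)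
      = (Real.toNNReal m⁻¹ : ℝ≥0∞) ^ d := by
    rw [hfin, ENNReal.rpow_natCast]
  rw [h2] at h1
  simp only [ENNReal.smul_def, smul_eq_mul]
  rw [mul_left_comm]
  gcongr

/-- This replaces the change of variables formula. Null sets of `Ω` pull back to null sets of `B`,
so `v ∘ Xb` does not depend on the representative of `v`, and its L² norm is at most m^(-d/2) times
that of `v`. -/
lemma map_restrict_le (hB : IsOpen B) {Xb : E d → E d}
    (hX : AEMeasurable Xb (volume.restrict B)) (hmaps : MapsTo Xb B Ω) {m : ℝ} (hm : 0 < m)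
    (hinv : ∀ s ∈ B, ∀ t ∈ B, m * ‖s - t‖ ≤ ‖Xb s - Xb t‖) :
    Measure.map Xb (volume.restrict B)
      ≤ ((Real.toNNReal m⁻¹ : ℝ≥0∞) ^ d) • volume.restrict Ω := by
  refine Measure.le_iff.2 fun A hA => ?_
  rw [Measure.map_apply_of_aemeasurable hX hA, Measure.restrict_apply' hB.measurableSet,
    Measure.smul_apply, Measure.restrict_apply hA, smul_eq_mul]
  refine (volume_le_of_expanding hm hinv inter_subset_right).trans ?_
  gcongr
  rintro _ ⟨s, ⟨h1, h2⟩, rfl⟩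
  exact ⟨h1, hmaps h2⟩

lemma ae_comp {Xb : E d → E d} {M : ℝ≥0∞} (hX : AEMeasurable Xb (volume.restrict B))
    (hle : Measure.map Xb (volume.restrict B) ≤ M • volume.restrict Ω) {p : E d → Prop} (h : ∀ᵐ x ∂(volume.restrict Ω), p x) :
    ∀ᵐ s ∂(volume.restrict B), p (Xb s) :=
  ae_of_ae_map hX ((Measure.absolutelyContinuous_of_le_smul hle).ae_le h)

lemma memLp_comp {F : Type*} [NormedAddCommGroup F] {Xb : E d → E d} {M : ℝ≥0∞} (hM : M ≠ ⊤)
    (hX : AEMeasurable Xb (volume.restrict B))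
    (hle : Measure.map Xb (volume.restrict B) ≤ M • volume.restrict Ω) (v : Lp F 2 (volume.restrict Ω)) :
    MemLp (fun s => v (Xb s)) 2 (volume.restrict B) := by
  have h := (Lp.memLp v).of_measure_le_smul hM hle
  exact (memLp_map_measure_iff h.1 hX).1 h

variable {F : Type*} [NormedAddCommGroup F] [NormedSpace ℝ F]

section

variable {Xb : E d → E d} {M : ℝ≥0∞} (hM : M ≠ ⊤) (hX : AEMeasurable Xb (volume.restrict B))
  (hle : Measure.map Xb (volume.restrict B) ≤ M • volume.restrict Ω)

/-- Composition with `Xb` as an operator on `L²`. -/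
def compLp : Lp F 2 (volume.restrict Ω) →L[ℝ] Lp F 2 (volume.restrict B) :=
  LinearMap.mkContinuous
    { toFun := fun v => (memLp_comp hM hX hle v).toLp
      map_add' := by
        intro v w
        apply Lp.ext
        filter_upwards [(memLp_comp hM hX hle v).coeFn_toLp, (memLp_comp hM hX hle w).coeFn_toLp,
          (memLp_comp hM hX hle (v + w)).coeFn_toLp,
          Lp.coeFn_add (memLp_comp hM hX hle v).toLp (memLp_comp hM hX hle w).toLp,
          ae_comp hX hle (Lp.coeFn_add v w)] with s h1 h2 h3 h4 h5
        rw [h3, h4, Pi.add_apply, h1, h2, h5, Pi.add_apply]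
      map_smul' := by
        intro a v
        apply Lp.ext
        filter_upwards [(memLp_comp hM hX hle v).coeFn_toLp,
          (memLp_comp hM hX hle (a • v)).coeFn_toLp,
          Lp.coeFn_smul a (memLp_comp hM hX hle v).toLp,
          ae_comp hX hle (Lp.coeFn_smul a v)] with s h1 h3 h4 h5
        rw [h3, RingHom.id_apply, h4, Pi.smul_apply, h1, h5, Pi.smul_apply] }
    (M ^ ((1 : ℝ≥0∞) / 2).toReal).toReal (by
      intro v
      have h := (Lp.memLp v).of_measure_le_smul hM hle
      change ‖(memLp_comp hM hX hle v).toLp‖ ≤ _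
      rw [Lp.norm_toLp, Lp.norm_def, ← ENNReal.toReal_mul]
      have e : eLpNorm (fun s => v (Xb s)) 2 (volume.restrict B)
          = eLpNorm v 2 (Measure.map Xb (volume.restrict B)) :=
        (eLpNorm_map_measure h.1 hX).symm
      rw [e]
      refine ENNReal.toReal_mono ?_ ?_
      · exact ENNReal.mul_ne_top (ENNReal.rpow_ne_top_of_nonneg ENNReal.toReal_nonneg hM)
          (Lp.eLpNorm_ne_top v)
      · refine (eLpNorm_mono_measure _ hle).trans_eq ?_
        rw [eLpNorm_smul_measure_of_ne_top (by simp), smul_eq_mul])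

lemma compLp_coe (v : Lp F 2 (volume.restrict Ω)) :
    compLp hM hX hle v =ᵐ[volume.restrict B] fun s => v (Xb s) :=
  (memLp_comp hM hX hle v).coeFn_toLp

end

/-- The matrix product `(A G)_{ij} = ∑ₖ A_{ik} G_{kj}`. -/
def tensorMul (d : ℕ) : Tensor d →L[ℝ] Tensor d →L[ℝ] Tensor d :=
  LinearMap.toContinuousBilinearMap (LinearMap.mk₂ ℝ
    (fun A G : Tensor d => (WithLp.toLp 2 fun ij => ∑ k, A (ij.1, k) * G (k, ij.2) : Tensor d))
    (by intro A A' G; ext ij; simp [add_mul, Finset.sum_add_distrib])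
    (by intro a A G; ext ij; simp [mul_assoc, Finset.mul_sum])
    (by intro A G G'; ext ij; simp [mul_add, Finset.sum_add_distrib])
    (by intro a A G; ext ij; simp [mul_left_comm, Finset.mul_sum]))

lemma tensorMul_apply (A G : Tensor d) (i j : Fin d) :
    tensorMul d A G (i, j) = ∑ k, A (i, k) * G (k, j) := rfl

/-- Composition with a bounded expanding map with bounded weak gradient maps `H¹₀(Ω)^d`
boundedly to `H¹(B)^d`. -/
theorem exists_comp (hΩ : IsOpen Ω) (hB : IsOpen B) {Xb : E d → E d} (hXb : MemW1inf B Xb)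
    (hmaps : MapsTo Xb B Ω) {m : ℝ} (hm : 0 < m)
    (hinv : ∀ s ∈ B, ∀ t ∈ B, m * ‖s - t‖ ≤ ‖Xb s - Xb t‖) :
    ∃ K : H10 Ω →L[ℝ] H1 B, ∀ v : H10 Ω, IsComp Xb (v : H1 Ω) (K v) := by
  obtain ⟨hXm, G, hGm, hG⟩ := hXb
  have hX : AEMeasurable Xb (volume.restrict B) := hXm.1.aemeasurable
  have hle := map_restrict_le hB hX hmaps hm hinv
  have hM : (Real.toNNReal m⁻¹ : ℝ≥0∞) ^ d ≠ ⊤ := ENNReal.pow_ne_top ENNReal.coe_ne_top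
  let mulG : L2T B →L[ℝ] L2T B :=
    (tensorMul d).flip.holderL (volume.restrict B) ⊤ 2 2 (hGm.toLp G)
  have hmulG : ∀ A : L2T B, mulG A =ᵐ[volume.restrict B] fun s => tensorMul d (A s) (G s) := by
    intro A
    filter_upwards [(tensorMul d).flip.coeFn_holder (r := 2) (hGm.toLp G) A, hGm.coeFn_toLp]
      with s h1 h2
    change ((tensorMul d).flip.holder 2 (hGm.toLp G) A) s = _
    rw [h1, h2]
    rfl
  let T : H1 Ω →L[ℝ] WithLp 2 (L2V B × L2T B) :=
    ((WithLp.prodContinuousLinearEquiv 2 ℝ (L2V B) (L2T B)).symm : _ →L[ℝ] _).comp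
      (((compLp hM hX hle).comp (fnL Ω)).prod (mulG.comp ((compLp hM hX hle).comp (gradL Ω))))
  have hT1 : ∀ v : H1 Ω, (T v).fst = compLp hM hX hle (fn v) := fun v => rfl
  have hT2 : ∀ v : H1 Ω, (T v).snd = mulG (compLp hM hX hle (grad v)) := fun v => rfl
  -- `T` is continuous on all of `H1 Ω` and `H1 B` is closed, so only test fields need checking;
  -- there the claim is the weak chain rule.
  have hmem : ∀ v ∈ H10 Ω, T v ∈ H1 B := by
    intro v hv
    refine H10_induction hΩ (P := fun v => T v ∈ H1 B) (isClosed_H1.preimage T.continuous) ?_ hv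
    intro φ hφ ψ h1 h2 h3 i j
    have hψ : IsTest B ψ := ⟨h1, h2, h3⟩
    have e1 : ∫ s in B, (T (ofTest hφ)).fst s i * fderiv ℝ ψ s (EuclideanSpace.single j 1)
        = ∫ s in B, φ (Xb s) i * pd j ψ s := by
      apply integral_congr_ae
      rw [hT1]
      filter_upwards [compLp_coe hM hX hle (fn (ofTest hφ)), ae_comp hX hle hφ.coe_toL2]
        with s h4 h5
      rw [h4, fn_ofTest, h5]
    have e2 : ∫ s in B, (T (ofTest hφ)).snd s (i, j) * ψ s
        = ∫ s in B, (∑ k, G s (k, j) * pd k (fun x => φ x i) (Xb s)) * ψ s := by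
      apply integral_congr_ae
      rw [hT2]
      filter_upwards [hmulG (compLp hM hX hle (grad (ofTest hφ))),
        compLp_coe hM hX hle (grad (ofTest hφ)), ae_comp hX hle hφ.gradFun.coe_toL2]
        with s h4 h5 h6
      rw [h4, tensorMul_apply]
      congr 1
      refine Finset.sum_congr rfl fun k _ => ?_
      rw [h5, grad_ofTest, h6, mul_comm, pd, fderiv_coord i hφ.differentiable.differentiableAt]
      rfl
    rw [e1, e2]
    exact weak_chain_rule hB hXm hGm hG (hφ.coord i) hψ j
  refine ⟨(T.comp (H10 Ω).subtypeL).codRestrict (H1 B) fun v => hmem v v.2, fun v => ?_⟩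
  exact compLp_coe hM hX hle (fn (v : H1 Ω))

lemma isComp_unique (hB : IsOpen B) {Xb : E d → E d} {v : H1 Ω} {w w' : H1 B}
    (h : IsComp Xb v w) (h' : IsComp Xb v w') : w = w' :=
  H1_ext hB (Lp.ext (h.trans h'.symm))

lemma comp_eq (hB : IsOpen B) {Xb : E d → E d} {v : H1 Ω} {w : H1 B} (h : IsComp Xb v w) :
    comp B Xb v = w := by
  have hex : ∃ w : H1 B, IsComp Xb v w := ⟨w, h⟩
  rw [comp, dif_pos hex]
  exact isComp_unique hB hex.choose_spec h

end Composition

/-! ### Bilinear forms, Korn and Poincaré inequalities -/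

section Forms

variable {d : ℕ} {Ω B : Set (E d)}

/-- The divergence as an operator from `H¹(Ω)^d` to `L²(Ω)`. -/
def divL (Ω : Set (E d)) : H1 Ω →L[ℝ] L2 Ω := ∑ i : Fin d, (coordL Ω (i, i)).comp (gradL Ω)

lemma divL_apply (v : H1 Ω) : divL Ω v = ∑ i : Fin d, coordL Ω (i, i) (grad v) := by
  simp [divL]

lemma divL_coe (v : H1 Ω) : divL Ω v =ᵐ[volume.restrict Ω] fun x => ∑ i, grad v x (i, i) := by
  have h1 : ∀ᵐ x ∂(volume.restrict Ω), ∀ i : Fin d, coordL Ω (i, i) (grad v) x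
      = grad v x (i, i) := ae_all_iff.2 fun i => coordL_coe _ _
  rw [divL_apply]
  filter_upwards [h1, Lp.coeFn_finsetSum Finset.univ fun i : Fin d => coordL Ω (i, i) (grad v)]
    with x h2 h3
  rw [h3, Finset.sum_apply]
  exact Finset.sum_congr rfl fun i _ => h2 i

lemma divForm_eq (v : H1 Ω) (q : L2 Ω) : divForm v q = inner ℝ (divL Ω v) q := by
  rw [L2.inner_def, divForm]
  apply integral_congr_ae
  filter_upwards [divL_coe v] with x h1
  rw [h1]
  simp [mul_comm]

/-- The symmetric part of a tensor. -/
def symT (d : ℕ) : Tensor d →L[ℝ] Tensor d :=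
  LinearMap.toContinuousLinearMap
    { toFun := fun A => WithLp.toLp 2 fun ij => (1 / 2) * (A (ij.1, ij.2) + A (ij.2, ij.1))
      map_add' := by intro A A'; ext ij; simp; ring
      map_smul' := by intro a A; ext ij; simp; ring }

lemma symT_apply (A : Tensor d) (i j : Fin d) :
    symT d A (i, j) = (1 / 2) * (A (i, j) + A (j, i)) := rfl

/-- The symmetric gradient as an operator from `H¹(Ω)^d` to `L²(Ω)^{d × d}`. -/
def symL (Ω : Set (E d)) : H1 Ω →L[ℝ] L2T Ω :=
  ((symT d).compLpL 2 (volume.restrict Ω)).comp (gradL Ω)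

lemma symL_coe (v : H1 Ω) :
    ∀ᵐ x ∂(volume.restrict Ω), ∀ i j, symL Ω v x (i, j) = symGrad v x i j := by
  filter_upwards [ContinuousLinearMap.coeFn_compLpL (symT d) (grad v)] with x h i j
  change ((symT d).compLpL 2 (volume.restrict Ω) (grad v)) x (i, j) = _
  rw [h, symT_apply]
  rfl

lemma coordL_symL (v : H1 Ω) (i j : Fin d) : coordL Ω (i, j) (symL Ω v)
    = (1 / 2 : ℝ) • (coordL Ω (i, j) (grad v) + coordL Ω (j, i) (grad v)) := by
  apply Lp.ext
  filter_upwards [coordL_coe (symL Ω v) (i, j), symL_coe v, coordL_coe (grad v) (i, j),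
    coordL_coe (grad v) (j, i),
    Lp.coeFn_smul (1 / 2 : ℝ) (coordL Ω (i, j) (grad v) + coordL Ω (j, i) (grad v)),
    Lp.coeFn_add (coordL Ω (i, j) (grad v)) (coordL Ω (j, i) (grad v))] with x h1 h2 h3 h4 h5 h6
  rw [h1, h2, h5, Pi.smul_apply, h6, Pi.add_apply, h3, h4]
  rfl

/-- Multiplication by a bounded function on `L²(Ω)^{d × d}`. -/
def mulNu {ν : E d → ℝ} (hν : MemLp ν ⊤ (volume.restrict Ω)) : L2T Ω →L[ℝ] L2T Ω :=
  (ContinuousLinearMap.lsmul ℝ ℝ).holderL (volume.restrict Ω) ⊤ 2 2 (hν.toLp ν)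

lemma mulNu_coe {ν : E d → ℝ} (hν : MemLp ν ⊤ (volume.restrict Ω)) (A : L2T Ω) :
    mulNu hν A =ᵐ[volume.restrict Ω] fun x => ν x • A x := by
  filter_upwards [(ContinuousLinearMap.lsmul ℝ ℝ).coeFn_holder (r := 2) (hν.toLp ν) A,
    hν.coeFn_toLp] with x h1 h2
  change ((ContinuousLinearMap.lsmul ℝ ℝ).holder 2 (hν.toLp ν) A) x = _
  rw [h1, h2]
  rfl

lemma inner_mulNu_symL {ν : E d → ℝ} (hν : MemLp ν ⊤ (volume.restrict Ω)) (u v : H1 Ω) :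
    inner ℝ (mulNu hν (symL Ω u)) (symL Ω v)
      = ∫ x in Ω, ν x * ∑ i : Fin d, ∑ j : Fin d, symGrad u x i j * symGrad v x i j := by
  rw [L2.inner_def]
  apply integral_congr_ae
  filter_upwards [mulNu_coe hν (symL Ω u), symL_coe u, symL_coe v] with x h1 h2 h3
  rw [h1, real_inner_smul_left, PiLp.inner_apply, Fintype.sum_prod_type]
  congr 1
  refine Finset.sum_congr rfl fun i _ => Finset.sum_congr rfl fun j _ => ?_
  rw [h2, h3]
  simp [mul_comm]

lemma aS_self_nonneg {β γ : ℝ} (hβ : 0 ≤ β) (hγ : 0 ≤ γ) (X : H1 B) : 0 ≤ aS β γ X X := by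
  rw [aS, real_inner_self_eq_norm_sq, real_inner_self_eq_norm_sq]
  positivity

lemma mulNu_coercive {ν : E d → ℝ} (hν : MemLp ν ⊤ (volume.restrict Ω)) {ν₀ : ℝ}
    (h : ∀ᵐ x ∂(volume.restrict Ω), ν₀ ≤ ν x) (A : L2T Ω) :
    ν₀ * ‖A‖ ^ 2 ≤ inner ℝ (mulNu hν A) A := by
  rw [← real_inner_self_eq_norm_sq, L2.inner_def, L2.inner_def, ← integral_const_mul]
  refine integral_mono_ae ((L2.integrable_inner A A).const_mul _)
    (L2.integrable_inner (mulNu hν A) A) ?_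
  filter_upwards [h, mulNu_coe hν A] with x h1 h2
  rw [h2, real_inner_smul_left]
  exact mul_le_mul_of_nonneg_right h1 real_inner_self_nonneg

/-- For a test field φ, (∂ⱼuᵢ, ∂ᵢφⱼ) = -(uᵢ, ∂ⱼ∂ᵢφⱼ) = -(uᵢ, ∂ᵢ∂ⱼφⱼ) = (∂ᵢuᵢ, ∂ⱼφⱼ). Only the second
field has to vanish on the boundary. The identity serves both Korn's inequality and the residual of
the vector Laplace problem. -/
lemma sum_inner_transpose (hΩ : IsOpen Ω) (u : H1 Ω) {v : H1 Ω} (hv : v ∈ H10 Ω) :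
    ∑ i : Fin d, ∑ j : Fin d, inner ℝ (coordL Ω (i, j) (grad u)) (coordL Ω (j, i) (grad v))
      = inner ℝ (divL Ω u) (divL Ω v) := by
  refine H10_induction hΩ (P := fun v => ∑ i : Fin d, ∑ j : Fin d,
      inner ℝ (coordL Ω (i, j) (grad u)) (coordL Ω (j, i) (grad v))
      = inner ℝ (divL Ω u) (divL Ω v)) ?_ ?_ hv
  · refine isClosed_eq ?_ ?_
    · exact continuous_finsetSum _ fun i _ => continuous_finsetSum _ fun j _ =>
        continuous_const.inner ((coordL Ω (j, i)).continuous.comp (gradL Ω).continuous)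
    · exact continuous_const.inner (divL Ω).continuous
  · intro φ hφ
    rw [divL_apply, divL_apply, sum_inner]
    refine Finset.sum_congr rfl fun i _ => ?_
    rw [inner_sum]
    refine Finset.sum_congr rfl fun j _ => ?_
    rw [coordL_grad_ofTest, coordL_grad_ofTest]
    have h1 := weak_grad u ((hφ.coord j).pd i) i j
    have h2 := weak_grad u ((hφ.coord j).pd j) i i
    have e : (((hφ.coord j).pd i).pd j).toL2 = (((hφ.coord j).pd j).pd i).toL2 := by
      apply Lp.ext
      filter_upwards [(((hφ.coord j).pd i).pd j).coe_toL2, (((hφ.coord j).pd j).pd i).coe_toL2]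
        with x h3 h4
      rw [h3, h4, pd_comm (hφ.coord j)]
    rw [e] at h1
    linarith

/-- Korn's inequality on `H¹₀(Ω)^d`. -/
lemma korn (hΩ : IsOpen Ω) {v : H1 Ω} (hv : v ∈ H10 Ω) :
    ‖grad v‖ ^ 2 ≤ 2 * ‖symL Ω v‖ ^ 2 := by
  -- With u = v the mixed terms add up to a square, so that 2‖ε(v)‖² = ‖∇v‖² + ‖div v‖².
  have h1 := sum_inner_transpose hΩ v hv
  rw [real_inner_self_eq_norm_sq] at h1
  have h2 : ‖grad v‖ ^ 2
      = ∑ i : Fin d, ∑ j : Fin d, ‖coordL Ω (i, j) (grad v)‖ ^ 2 := by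
    rw [← real_inner_self_eq_norm_sq, inner_eq_sum_coordL, Fintype.sum_prod_type]
    simp only [real_inner_self_eq_norm_sq]
  have h2' : ‖grad v‖ ^ 2
      = ∑ i : Fin d, ∑ j : Fin d, ‖coordL Ω (j, i) (grad v)‖ ^ 2 := by
    rw [h2, Finset.sum_comm]
  have h3 : ‖symL Ω v‖ ^ 2 = ∑ i : Fin d, ∑ j : Fin d,
      (1 / 4 * ‖coordL Ω (i, j) (grad v)‖ ^ 2 + 1 / 4 * ‖coordL Ω (j, i) (grad v)‖ ^ 2
        + 1 / 2 * inner ℝ (coordL Ω (i, j) (grad v)) (coordL Ω (j, i) (grad v))) := by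
    rw [← real_inner_self_eq_norm_sq, inner_eq_sum_coordL, Fintype.sum_prod_type]
    refine Finset.sum_congr rfl fun i _ => Finset.sum_congr rfl fun j _ => ?_
    rw [real_inner_self_eq_norm_sq, coordL_symL, norm_smul, mul_pow, norm_add_sq_real]
    norm_num
    ring
  simp only [Finset.sum_add_distrib, ← Finset.mul_sum] at h3
  rw [h1, ← h2, ← h2'] at h3
  nlinarith [sq_nonneg ‖divL Ω v‖]

/-- Korn turns ν₀‖ε(v)‖² into at least (ν₀/2)‖∇v‖², and α‖v‖² supplies the rest of the norm. No
divergence constraint enters, so the well-posedness proof can use coercivity on the whole space. -/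
lemma aF_coercive (hΩ : IsOpen Ω) {ν : E d → ℝ} (hν : MemLp ν ⊤ (volume.restrict Ω)) {ν₀ : ℝ}
    (hν₀ : 0 < ν₀) (h : ∀ᵐ x ∂(volume.restrict Ω), ν₀ ≤ ν x) {α : ℝ} (hα : 0 < α) :
    ∃ a₀ : ℝ, 0 < a₀ ∧ ∀ v ∈ H10 Ω, a₀ * ‖v‖ ^ 2 ≤ aF α ν v v := by
  refine ⟨min α (ν₀ / 2), by positivity, fun v hv => ?_⟩
  rw [aF, ← inner_mulNu_symL hν, real_inner_self_eq_norm_sq, norm_sq_H1, mul_add]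
  have h1 := mulNu_coercive hν h (symL Ω v)
  have h2 := korn hΩ hv
  have h3 : min α (ν₀ / 2) * ‖fn v‖ ^ 2 ≤ α * ‖fn v‖ ^ 2 := by
    gcongr
    exact min_le_left _ _
  have h4 : min α (ν₀ / 2) * ‖grad v‖ ^ 2 ≤ ν₀ / 2 * ‖grad v‖ ^ 2 := by
    gcongr
    exact min_le_right _ _
  nlinarith

lemma isTest_mul_left {S : Set (E d)} {a f : E d → ℝ} (ha : ContDiff ℝ ∞ a) (hf : IsTest S f) :
    IsTest S fun x => a x * f x :=
  ⟨ha.mul hf.smooth, hf.compact.mul_left, (tsupport_mul_subset_right).trans hf.supp⟩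

/-- The Poincaré inequality for test functions on bounded sets. -/
lemma IsTest.poincare {f : E d → ℝ} (hf : IsTest Ω f) (hm : MeasurableSet Ω) {R : ℝ}
    (hR : ∀ x ∈ Ω, ‖x‖ ≤ R) (j : Fin d) : ‖hf.toL2‖ ≤ 2 * R * ‖(hf.pd j).toL2‖ := by
  -- The norm of `f` is cancelled at the end, so the value zero is set apart. The sign of `R` is
  -- known only when `Ω` is nonempty.
  by_cases h0 : ‖hf.toL2‖ = 0
  · rw [h0]
    by_cases hne : Ω.Nonempty
    · obtain ⟨x, hx⟩ := hne
      have := (norm_nonneg x).trans (hR x hx)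
      positivity
    · rw [not_nonempty_iff_eq_empty] at hne
      have : ‖(hf.pd j).toL2‖ = 0 := by
        subst hne
        rw [norm_eq_zero]
        apply Lp.ext
        simp [Measure.restrict_empty, Filter.EventuallyEq]
      rw [this, mul_zero]
  have hx : ContDiff ℝ ∞ fun x : E d => x j :=
    (EuclideanSpace.proj (𝕜 := ℝ) j).contDiff
  -- Integrating ∂ⱼ(xⱼ f) f by parts gives ∫ f² = -2 ∫ xⱼ f ∂ⱼf, and |xⱼ| ≤ R on `Ω`.
  have hg : IsTest Ω fun x => x j * f x := isTest_mul_left hx hf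
  have hpd : ∀ x, FSI.pd j (fun x : E d => x j * f x) x = f x + x j * FSI.pd j f x := by
    intro x
    have h1 : HasFDerivAt (fun x : E d => x j) (EuclideanSpace.proj (𝕜 := ℝ) j) x :=
      (EuclideanSpace.proj (𝕜 := ℝ) j).hasFDerivAt
    have h2 := (h1.mul hf.differentiable.differentiableAt.hasFDerivAt).fderiv
    change _root_.fderiv ℝ ((fun x : E d => x j) * f) x _ = _
    rw [h2]
    simp
    ring
  have key := hg.integral_pd_mul hf j
  have hii : ∀ {a b : E d → ℝ}, Continuous a → IsTest Ω b →
      Integrable (fun x => a x * b x) (volume.restrict Ω) := fun ha hb =>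
    ((ha.mul hb.continuous).integrable_of_hasCompactSupport hb.compact.mul_left).restrict
  have e1 : ∫ x in Ω, FSI.pd j (fun x : E d => x j * f x) x * f x
      = (∫ x in Ω, f x * f x) + ∫ x in Ω, x j * f x * FSI.pd j f x := by
    rw [← integral_add (hii hf.continuous hf) (hii hg.continuous (hf.pd j))]
    congr 1
    ext x
    rw [hpd]
    ring
  have e2 : ∫ x in Ω, f x * f x = ‖hf.toL2‖ ^ 2 := by
    rw [← real_inner_self_eq_norm_sq, L2.inner_def]
    apply integral_congr_ae
    filter_upwards [hf.coe_toL2] with x h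
    rw [h]
    simp [sq]
  have e3 : |∫ x in Ω, x j * f x * FSI.pd j f x| ≤ R * (‖hf.toL2‖ * ‖(hf.pd j).toL2‖) := by
    have e4 : ‖hf.toL2‖ * ‖(hf.pd j).toL2‖
        = ‖(Lp.memLp hf.toL2).norm.toLp‖ * ‖(Lp.memLp (hf.pd j).toL2).norm.toLp‖ := by
      rw [Lp.norm_toLp, Lp.norm_toLp, eLpNorm_norm, eLpNorm_norm]
      rfl
    have e5 := real_inner_le_norm (Lp.memLp hf.toL2).norm.toLp (Lp.memLp (hf.pd j).toL2).norm.toLp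
    rw [← e4, L2.inner_def] at e5
    by_cases hne : Ω.Nonempty
    · obtain ⟨x, hx⟩ := hne
      have hR0 := (norm_nonneg x).trans (hR x hx)
      refine le_trans ?_ (mul_le_mul_of_nonneg_left e5 hR0)
      rw [← integral_const_mul, ← Real.norm_eq_abs]
      refine norm_integral_le_of_norm_le ((L2.integrable_inner _ _).const_mul _) ?_
      filter_upwards [hf.coe_toL2, (hf.pd j).coe_toL2, (Lp.memLp hf.toL2).norm.coeFn_toLp,
        (Lp.memLp (hf.pd j).toL2).norm.coeFn_toLp, ae_restrict_mem hm] with x h1 h2 h3 h4 h5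
      rw [h3, h4, h1, h2, norm_mul, norm_mul]
      have : ‖x j‖ ≤ R := (PiLp.norm_apply_le x j).trans (hR x h5)
      simp only [RCLike.inner_apply, conj_trivial]
      rw [mul_assoc, mul_comm ‖FSI.pd j f x‖]
      gcongr
    · rw [not_nonempty_iff_eq_empty] at hne
      exfalso
      apply h0
      subst hne
      rw [norm_eq_zero]
      apply Lp.ext
      simp [Measure.restrict_empty, Filter.EventuallyEq]
  have hpos : 0 < ‖hf.toL2‖ := lt_of_le_of_ne (norm_nonneg _) (Ne.symm h0)
  have h6 : ‖hf.toL2‖ ^ 2 ≤ 2 * (R * (‖hf.toL2‖ * ‖(hf.pd j).toL2‖)) := by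
    have := (abs_le.1 e3).1
    rw [e1] at key
    linarith
  have h7 : ‖hf.toL2‖ * ‖hf.toL2‖ ≤ ‖hf.toL2‖ * (2 * R * ‖(hf.pd j).toL2‖) := by nlinarith
  exact le_of_mul_le_mul_left h7 hpos

/-- The Poincaré inequality on `H¹₀(Ω)^d`. -/
lemma poincare (hd : 0 < d) (hΩ : IsOpen Ω) (hb : Bornology.IsBounded Ω) :
    ∃ C : ℝ, 0 ≤ C ∧ ∀ v ∈ H10 Ω, ‖fn v‖ ^ 2 ≤ C * ‖grad v‖ ^ 2 := by
  obtain ⟨R, hR⟩ := hb.exists_norm_le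
  refine ⟨(2 * R) ^ 2, by positivity, fun v hv => ?_⟩
  refine H10_induction hΩ (P := fun v => ‖fn v‖ ^ 2 ≤ (2 * R) ^ 2 * ‖grad v‖ ^ 2) ?_ ?_ hv
  · exact isClosed_le ((fnL Ω).continuous.norm.pow 2)
      (continuous_const.mul ((gradL Ω).continuous.norm.pow 2))
  · intro φ hφ
    let j : Fin d := ⟨0, hd⟩
    have h2 : ‖grad (ofTest hφ)‖ ^ 2
        = ∑ i : Fin d, ∑ k : Fin d, ‖coordL Ω (i, k) (grad (ofTest hφ))‖ ^ 2 := by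
      rw [← real_inner_self_eq_norm_sq, inner_eq_sum_coordL, Fintype.sum_prod_type]
      simp only [real_inner_self_eq_norm_sq]
    rw [← real_inner_self_eq_norm_sq, inner_eq_sum_coordL, h2, Finset.mul_sum]
    refine Finset.sum_le_sum fun i _ => ?_
    rw [real_inner_self_eq_norm_sq, fn_ofTest, coordL_toL2]
    have h3 := (hφ.coord i).poincare hΩ.measurableSet hR j
    calc ‖(hφ.coord i).toL2‖ ^ 2 ≤ (2 * R * ‖((hφ.coord i).pd j).toL2‖) ^ 2 := by gcongr
      _ = (2 * R) ^ 2 * ‖coordL Ω (i, j) (grad (ofTest hφ))‖ ^ 2 := by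
        rw [coordL_grad_ofTest, mul_pow]
      _ ≤ _ := by
        gcongr
        exact Finset.single_le_sum (f := fun k => ‖coordL Ω (i, k) (grad (ofTest hφ))‖ ^ 2)
          (fun _ _ => by positivity) (Finset.mem_univ j)

/-- The divergence of an element of `H¹₀(Ω)^d` has zero mean value. -/
lemma integral_divL (hΩ : IsOpen Ω) (hb : Bornology.IsBounded Ω) {v : H1 Ω} (hv : v ∈ H10 Ω) :
    ∫ x in Ω, divL Ω v x = 0 := by
  have : IsFiniteMeasure (volume.restrict Ω) := ⟨by
    rw [Measure.restrict_apply_univ]; exact hb.measure_lt_top⟩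
  let q : L2 Ω := (memLp_const (1 : ℝ)).toLp
  have hq : ∀ w : L2 Ω, ∫ x in Ω, w x = inner ℝ w q := by
    intro w
    rw [L2.inner_def]
    apply integral_congr_ae
    filter_upwards [(memLp_const (μ := volume.restrict Ω) (p := 2) (1 : ℝ)).coeFn_toLp] with x h
    rw [h]
    simp
  refine H10_induction hΩ (P := fun v => ∫ x in Ω, divL Ω v x = 0) ?_ ?_ hv
  · simp only [hq]
    exact isClosed_eq ((divL Ω).continuous.inner continuous_const) continuous_const
  · intro φ hφ
    rw [hq, divL_apply, sum_inner]
    refine Finset.sum_eq_zero fun i _ => ?_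
    rw [coordL_grad_ofTest, ← hq]
    have e : ∫ x in Ω, ((hφ.coord i).pd i).toL2 x = ∫ x in Ω, pd i (fun y => φ y i) x :=
      integral_congr_ae ((hφ.coord i).pd i).coe_toL2
    rw [e, ((hφ.coord i).pd i).setIntegral_eq, (hφ.coord i).integral_pd]

end Forms

/-! ### Abstract saddle point problems -/

section Abstract

open ContinuousLinearMap

variable {U W P : Type*} [NormedAddCommGroup U] [InnerProductSpace ℝ U] [CompleteSpace U]
  [NormedAddCommGroup W] [InnerProductSpace ℝ W] [CompleteSpace W]
  [NormedAddCommGroup P] [InnerProductSpace ℝ P] [CompleteSpace P]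

/-- The Lax–Milgram theorem for operators. -/
lemma exists_equiv_of_coercive (A : U →L[ℝ] U) {a₀ : ℝ} (ha₀ : 0 < a₀)
    (hA : ∀ u, a₀ * ‖u‖ ^ 2 ≤ inner ℝ (A u) u) : ∃ e : U ≃L[ℝ] U, ∀ u, e u = A u := by
  have hc : IsCoercive ((innerSL ℝ).comp A : U →L[ℝ] U →L[ℝ] ℝ) :=
    ⟨a₀, ha₀, fun u => by
      have := hA u
      change a₀ * ‖u‖ * ‖u‖ ≤ inner ℝ (A u) u
      nlinarith⟩
  refine ⟨hc.continuousLinearEquivOfBilin, fun u => ?_⟩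
  refine ext_inner_right ℝ fun w => ?_
  rw [hc.continuousLinearEquivOfBilin_apply]
  rfl

/-- Solvability of the reduced saddle point problem: the solution depends linearly and continuously
on the data. -/
theorem exists_solution_operator (A : U →L[ℝ] U) {a₀ : ℝ} (ha₀ : 0 < a₀)
    (hA : ∀ u, a₀ * ‖u‖ ^ 2 ≤ inner ℝ (A u) u) (K : U →L[ℝ] W) (S : W →L[ℝ] W)
    (hS : ∀ X, 0 ≤ inner ℝ (S X) X) (D : U →L[ℝ] P) {b : ℝ} (hb : 0 < b)
    (hD : ∀ p, b * ‖p‖ ≤ ‖adjoint D p‖) :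
    ∃ T : U × W × W →L[ℝ] U × W × W × P, ∀ (f : U) (h δ : W) (u : U) (X l : W) (p : P),
      (A u - adjoint D p + adjoint K l = f ∧ D u = 0 ∧ S X - l = h ∧ K u - X = δ) ↔
        (u, X, l, p) = T (f, h, δ) := by
  -- Substituting X = K u - δ and l = S X - h into the first equation leaves A' u - D* p = F. Since
  -- S is nonnegative, A' inherits the coercivity of A.
  let A' : U →L[ℝ] U := A + (adjoint K).comp (S.comp K)
  have hA' : ∀ u, a₀ * ‖u‖ ^ 2 ≤ inner ℝ (A' u) u := by
    intro u
    have h1 := hA u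
    have h2 := hS (K u)
    have h3 : inner ℝ (A' u) u = inner ℝ (A u) u + inner ℝ (S (K u)) (K u) := by
      change inner ℝ (A u + adjoint K (S (K u))) u = _
      rw [inner_add_left, adjoint_inner_left]
    linarith
  obtain ⟨e, he⟩ := exists_equiv_of_coercive A' ha₀ hA'
  -- The pressure Schur complement D A'⁻¹ D*. With w = A'⁻¹ D* p, ⟨Q p, p⟩ = ⟨A' w, w⟩ ≥ a₀‖w‖²,
  -- while b‖p‖ ≤ ‖D* p‖ ≤ N‖w‖. The added 1 in N keeps the divisor positive even if A' vanishes.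
  let Q : P →L[ℝ] P := D.comp ((e.symm : U →L[ℝ] U).comp (adjoint D))
  let N : ℝ := ‖A'‖ + 1
  have hN : 0 < N := by positivity
  have hQ : ∀ p, (a₀ * b ^ 2 / N ^ 2) * ‖p‖ ^ 2 ≤ inner ℝ (Q p) p := by
    intro p
    have h1 : inner ℝ (Q p) p = inner ℝ (A' (e.symm (adjoint D p))) (e.symm (adjoint D p)) := by
      rw [← he, e.apply_symm_apply, real_inner_comm]
      change inner ℝ p (D (e.symm (adjoint D p))) = _
      rw [adjoint_inner_left]
    have h2 : b * ‖p‖ ≤ N * ‖e.symm (adjoint D p)‖ := by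
      refine (hD p).trans ?_
      have h3 : ‖adjoint D p‖ = ‖A' (e.symm (adjoint D p))‖ := by
        rw [← he, e.apply_symm_apply]
      rw [h3]
      refine (A'.le_opNorm _).trans ?_
      gcongr
      simp [N]
    have h4 : (b * ‖p‖) ^ 2 ≤ (N * ‖e.symm (adjoint D p)‖) ^ 2 := by gcongr
    rw [h1]
    refine le_trans ?_ (hA' _)
    rw [div_mul_eq_mul_div, div_le_iff₀ (by positivity)]
    nlinarith
  obtain ⟨e', he'⟩ := exists_equiv_of_coercive Q (by positivity) hQ
  -- the operators giving the right-hand side, the pressure, the velocity, the position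
  let F : U × W × W →L[ℝ] U := fst ℝ U (W × W)
    + (adjoint K).comp (S.comp ((snd ℝ W W).comp (snd ℝ U (W × W)))
      + (fst ℝ W W).comp (snd ℝ U (W × W)))
  let p' : U × W × W →L[ℝ] P :=
    -((e'.symm : P →L[ℝ] P).comp (D.comp ((e.symm : U →L[ℝ] U).comp F)))
  let u' : U × W × W →L[ℝ] U := (e.symm : U →L[ℝ] U).comp (F + (adjoint D).comp p')
  let X' : U × W × W →L[ℝ] W := K.comp u' - (snd ℝ W W).comp (snd ℝ U (W × W))
  let l' : U × W × W →L[ℝ] W := S.comp X' - (fst ℝ W W).comp (snd ℝ U (W × W))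
  refine ⟨u'.prod (X'.prod (l'.prod p')), fun f h δ u X l p => ?_⟩
  have hF : F (f, h, δ) = f + adjoint K (S δ + h) := rfl
  have hp' : p' (f, h, δ) = -(e'.symm (D (e.symm (F (f, h, δ))))) := rfl
  have hu' : u' (f, h, δ) = e.symm (F (f, h, δ) + adjoint D (p' (f, h, δ))) := rfl
  have hX' : X' (f, h, δ) = K (u' (f, h, δ)) - δ := rfl
  have hl' : l' (f, h, δ) = S (X' (f, h, δ)) - h := rfl
  have hT : u'.prod (X'.prod (l'.prod p')) (f, h, δ)
      = (u' (f, h, δ), X' (f, h, δ), l' (f, h, δ), p' (f, h, δ)) := rfl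
  have hmom : ∀ v q, A' v - adjoint D q = F (f, h, δ) ↔
      A v - adjoint D q + adjoint K (S (K v - δ) - h) = f := by
    intro v q
    have : A' v = A v + adjoint K (S (K v)) := rfl
    rw [this, hF, map_sub S, map_sub, map_sub, map_add, eq_comm, ← sub_eq_zero,
      ← sub_eq_zero (b := f), ← neg_eq_zero]
    constructor <;> intro h <;> rw [← h] <;> abel
  rw [hT, Prod.mk.injEq, Prod.mk.injEq, Prod.mk.injEq]
  have hQe : ∀ q, e' q = D (e.symm (adjoint D q)) := fun q => he' q
  constructor
  · rintro ⟨h1, h2, h3, h4⟩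
    have hX : X = K u - δ := by rw [← h4]; abel
    have hl : l = S X - h := by rw [← h3]; abel
    rw [hl, hX, ← hmom] at h1
    have hu : u = e.symm (F (f, h, δ) + adjoint D p) := by
      rw [e.eq_symm_apply, he, ← h1]; abel
    have hp : p = p' (f, h, δ) := by
      have h5 := h2
      rw [hu, map_add, map_add, ← hQe] at h5
      rw [hp', ← map_neg, e'.eq_symm_apply]
      exact eq_neg_of_add_eq_zero_right h5
    have hu2 : u = u' (f, h, δ) := by rw [hu', ← hp, ← hu]
    have hX2 : X = X' (f, h, δ) := by rw [hX', ← hu2, hX]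
    exact ⟨hu2, hX2, by rw [hl', ← hX2, hl], hp⟩
  · rintro ⟨hu, hX, hl, hp⟩
    have hu2 : u = e.symm (F (f, h, δ) + adjoint D p) := hu.trans (hu'.trans (by rw [← hp]))
    have hX2 : X = K u - δ := hX.trans (hX'.trans (by rw [← hu]))
    have hl2 : l = S X - h := hl.trans (hl'.trans (by rw [← hX]))
    have h1 : A' u - adjoint D p = F (f, h, δ) := by
      rw [← he, hu2, e.apply_symm_apply]; abel
    rw [hmom] at h1
    refine ⟨?_, ?_, ?_, ?_⟩
    · rw [hl2, hX2]; exact h1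
    · rw [hu2, map_add, map_add, ← hQe, hp, hp', map_neg, e'.apply_symm_apply]; abel
    · rw [hl2]; abel
    · rw [hX2]; abel

/-- Well-posedness of the saddle point problem in variational form. -/
theorem exists_variational_solution {F G T₀ T₁ : Type*}
    [NormedAddCommGroup F] [InnerProductSpace ℝ F] [CompleteSpace F]
    [NormedAddCommGroup G] [InnerProductSpace ℝ G] [CompleteSpace G]
    [NormedAddCommGroup T₀] [InnerProductSpace ℝ T₀] [CompleteSpace T₀]
    [NormedAddCommGroup T₁] [InnerProductSpace ℝ T₁] [CompleteSpace T₁]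
    (L : U →L[ℝ] F) (E : U →L[ℝ] T₀) (M : T₀ →L[ℝ] T₀) {α a₀ : ℝ} (ha₀ : 0 < a₀)
    (hA : ∀ u, a₀ * ‖u‖ ^ 2 ≤ α * inner ℝ (L u) (L u) + inner ℝ (M (E u)) (E u))
    (N : W →L[ℝ] G) (R : W →L[ℝ] T₁) {β γ : ℝ} (hβ : 0 ≤ β) (hγ : 0 ≤ γ)
    (K : U →L[ℝ] W) (D : U →L[ℝ] P) {b : ℝ} (hb : 0 < b)
    (hD : ∀ p c, (∀ v, inner ℝ (D v) p ≤ c * ‖v‖) → b * ‖p‖ ≤ c) :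
    ∃ C : ℝ, ∀ (f : F) (g : G) (δ : W), ∃ (u : U) (X l : W) (p : P),
      (∀ (u' : U) (X' l' : W) (p' : P),
        ((∀ v, α * inner ℝ (L u') (L v) + inner ℝ (M (E u')) (E v) - inner ℝ (D v) p'
            + inner ℝ l' (K v) = inner ℝ f (L v)) ∧
          (∀ q, inner ℝ (D u') q = 0) ∧
          (∀ Y, β * inner ℝ (N X') (N Y) + γ * inner ℝ (R X') (R Y) - inner ℝ l' Y
            = inner ℝ g (N Y)) ∧
          (∀ Y, inner ℝ Y (K u' - X') = inner ℝ Y δ)) ↔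
        (u' = u ∧ X' = X ∧ l' = l ∧ p' = p)) ∧
      ‖u‖ + ‖X‖ + ‖l‖ + ‖p‖ ≤ C * (‖f‖ + ‖g‖ + ‖δ‖) := by
  let A : U →L[ℝ] U := α • (adjoint L).comp L + (adjoint E).comp (M.comp E)
  have hAi : ∀ u v, inner ℝ (A u) v = α * inner ℝ (L u) (L v) + inner ℝ (M (E u)) (E v) := by
    intro u v
    change inner ℝ (α • adjoint L (L u) + adjoint E (M (E u))) v = _
    rw [inner_add_left, real_inner_smul_left, adjoint_inner_left, adjoint_inner_left]
  let S : W →L[ℝ] W := β • (adjoint N).comp N + γ • (adjoint R).comp R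
  have hS : ∀ X Y, inner ℝ (S X) Y = β * inner ℝ (N X) (N Y) + γ * inner ℝ (R X) (R Y) := by
    intro X Y
    change inner ℝ (β • adjoint N (N X) + γ • adjoint R (R X)) Y = _
    rw [inner_add_left, real_inner_smul_left, real_inner_smul_left, adjoint_inner_left,
      adjoint_inner_left]
  have hD' : ∀ p, b * ‖p‖ ≤ ‖adjoint D p‖ := fun p => hD p _ fun v => by
    rw [← adjoint_inner_right, mul_comm]
    exact real_inner_le_norm _ _
  obtain ⟨T, hT⟩ := exists_solution_operator A ha₀ (fun u => by rw [hAi]; exact hA u) K S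
    (fun X => by
      rw [hS, real_inner_self_eq_norm_sq, real_inner_self_eq_norm_sq]; positivity) D hb hD'
  -- Each of the four components is bounded by the maximum norm of the solution tuple, whence the 4;
  -- the bracket bounds the norm of the data tuple.
  refine ⟨4 * ‖T‖ * (‖adjoint L‖ + ‖adjoint N‖ + 1), fun f g δ => ?_⟩
  set t := T (adjoint L f, adjoint N g, δ) with ht
  refine ⟨t.1, t.2.1, t.2.2.1, t.2.2.2, fun u X l p => ?_, ?_⟩
  · have h0 : (u = t.1 ∧ X = t.2.1 ∧ l = t.2.2.1 ∧ p = t.2.2.2) ↔ (u, X, l, p) = t := by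
      simp only [Prod.ext_iff]
    rw [h0, ← hT]
    refine and_congr ?_ (and_congr ?_ (and_congr ?_ ?_))
    · rw [ext_iff_inner_right ℝ]
      refine forall_congr' fun v => ?_
      rw [inner_add_left, inner_sub_left, hAi, adjoint_inner_left, adjoint_inner_left,
        adjoint_inner_left, real_inner_comm p]
    · rw [ext_iff_inner_right ℝ]
      simp only [inner_zero_left]
    · rw [ext_iff_inner_right ℝ]
      refine forall_congr' fun v => ?_
      rw [inner_sub_left, hS, adjoint_inner_left]
    · rw [ext_iff_inner_left ℝ]
  · have h2 : ‖t.1‖ ≤ ‖t‖ := norm_fst_le t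
    have h3 : ‖t.2‖ ≤ ‖t‖ := norm_snd_le t
    have h4 : ‖t.2.1‖ ≤ ‖t.2‖ := norm_fst_le t.2
    have h5 : ‖t.2.2‖ ≤ ‖t.2‖ := norm_snd_le t.2
    have h6 : ‖t.2.2.1‖ ≤ ‖t.2.2‖ := norm_fst_le t.2.2
    have h7 : ‖t.2.2.2‖ ≤ ‖t.2.2‖ := norm_snd_le t.2.2
    have h8 : ‖t‖ ≤ ‖T‖ * ((‖adjoint L‖ + ‖adjoint N‖ + 1) * (‖f‖ + ‖g‖ + ‖δ‖)) := by
      refine (T.le_opNorm _).trans ?_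
      gcongr
      have e1 := (adjoint L).le_opNorm f
      have e2 := (adjoint N).le_opNorm g
      have n1 := norm_nonneg f
      have n2 := norm_nonneg g
      have n3 := norm_nonneg δ
      have n4 := norm_nonneg (adjoint L)
      have n5 := norm_nonneg (adjoint N)
      have m1 := mul_nonneg n4 n1
      have m2 := mul_nonneg n4 n2
      have m3 := mul_nonneg n4 n3
      have m4 := mul_nonneg n5 n1
      have m5 := mul_nonneg n5 n2
      have m6 := mul_nonneg n5 n3
      refine max_le ?_ (max_le ?_ ?_)
      · exact e1.trans (by linarith)
      · exact e2.trans (by linarith)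
      · change ‖δ‖ ≤ _
        linarith
    calc _ ≤ 4 * ‖t‖ := by linarith
      _ ≤ 4 * (‖T‖ * ((‖adjoint L‖ + ‖adjoint N‖ + 1) * (‖f‖ + ‖g‖ + ‖δ‖))) := by gcongr
      _ = _ := by ring

end Abstract

/-! ### The inf-sup condition for 𝒜 and well-posedness -/

section Mixed

open ContinuousLinearMap

variable {d : ℕ} {Ω B : Set (E d)} {Λ : Type} [NormedAddCommGroup Λ] [NormedSpace ℝ Λ]

lemma norm_sq_VV (V : VV Ω B Λ) : ‖V‖ ^ 2 = ‖vel V‖ ^ 2 + ‖pos V‖ ^ 2 + ‖mult V‖ ^ 2 := by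
  have h1 := WithLp.prod_norm_sq_eq_of_L2 V
  have h2 := WithLp.prod_norm_sq_eq_of_L2 V.snd
  change ‖V‖ ^ 2 = ‖vel V‖ ^ 2 + ‖V.snd‖ ^ 2 at h1
  change ‖V.snd‖ ^ 2 = ‖pos V‖ ^ 2 + ‖mult V‖ ^ 2 at h2
  rw [h1, h2, ← add_assoc]

/-- The element `(v, Y, μ)` of the product space. -/
def mkVV (v : H10 Ω) (Y : H1 B) (μ : Λ) : VV Ω B Λ := WithLp.toLp 2 (v, WithLp.toLp 2 (Y, μ))

@[simp] lemma vel_mkVV (v : H10 Ω) (Y : H1 B) (μ : Λ) : vel (mkVV v Y μ) = v := rfl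

@[simp] lemma pos_mkVV (v : H10 Ω) (Y : H1 B) (μ : Λ) : pos (mkVV v Y μ) = Y := rfl

@[simp] lemma mult_mkVV (v : H10 Ω) (Y : H1 B) (μ : Λ) : mult (mkVV v Y μ) = μ := rfl

lemma mkVV_eta (V : VV Ω B Λ) : mkVV (vel V) (pos V) (mult V) = V := rfl

/-- The weights of the test function in the proof of the inf-sup condition. -/
lemma exists_weights {a₀ k s : ℝ} (ha₀ : 0 < a₀) :
    ∃ δ₁ δ₂ κ : ℝ, 0 < δ₁ ∧ 0 < δ₂ ∧ 0 < κ ∧ ∀ auu sxx sxl xku nu nx nl : ℝ,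
      a₀ * nu ^ 2 ≤ auu → 0 ≤ sxx → sxl ≤ s * nx * nl → xku ≤ nx * (k * nu) →
      κ * (nu ^ 2 + nx ^ 2 + nl ^ 2)
        ≤ auu + sxx - δ₂ * sxl + δ₂ * nl ^ 2 - δ₁ * xku + δ₁ * nx ^ 2 := by
  -- By Young's inequality the term with K costs half of δ₁‖X‖² and, as δ₁k² ≤ a₀, half of a₀‖u‖².
  -- Then δ₂ is chosen relative to δ₁ so that the term a_s(X, λ) costs a quarter of δ₁‖X‖² and half
  -- of δ₂‖λ‖². The remainders are the three entries of κ₁.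
  set δ₁ := a₀ / (k ^ 2 + 1) with hδ₁
  set δ₂ := δ₁ / (2 * (s ^ 2 + 1)) with hδ₂
  have h1p : 0 < δ₁ := by positivity
  have h2p : 0 < δ₂ := by positivity
  have h1k : δ₁ * k ^ 2 ≤ a₀ := by
    rw [hδ₁, div_mul_eq_mul_div, div_le_iff₀ (by positivity)]
    nlinarith
  have h2s : δ₂ * s ^ 2 ≤ δ₁ / 2 := by
    rw [hδ₂, div_mul_eq_mul_div, div_le_iff₀ (by positivity)]
    nlinarith
  set κ₁ := min (a₀ / 2) (min (δ₁ / 4) (δ₂ / 2)) with hκ₁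
  refine ⟨δ₁, δ₂, κ₁, h1p, h2p, by positivity, ?_⟩
  intro auu sxx sxl xku nu nx nl b1 b2 b3 b4
  have b5 : κ₁ ≤ a₀ / 2 := min_le_left _ _
  have b6 : κ₁ ≤ δ₁ / 4 := (min_le_right _ _).trans (min_le_left _ _)
  have b7 : κ₁ ≤ δ₂ / 2 := (min_le_right _ _).trans (min_le_right _ _)
  have c1 : δ₂ * sxl ≤ δ₂ / 2 * nl ^ 2 + δ₁ / 4 * nx ^ 2 := by
    have : s * nx * nl ≤ (nl ^ 2 + s ^ 2 * nx ^ 2) / 2 := by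
      nlinarith [sq_nonneg (nl - s * nx)]
    calc δ₂ * sxl ≤ δ₂ * ((nl ^ 2 + s ^ 2 * nx ^ 2) / 2) := by
          gcongr; exact b3.trans this
      _ = δ₂ / 2 * nl ^ 2 + (δ₂ * s ^ 2) / 2 * nx ^ 2 := by ring
      _ ≤ δ₂ / 2 * nl ^ 2 + (δ₁ / 2) / 2 * nx ^ 2 := by gcongr
      _ = _ := by ring
  have c2 : δ₁ * xku ≤ δ₁ / 2 * nx ^ 2 + a₀ / 2 * nu ^ 2 := by
    have : nx * (k * nu) ≤ (nx ^ 2 + k ^ 2 * nu ^ 2) / 2 := by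
      nlinarith [sq_nonneg (nx - k * nu)]
    calc δ₁ * xku ≤ δ₁ * ((nx ^ 2 + k ^ 2 * nu ^ 2) / 2) := by
          gcongr; exact b4.trans this
      _ = δ₁ / 2 * nx ^ 2 + (δ₁ * k ^ 2) / 2 * nu ^ 2 := by ring
      _ ≤ _ := by gcongr
  have c3 : κ₁ * nu ^ 2 ≤ a₀ / 2 * nu ^ 2 := by gcongr
  have c4 : κ₁ * nx ^ 2 ≤ δ₁ / 4 * nx ^ 2 := by gcongr
  have c5 : κ₁ * nl ^ 2 ≤ δ₂ / 2 * nl ^ 2 := by gcongr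
  linarith

lemma aS_sub_smul (β γ δ : ℝ) (X l : H1 B) :
    aS β γ X (X - δ • l) = aS β γ X X - δ * aS β γ X l := by
  simp only [aS, ← fnL_apply, ← gradL_apply, map_sub, map_smul, inner_sub_right,
    real_inner_smul_right]
  ring

lemma aS_le {β γ : ℝ} (hβ : 0 ≤ β) (hγ : 0 ≤ γ) (X l : H1 B) :
    aS β γ X l ≤ (β + γ) * ‖X‖ * ‖l‖ := by
  have h1 : inner ℝ (fn X) (fn l) ≤ ‖X‖ * ‖l‖ := (real_inner_le_norm _ _).trans
    (mul_le_mul (norm_fn_le X) (norm_fn_le l) (norm_nonneg _) (norm_nonneg _))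
  have h2 : inner ℝ (grad X) (grad l) ≤ ‖X‖ * ‖l‖ := (real_inner_le_norm _ _).trans
    (mul_le_mul (norm_grad_le X) (norm_grad_le l) (norm_nonneg _) (norm_nonneg _))
  have := add_le_add (mul_le_mul_of_nonneg_left h1 hβ) (mul_le_mul_of_nonneg_left h2 hγ)
  rw [aS]
  linarith

lemma norm_add_smul_sq_le {H : Type*} [NormedAddCommGroup H] [NormedSpace ℝ H] (x y : H) (δ : ℝ) :
    ‖x + δ • y‖ ^ 2 ≤ 2 * ‖x‖ ^ 2 + 2 * δ ^ 2 * ‖y‖ ^ 2 := by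
  have h1 : ‖x + δ • y‖ ≤ ‖x‖ + |δ| * ‖y‖ := by
    refine (norm_add_le _ _).trans_eq ?_
    rw [norm_smul, Real.norm_eq_abs]
  calc ‖x + δ • y‖ ^ 2 ≤ (‖x‖ + |δ| * ‖y‖) ^ 2 := by gcongr
    _ ≤ 2 * ‖x‖ ^ 2 + 2 * (|δ| ^ 2 * ‖y‖ ^ 2) := by nlinarith [sq_nonneg (‖x‖ - |δ| * ‖y‖)]
    _ = _ := by rw [sq_abs]; ring

/-- The untouched part of the test function cancels the coupling terms by skew symmetry. The shift
of the position produces δ₂‖l‖², and the shift of the multiplier produces δ₁‖X‖²; the latter is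
indispensable for β = 0, when a_s sees only the gradient of X. -/
lemma formA_test {c : Λ → H1 B → ℝ} (J : H1 B ≃ₗᵢ[ℝ] Λ)
    (hc : ∀ l Y, c (J l) Y = inner ℝ l Y) {Xb : E d → E d} {K : H10 Ω →L[ℝ] H1 B}
    (hK : ∀ v : H10 Ω, comp B Xb (v : H1 Ω) = K v) {ν : E d → ℝ} {α β γ δ₁ δ₂ : ℝ}
    (u : H10 Ω) (X l : H1 B) :
    formA c Xb ν α β γ (mkVV u X (J l)) (mkVV u (X - δ₂ • l) (J (l + δ₁ • X)))
      = aF α ν (u : H1 Ω) u + aS β γ X X - δ₂ * aS β γ X l + δ₂ * ‖l‖ ^ 2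
        - δ₁ * inner ℝ X (K u) + δ₁ * ‖X‖ ^ 2 := by
  rw [formA]
  simp only [vel_mkVV, pos_mkVV, mult_mkVV]
  rw [aS_sub_smul, hK, hc, hc]
  simp only [inner_sub_right, inner_add_left, real_inner_smul_left, real_inner_smul_right,
    real_inner_self_eq_norm_sq]
  ring

set_option maxHeartbeats 1000000 in
/-- The inf-sup condition for `𝒜` on the kernel of `ℬ`, for every multiplier space that is
isometric to `H¹(B)^d` through the Riesz representation of `c`. -/
theorem infSupA_of_riesz (hΩ : IsOpen Ω) {c : Λ → H1 B → ℝ} (J : H1 B ≃ₗᵢ[ℝ] Λ)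
    (hc : ∀ l Y, c (J l) Y = inner ℝ l Y) {Xb : E d → E d} (K : H10 Ω →L[ℝ] H1 B)
    (hK : ∀ v : H10 Ω, comp B Xb (v : H1 Ω) = K v)
    {ν : E d → ℝ} (hν : MemLp ν ⊤ (volume.restrict Ω)) {ν₀ : ℝ} (hν₀ : 0 < ν₀)
    (hνν₀ : ∀ᵐ x ∂(volume.restrict Ω), ν₀ ≤ ν x) {α β γ : ℝ} (hα : 0 < α) (hβ : 0 ≤ β)
    (hγ : 0 < γ) : InfSupA c Ω Xb ν α β γ := by
  obtain ⟨a₀, ha₀, ha⟩ := aF_coercive hΩ hν hν₀ hνν₀ hα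
  obtain ⟨δ₁, δ₂, κ₁, h1p, h2p, hκ, hw⟩ :=
    exists_weights (k := ‖K‖) (s := β + γ) ha₀
  -- N bounds |||V||| by |||U|||, through (x + y)² ≤ 2x² + 2y² applied to the two modified
  -- components.
  set N := Real.sqrt (2 + 2 * δ₁ ^ 2 + 2 * δ₂ ^ 2) with hN
  have hNsq : N ^ 2 = 2 + 2 * δ₁ ^ 2 + 2 * δ₂ ^ 2 := Real.sq_sqrt (by positivity)
  have hN0 : 0 < N := Real.sqrt_pos.2 (by positivity)
  refine ⟨κ₁ / N, by positivity, le_iInf ?_⟩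
  rintro ⟨U, hU, hU0⟩
  obtain ⟨u, X, l, rfl⟩ : ∃ u X l, U = mkVV u X (J l) :=
    ⟨vel U, pos U, J.symm (mult U), by rw [J.apply_symm_apply, mkVV_eta]⟩
  set U : VV Ω B Λ := mkVV u X (J l) with hUdef
  have hUn : ‖U‖ ^ 2 = ‖u‖ ^ 2 + ‖X‖ ^ 2 + ‖l‖ ^ 2 := by
    rw [norm_sq_VV, hUdef, vel_mkVV, pos_mkVV, mult_mkVV, J.norm_map]
  have hUpos : 0 < ‖U‖ := norm_pos_iff.2 hU0
  set V : VV Ω B Λ := mkVV u (X - δ₂ • l) (J (l + δ₁ • X)) with hVdef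
  -- Membership in the kernel only involves the velocity, which U and V share.
  have hVK : V ∈ kerB Ω B Λ := hU
  have hAlow : κ₁ * ‖U‖ ^ 2 ≤ formA c Xb ν α β γ U V := by
    rw [hUn, hUdef, hVdef, formA_test J hc hK]
    exact hw _ _ _ _ _ _ _ (ha u u.2) (aS_self_nonneg hβ hγ.le X) (aS_le hβ hγ.le X l)
      ((real_inner_le_norm _ _).trans
        (mul_le_mul_of_nonneg_left (K.le_opNorm u) (norm_nonneg X)))
  have hVn : ‖V‖ ≤ N * ‖U‖ := by
    refine le_of_sq_le_sq ?_ (by positivity)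
    have e1 := norm_add_smul_sq_le X l (-δ₂)
    rw [neg_smul, ← sub_eq_add_neg, neg_sq] at e1
    have e2 := norm_add_smul_sq_le l X δ₁
    have e3 : ‖V‖ ^ 2 = ‖u‖ ^ 2 + ‖X - δ₂ • l‖ ^ 2 + ‖l + δ₁ • X‖ ^ 2 := by
      rw [norm_sq_VV, hVdef, vel_mkVV, pos_mkVV, mult_mkVV, J.norm_map]
    rw [mul_pow, hNsq, e3, hUn]
    have m1 := mul_nonneg (sq_nonneg δ₁) (sq_nonneg ‖u‖)
    have m2 := mul_nonneg (sq_nonneg δ₂) (sq_nonneg ‖u‖)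
    have m3 := mul_nonneg (sq_nonneg δ₂) (sq_nonneg ‖X‖)
    have m4 := mul_nonneg (sq_nonneg δ₁) (sq_nonneg ‖l‖)
    have m5 := sq_nonneg ‖u‖
    linarith
  have hApos : 0 < formA c Xb ν α β γ U V := lt_of_lt_of_le (by positivity) hAlow
  have hV0 : V ≠ 0 := by
    intro h
    have hu : u = 0 := congrArg vel h
    have hX : X - δ₂ • l = 0 := congrArg pos h
    have hm : J (l + δ₁ • X) = 0 := congrArg mult h
    have hm' : l + δ₁ • X = 0 := by rwa [map_eq_zero_iff J J.injective] at hm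
    have hX' : X = δ₂ • l := sub_eq_zero.1 hX
    have hl0 : (1 + δ₁ * δ₂) • l = 0 := by
      rw [← hm', hX', add_smul, one_smul, mul_smul]
    have hl1 : l = 0 := (smul_eq_zero.1 hl0).resolve_left (by positivity)
    rw [hX', hl1, hu, smul_zero, norm_zero, norm_zero] at hUn
    nlinarith
  have hVpos : 0 < ‖V‖ := norm_pos_iff.2 hV0
  refine le_iSup_of_le ⟨V, hVK, hV0⟩ ?_
  rw [EReal.coe_le_coe_iff, div_le_div_iff₀ hN0 (mul_pos hUpos hVpos)]
  calc κ₁ * (‖U‖ * ‖V‖) ≤ κ₁ * (‖U‖ * (N * ‖U‖)) := by gcongr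
    _ = (κ₁ * ‖U‖ ^ 2) * N := by ring
    _ ≤ _ := by gcongr

/-- `L²₀(Ω)` as a subspace. -/
def L20sub (Ω : Set (E d)) [IsFiniteMeasure (volume.restrict Ω)] : Submodule ℝ (L2 Ω) where
  carrier := L20 Ω
  zero_mem' := by
    change ∫ x in Ω, (0 : L2 Ω) x = 0
    rw [integral_congr_ae (Lp.coeFn_zero ℝ 2 (volume.restrict Ω))]
    simp
  add_mem' := by
    intro p q hp hq
    change ∫ x in Ω, (p + q) x = 0
    rw [integral_congr_ae (Lp.coeFn_add p q)]
    change ∫ x in Ω, p x + q x = 0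
    rw [integral_add ((Lp.memLp p).integrable (by norm_num))
      ((Lp.memLp q).integrable (by norm_num)), hp, hq, add_zero]
  smul_mem' := by
    intro a p hp
    change ∫ x in Ω, (a • p) x = 0
    rw [integral_congr_ae (Lp.coeFn_smul a p)]
    change ∫ x in Ω, a * p x = 0
    rw [integral_const_mul, hp, mul_zero]

lemma isClosed_L20 [IsFiniteMeasure (volume.restrict Ω)] :
    IsClosed (L20sub Ω : Set (L2 Ω)) := by
  have : Continuous fun q : L2 Ω => ∫ x in Ω, q x := by
    let q1 : L2 Ω := (memLp_const (1 : ℝ)).toLp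
    have hq : (fun w : L2 Ω => ∫ x in Ω, w x) = fun w : L2 Ω => inner ℝ w q1 := by
      ext w
      rw [L2.inner_def]
      apply integral_congr_ae
      filter_upwards [(memLp_const (μ := volume.restrict Ω) (p := 2) (1 : ℝ)).coeFn_toLp] with x h
      rw [h]
      simp
    rw [hq]
    exact continuous_id.inner continuous_const
  exact isClosed_eq this continuous_const

lemma isSolution_mkVV_iff {c : Λ → H1 B → ℝ} (J : H1 B ≃ₗᵢ[ℝ] Λ)
    (hc : ∀ l Y, c (J l) Y = inner ℝ l Y) {Xb : E d → E d} {K : H10 Ω →L[ℝ] H1 B}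
    (hK : ∀ v : H10 Ω, comp B Xb (v : H1 Ω) = K v) {ν : E d → ℝ} {α β γ : ℝ} {f : L2V Ω}
    {g : L2V B} {δ : H1 B} {u : H10 Ω} {X l : H1 B} {p : L2 Ω} :
    IsSolution c Xb ν α β γ f g δ (mkVV u X (J l), p) ↔
      p ∈ L20 Ω ∧
      (∀ v : H10 Ω, aF α ν (u : H1 Ω) v - divForm (v : H1 Ω) p + inner ℝ l (K v)
        = inner ℝ f (fn (v : H1 Ω))) ∧
      (∀ q ∈ L20 Ω, divForm (u : H1 Ω) q = 0) ∧
      (∀ Y : H1 B, aS β γ X Y - inner ℝ l Y = inner ℝ g (fn Y)) ∧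
      (∀ Y : H1 B, inner ℝ Y (K u - X) = inner ℝ Y δ) := by
  constructor
  · intro h
    refine ⟨h.pressure_mem, fun v => ?_, h.incompressible, fun Y => ?_, fun Y => ?_⟩
    · rw [← h.fluid v, hK, mult_mkVV, hc, vel_mkVV]
    · rw [← h.solid Y, mult_mkVV, hc, pos_mkVV]
    · have := h.coupling (J Y)
      rwa [hc, hc, hK] at this
  · rintro ⟨h0, h1, h2, h3, h4⟩
    refine ⟨h0, fun v => ?_, h2, fun Y => ?_, fun μ => ?_⟩
    · rw [← h1 v, hK, mult_mkVV, hc, vel_mkVV]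
    · rw [← h3 Y, mult_mkVV, hc, pos_mkVV]
    · rw [← J.apply_symm_apply μ, hc, hc, vel_mkVV, pos_mkVV, hK]
      exact h4 _

set_option maxHeartbeats 1000000 in
/-- Solvability of the variational problem, with the multiplier replaced by its Riesz
representative. -/
lemma exists_solution (hΩ : IsOpen Ω) (hΩb : Bornology.IsBounded Ω) (K : H10 Ω →L[ℝ] H1 B)
    {ν : E d → ℝ} (hν : MemLp ν ⊤ (volume.restrict Ω)) {ν₀ : ℝ} (hν₀ : 0 < ν₀)
    (hνν₀ : ∀ᵐ x ∂(volume.restrict Ω), ν₀ ≤ ν x) {α β γ : ℝ} (hα : 0 < α) (hβ : 0 ≤ β)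
    (hγ : 0 < γ) (hdiv : InfSupDiv Ω) :
    ∃ C : ℝ, ∀ (f : L2V Ω) (g : L2V B) (δ : H1 B), ∃ (u : H10 Ω) (X l : H1 B) (p : L2 Ω),
      (∀ (u' : H10 Ω) (X' l' : H1 B) (p' : L2 Ω),
        (p' ∈ L20 Ω ∧
          (∀ v : H10 Ω, aF α ν (u' : H1 Ω) v - divForm (v : H1 Ω) p' + inner ℝ l' (K v)
            = inner ℝ f (fn (v : H1 Ω))) ∧
          (∀ q ∈ L20 Ω, divForm (u' : H1 Ω) q = 0) ∧
          (∀ Y : H1 B, aS β γ X' Y - inner ℝ l' Y = inner ℝ g (fn Y)) ∧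
          (∀ Y : H1 B, inner ℝ Y (K u' - X') = inner ℝ Y δ)) ↔
        (u' = u ∧ X' = X ∧ l' = l ∧ p' = p)) ∧
      ‖u‖ + ‖X‖ + ‖l‖ + ‖p‖ ≤ C * (‖f‖ + ‖g‖ + ‖δ‖) := by
  have : IsFiniteMeasure (volume.restrict Ω) := ⟨by
    rw [Measure.restrict_apply_univ]; exact hΩb.measure_lt_top⟩
  have : CompleteSpace (L20sub Ω) := isClosed_L20.completeSpace_coe
  obtain ⟨a₀, ha₀, ha⟩ := aF_coercive hΩ hν hν₀ hνν₀ hα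
  let ι : H10 Ω →L[ℝ] H1 Ω := (H10 Ω).subtypeL
  -- With zero-mean functions as target space, incompressibility tested with `L20 Ω` is exactly D u
  -- = 0, and the adjoint of D is bounded below on the pressure space.
  let D : H10 Ω →L[ℝ] L20sub Ω :=
    ((divL Ω).comp ι).codRestrict (L20sub Ω) fun v => integral_divL hΩ hΩb v.2
  have hDq : ∀ (v : H10 Ω) (q : L20sub Ω), inner ℝ (D v) q = divForm (v : H1 Ω) (q : L2 Ω) :=
    fun v q => (divForm_eq _ _).symm
  obtain ⟨b, hb, hbD⟩ := hdiv
  have hD : ∀ (p : L20sub Ω) (c : ℝ), (∀ v, inner ℝ (D v) p ≤ c * ‖v‖) → b * ‖p‖ ≤ c := by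
    intro p c hpc
    have h1 := (hbD (p : L2 Ω) p.2).trans (iSup_le (a := ((c : ℝ) : EReal)) (by
      rintro ⟨v, hv⟩
      rw [EReal.coe_le_coe_iff, div_le_iff₀ (norm_pos_iff.2 hv), ← hDq]
      exact hpc v))
    exact EReal.coe_le_coe_iff.1 h1
  have hAF : ∀ u v : H10 Ω, aF α ν (u : H1 Ω) v
      = α * inner ℝ ((fnL Ω).comp ι u) ((fnL Ω).comp ι v)
        + inner ℝ (mulNu hν ((symL Ω).comp ι u)) ((symL Ω).comp ι v) := by
    intro u v
    rw [aF, ← inner_mulNu_symL hν]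
    rfl
  obtain ⟨C, hC⟩ := exists_variational_solution (U := H10 Ω) (W := H1 B) (P := L20sub Ω)
    (F := L2V Ω) (G := L2V B) (T₀ := L2T Ω) (T₁ := L2T B) ((fnL Ω).comp ι) ((symL Ω).comp ι)
    (mulNu hν) ha₀ (fun u => by rw [← hAF]; exact ha u u.2) (fnL B) (gradL B) hβ hγ.le K D hb hD
  refine ⟨C, fun f g δ => ?_⟩
  obtain ⟨u, X, l, p, huniq, hbound⟩ := hC f g δ
  refine ⟨u, X, l, p, fun u' X' l' p' => ?_, hbound⟩
  constructor
  · rintro ⟨h0, h1, h2, h3, h4⟩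
    obtain ⟨e1, e2, e3, e4⟩ := (huniq u' X' l' ⟨p', h0⟩).1
      ⟨fun v => by rw [← hAF, hDq]; exact h1 v, fun q => by rw [hDq]; exact h2 q q.2, h3, h4⟩
    exact ⟨e1, e2, e3, by rw [← e4]⟩
  · rintro ⟨rfl, rfl, rfl, rfl⟩
    obtain ⟨h1, h2, h3, h4⟩ := (huniq u' X' l' p).2 ⟨rfl, rfl, rfl, rfl⟩
    refine ⟨p.2, fun v => ?_, fun q hq => ?_, h3, h4⟩
    · have h := h1 v
      rw [← hAF, hDq] at h
      exact h
    · rw [← hDq u' ⟨q, hq⟩]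
      exact h2 _

/-- Well-posedness, for every multiplier space that is isometric to `H¹(B)^d` through the Riesz
representation of `c`. -/
theorem wellPosed_of_riesz (hΩ : IsOpen Ω) (hΩb : Bornology.IsBounded Ω) {c : Λ → H1 B → ℝ}
    (J : H1 B ≃ₗᵢ[ℝ] Λ) (hc : ∀ l Y, c (J l) Y = inner ℝ l Y) {Xb : E d → E d}
    (K : H10 Ω →L[ℝ] H1 B) (hK : ∀ v : H10 Ω, comp B Xb (v : H1 Ω) = K v)
    {ν : E d → ℝ} (hν : MemLp ν ⊤ (volume.restrict Ω)) {ν₀ : ℝ} (hν₀ : 0 < ν₀)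
    (hνν₀ : ∀ᵐ x ∂(volume.restrict Ω), ν₀ ≤ ν x) {α β γ : ℝ} (hα : 0 < α) (hβ : 0 ≤ β)
    (hγ : 0 < γ) (hdiv : InfSupDiv Ω) : WellPosed c Ω Xb ν α β γ := by
  obtain ⟨C, hC⟩ := exists_solution hΩ hΩb K hν hν₀ hνν₀ hα hβ hγ hdiv
  refine ⟨C, fun f g δ => ?_⟩
  obtain ⟨u, X, l, p, huniq, hbound⟩ := hC f g δ
  refine ⟨(mkVV u X (J l), p), (isSolution_mkVV_iff J hc hK).2
    ((huniq _ _ _ _).2 ⟨rfl, rfl, rfl, rfl⟩), ?_, ?_⟩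
  · rintro ⟨U, p'⟩ hs
    have hU : U = mkVV (vel U) (pos U) (J (J.symm (mult U))) := by
      rw [J.apply_symm_apply, mkVV_eta]
    rw [hU] at hs
    obtain ⟨h1, h2, h3, h4⟩ := (huniq _ _ _ _).1 ((isSolution_mkVV_iff J hc hK).1 hs)
    rw [hU, h1, h2, h3, h4]
  · have h1 : ‖mkVV u X (J l)‖ ≤ ‖u‖ + ‖X‖ + ‖l‖ := by
      refine le_of_sq_le_sq ?_ (by positivity)
      rw [norm_sq_VV, vel_mkVV, pos_mkVV, mult_mkVV, J.norm_map]
      have n1 := mul_nonneg (norm_nonneg u) (norm_nonneg X)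
      have n2 := mul_nonneg (norm_nonneg u) (norm_nonneg l)
      have n3 := mul_nonneg (norm_nonneg X) (norm_nonneg l)
      nlinarith
    refine le_trans ?_ hbound
    change ‖mkVV u X (J l)‖ + ‖p‖ ≤ _
    linarith

end Mixed

/-! ### One-dimensional Hardy inequalities -/

section Hardy

/-- A weighted Hardy inequality on an interval. -/
lemma hardy_interval {a a' b : ℝ} (ha : a ≤ a') (hab : a' ≤ b) {φ φ' : ℝ → ℝ}
    (hd : ∀ τ ∈ Icc a' b, HasDerivAt φ (φ' τ) τ) (hc : ContinuousOn φ' (Icc a' b)) :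
    ∫ τ in a'..b, φ τ ^ 2
      ≤ 4 * (∫ τ in a'..b, ((τ - a) * φ' τ) ^ 2) + 2 * ((b - a) * φ b ^ 2) := by
  have hφ : ContinuousOn φ (Icc a' b) := fun τ hτ => (hd τ hτ).continuousAt.continuousWithinAt
  -- Integrate the derivative of (τ - a)φ². The boundary term at a' has the good sign, and the mixed
  -- term is absorbed through ½(φ + 2(τ - a)φ')² ≥ 0. The weight is based at a ≤ a', so that a' can
  -- later decrease to a without any regularity there.
  have hF : ∀ τ ∈ uIcc a' b, HasDerivAt (fun τ => (τ - a) * φ τ ^ 2)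
      (φ τ ^ 2 + 2 * (τ - a) * (φ τ * φ' τ)) τ := by
    intro τ hτ
    rw [uIcc_of_le hab] at hτ
    have h1 : HasDerivAt (fun τ : ℝ => τ - a) 1 τ := (hasDerivAt_id τ).sub_const a
    have h2 : HasDerivAt (fun τ => φ τ ^ 2) (2 * φ τ * φ' τ) τ := by
      simpa using (hd τ hτ).fun_pow 2
    exact (h1.fun_mul h2).congr_deriv (by ring)
  have c1 : ContinuousOn (fun τ => φ τ ^ 2) (uIcc a' b) := by
    rw [uIcc_of_le hab]; exact hφ.pow 2
  have c2 : ContinuousOn (fun τ => ((τ - a) * φ' τ) ^ 2) (uIcc a' b) := by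
    rw [uIcc_of_le hab]; exact ((continuousOn_id.sub continuousOn_const).mul hc).pow 2
  have c3 : ContinuousOn (fun τ => φ τ ^ 2 + 2 * (τ - a) * (φ τ * φ' τ)) (uIcc a' b) := by
    refine c1.add ?_
    rw [uIcc_of_le hab]
    exact (continuousOn_const.mul (continuousOn_id.sub continuousOn_const)).mul (hφ.mul hc)
  have h1 := intervalIntegral.integral_eq_sub_of_hasDerivAt hF c3.intervalIntegrable
  have h2 : ∫ τ in a'..b, (1 / 2 * φ τ ^ 2 - 2 * ((τ - a) * φ' τ) ^ 2)
      ≤ ∫ τ in a'..b, (φ τ ^ 2 + 2 * (τ - a) * (φ τ * φ' τ)) := by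
    refine intervalIntegral.integral_mono_on hab
      ((c1.intervalIntegrable.const_mul _).sub (c2.intervalIntegrable.const_mul _))
      c3.intervalIntegrable fun τ _ => ?_
    nlinarith [sq_nonneg (φ τ + 2 * (τ - a) * φ' τ)]
  rw [intervalIntegral.integral_sub (c1.intervalIntegrable.const_mul _)
    (c2.intervalIntegrable.const_mul _), intervalIntegral.integral_const_mul,
    intervalIntegral.integral_const_mul, h1] at h2
  have h3 : 0 ≤ (a' - a) * φ a' ^ 2 := mul_nonneg (sub_nonneg.2 ha) (sq_nonneg _)
  linarith

lemma ofReal_intervalIntegral {a b : ℝ} (hab : a ≤ b) {g : ℝ → ℝ} (hg : ContinuousOn g (Icc a b))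
    (h0 : ∀ x, 0 ≤ g x) :
    ENNReal.ofReal (∫ τ in a..b, g τ) = ∫⁻ τ in Ioc a b, ENNReal.ofReal (g τ) := by
  rw [intervalIntegral.integral_of_le hab]
  exact ofReal_integral_eq_lintegral_ofReal
    ((hg.integrableOn_compact isCompact_Icc).mono_set Ioc_subset_Icc_self)
    (ae_of_all _ h0)

/-- In extended nonnegative form the inequality can be extended to half-open intervals and
integrated over lines without knowing that anything is finite. -/
lemma hardy_lintegral {a a' b : ℝ} (ha : a ≤ a') (hab : a' ≤ b) {φ φ' : ℝ → ℝ}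
    (hd : ∀ τ ∈ Icc a' b, HasDerivAt φ (φ' τ) τ) (hc : ContinuousOn φ' (Icc a' b)) :
    ∫⁻ τ in Ioc a' b, ENNReal.ofReal (φ τ ^ 2)
      ≤ 4 * (∫⁻ τ in Ioc a' b, ENNReal.ofReal (((τ - a) * φ' τ) ^ 2))
        + ENNReal.ofReal (2 * (b - a)) * ENNReal.ofReal (φ b ^ 2) := by
  have hφ : ContinuousOn φ (Icc a' b) := fun τ hτ => (hd τ hτ).continuousAt.continuousWithinAt
  have c1 : ContinuousOn (fun τ => φ τ ^ 2) (Icc a' b) := hφ.pow 2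
  have c2 : ContinuousOn (fun τ => ((τ - a) * φ' τ) ^ 2) (Icc a' b) :=
    ((continuousOn_id.sub continuousOn_const).mul hc).pow 2
  rw [← ofReal_intervalIntegral hab c1 fun _ => sq_nonneg _,
    ← ofReal_intervalIntegral hab c2 fun _ => sq_nonneg _,
    show (4 : ℝ≥0∞) = ENNReal.ofReal 4 by simp, ← ENNReal.ofReal_mul (by norm_num),
    ← ENNReal.ofReal_mul (by linarith), ← ENNReal.ofReal_add]
  · refine ENNReal.ofReal_le_ofReal ?_
    have := hardy_interval ha hab hd hc
    linarith
  · exact mul_nonneg (by norm_num)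
      (intervalIntegral.integral_nonneg hab fun _ _ => sq_nonneg _)
  · exact mul_nonneg (by linarith) (sq_nonneg _)

/-- The Hardy inequality with the boundary term averaged over the last third of an interval. -/
lemma hardy_averaged {a T : ℝ} (ha : 0 ≤ a) (hT : 0 < T) {φ φ' : ℝ → ℝ}
    (hd : ∀ τ ∈ Ioc a (3 * T), HasDerivAt φ (φ' τ) τ) (hc : ContinuousOn φ' (Ioc a (3 * T))) :
    ∫⁻ τ in Ioc a T, ENNReal.ofReal (φ τ ^ 2)
      ≤ 4 * (∫⁻ τ in Ioc a (3 * T), ENNReal.ofReal (((τ - a) * φ' τ) ^ 2))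
        + 6 * ∫⁻ τ in Ioc (2 * T) (3 * T), ENNReal.ofReal (φ τ ^ 2) := by
  set I := ∫⁻ τ in Ioc a (3 * T), ENNReal.ofReal (((τ - a) * φ' τ) ^ 2) with hI
  -- The constants do not depend on a', so the intervals with a' > a exhaust the half-open interval
  -- at the end.
  have key : ∀ a' : ℝ, a < a' → ∫⁻ τ in Ioc a' T, ENNReal.ofReal (φ τ ^ 2)
      ≤ 4 * I + 6 * ∫⁻ τ in Ioc (2 * T) (3 * T), ENNReal.ofReal (φ τ ^ 2) := by
    intro a' ha'
    by_cases hTa : T < a'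
    · simp [Ioc_eq_empty (not_lt.2 hTa.le)]
    push Not at hTa
    have h1 : ∀ b ∈ Ioc (2 * T) (3 * T), ∫⁻ τ in Ioc a' T, ENNReal.ofReal (φ τ ^ 2)
        ≤ 4 * I + ENNReal.ofReal (6 * T) * ENNReal.ofReal (φ b ^ 2) := by
      intro b hb
      have hsub : Icc a' b ⊆ Ioc a (3 * T) := fun τ hτ =>
        ⟨ha'.trans_le hτ.1, hτ.2.trans hb.2⟩
      refine (lintegral_mono_set (Ioc_subset_Ioc_right (by linarith [hb.1] : T ≤ b))).trans ?_
      refine (hardy_lintegral ha'.le (by linarith [hb.1]) (fun τ hτ => hd τ (hsub hτ))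
        (hc.mono hsub)).trans ?_
      refine add_le_add (mul_le_mul_right (lintegral_mono_set (Ioc_subset_Icc_self.trans hsub)) 4)
        (mul_le_mul_left (ENNReal.ofReal_le_ofReal ?_) _)
      linarith [hb.2]
    -- Averaging the endpoint b over (2T, 3T], of length T: the boundary coefficient 2(b - a) is at
    -- most 6T, which leaves the factor 6.
    have h2 : ENNReal.ofReal T * ∫⁻ τ in Ioc a' T, ENNReal.ofReal (φ τ ^ 2)
        ≤ ENNReal.ofReal T * (4 * I + 6 * ∫⁻ τ in Ioc (2 * T) (3 * T),
          ENNReal.ofReal (φ τ ^ 2)) := by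
      have hv : volume (Ioc (2 * T) (3 * T)) = ENNReal.ofReal T := by
        rw [Real.volume_Ioc]; congr 1; ring
      calc ENNReal.ofReal T * ∫⁻ τ in Ioc a' T, ENNReal.ofReal (φ τ ^ 2)
          = ∫⁻ _ in Ioc (2 * T) (3 * T), ∫⁻ τ in Ioc a' T, ENNReal.ofReal (φ τ ^ 2) := by
            rw [setLIntegral_const, hv, mul_comm]
        _ ≤ ∫⁻ b in Ioc (2 * T) (3 * T),
            (4 * I + ENNReal.ofReal (6 * T) * ENNReal.ofReal (φ b ^ 2)) :=
            setLIntegral_mono' measurableSet_Ioc h1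
        _ = ENNReal.ofReal T * (4 * I) + ENNReal.ofReal (6 * T)
            * ∫⁻ b in Ioc (2 * T) (3 * T), ENNReal.ofReal (φ b ^ 2) := by
            rw [lintegral_add_left measurable_const, setLIntegral_const, hv,
              lintegral_const_mul' _ _ ENNReal.ofReal_ne_top, mul_comm]
        _ = _ := by
            rw [mul_comm (6 : ℝ) T, ENNReal.ofReal_mul hT.le, mul_add, mul_assoc]
            simp
    exact (ENNReal.mul_le_mul_iff_right (by simpa using hT) ENNReal.ofReal_ne_top).1 h2
  have hU : Ioc a T = ⋃ n : ℕ, Ioc (a + 1 / ((n : ℝ) + 1)) T := by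
    ext τ
    simp only [mem_iUnion, mem_Ioc]
    constructor
    · rintro ⟨h1, h2⟩
      obtain ⟨n, hn⟩ := exists_nat_one_div_lt (sub_pos.2 h1)
      exact ⟨n, by linarith, h2⟩
    · rintro ⟨n, h1, h2⟩
      have : (0 : ℝ) < 1 / ((n : ℝ) + 1) := by positivity
      exact ⟨by linarith, h2⟩
  rw [hU, setLIntegral_iUnion_of_directed]
  · exact iSup_le fun n => key _ (by
      have : (0 : ℝ) < 1 / ((n : ℝ) + 1) := by positivity
      linarith)
  · refine Monotone.directed_le fun n k hnk => Ioc_subset_Ioc_left ?_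
    have : (1 : ℝ) / ((k : ℝ) + 1) ≤ 1 / ((n : ℝ) + 1) :=
      one_div_le_one_div_of_le (by positivity) (by exact_mod_cast Nat.succ_le_succ hnk)
    linarith

end Hardy

/-! ### Hardy's inequality with the distance weight on cone sets -/

section Weighted

variable {d : ℕ} {Ω : Set (E d)}

/-- The distance to the complement of `Ω`. -/
abbrev bdist (Ω : Set (E d)) (x : E d) : ℝ := Metric.infDist x Ωᶜ

lemma mem_of_bdist_pos {x : E d} (h : 0 < bdist Ω x) : x ∈ Ω := by
  by_contra hx
  exact h.ne' (Metric.infDist_zero_of_mem hx)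

/-- The density of the weighted Dirichlet energy, extended by zero. -/
def wDens (Ω : Set (E d)) (f : E d → ℝ) : E d → ℝ≥0∞ :=
  Ω.indicator fun x => ENNReal.ofReal ((bdist Ω x * ‖fderiv ℝ f x‖) ^ 2)

/-- The Dirichlet energy, weighted with the squared distance to the boundary. -/
def wEnergy (Ω : Set (E d)) (f : E d → ℝ) : ℝ≥0∞ := ∫⁻ x, wDens Ω f x

lemma measurable_indicator_of_continuousOn {K : Set (E d)} (hK : MeasurableSet K)
    {g : E d → ℝ≥0∞} (hg : ContinuousOn g K) : Measurable (K.indicator g) := by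
  classical
  rw [← piecewise_eq_indicator]
  exact hg.measurable_piecewise continuousOn_const hK

lemma measurable_wDens (hΩ : IsOpen Ω) {f : E d → ℝ} (hf : ContDiffOn ℝ 1 f Ω) :
    Measurable (wDens Ω f) := by
  refine measurable_indicator_of_continuousOn hΩ.measurableSet ?_
  refine ENNReal.continuous_ofReal.comp_continuousOn ?_
  exact ((Metric.continuous_infDist_pt _).continuousOn.mul
    (hf.continuousOn_fderiv_of_isOpen hΩ le_rfl).norm).pow 2

/-- Integrals of averages over segments of fixed direction. -/
lemma lintegral_segment {F : E d → ℝ≥0∞} (hF : Measurable F) (e : E d) (a b : ℝ) :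
    ∫⁻ x, ∫⁻ τ in Ioc a b, F (x + τ • e) = ENNReal.ofReal (b - a) * ∫⁻ x, F x := by
  rw [lintegral_lintegral_swap]
  · simp_rw [lintegral_add_right_eq_self F]
    rw [setLIntegral_const, Real.volume_Ioc, mul_comm]
  · refine Measurable.aemeasurable ?_
    exact hF.comp (measurable_fst.add (measurable_snd.smul_const e))

lemma hasDerivAt_segment (hΩ : IsOpen Ω) {f : E d → ℝ} (hf : ContDiffOn ℝ 1 f Ω) (x e : E d)
    {τ : ℝ} (h : x + τ • e ∈ Ω) :
    HasDerivAt (fun τ : ℝ => f (x + τ • e)) (fderiv ℝ f (x + τ • e) e) τ := by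
  have h1 : HasFDerivAt f (fderiv ℝ f (x + τ • e)) (x + τ • e) :=
    ((hf.differentiableOn (by simp)).differentiableAt (hΩ.mem_nhds h)).hasFDerivAt
  have h2 : HasDerivAt (fun τ : ℝ => x + τ • e) e τ := by
    simpa using ((hasDerivAt_id τ).smul_const e).const_add x
  exact h1.comp_hasDerivAt τ h2

lemma continuousOn_segment (hΩ : IsOpen Ω) {f : E d → ℝ} (hf : ContDiffOn ℝ 1 f Ω) (x e : E d)
    {s : Set ℝ} (h : ∀ τ ∈ s, x + τ • e ∈ Ω) :
    ContinuousOn (fun τ : ℝ => fderiv ℝ f (x + τ • e) e) s := by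
  have h1 : ContinuousOn (fun τ : ℝ => x + τ • e) s := by fun_prop
  exact ((hf.continuousOn_fderiv_of_isOpen hΩ le_rfl).comp h1 h).clm_apply continuousOn_const

/-- The points from which a cone with axis `e` fits into `Ω`. -/
def coneSet (Ω : Set (E d)) (e : E d) (c T : ℝ) : Set (E d) :=
  {x | x ∈ Ω ∧ ∀ t ∈ Ioc 0 (3 * T), c * t ≤ bdist Ω (x + t • e)}

lemma measurableSet_coneSet (hΩ : IsOpen Ω) (e : E d) (c T : ℝ) :
    MeasurableSet (coneSet Ω e c T) := by
  have : coneSet Ω e c T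
      = Ω ∩ ⋂ t ∈ Ioc 0 (3 * T), {x | c * t ≤ bdist Ω (x + t • e)} := by
    ext x; simp [coneSet]
  rw [this]
  refine hΩ.measurableSet.inter (IsClosed.measurableSet ?_)
  refine isClosed_biInter fun t _ => isClosed_le continuous_const ?_
  exact (Metric.continuous_infDist_pt _).comp (continuous_id.add continuous_const)

/-- The Hardy inequality along a segment. -/
lemma hardy_segment (hΩ : IsOpen Ω) {f : E d → ℝ} (hf : ContDiffOn ℝ 1 f Ω) {e : E d}
    (he : ‖e‖ = 1) {c T : ℝ} (hc : 0 < c) (hT : 0 < T) (x : E d) :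
    ∫⁻ τ in Ioc 0 T, (coneSet Ω e c T).indicator (fun y => ENNReal.ofReal (f y ^ 2)) (x + τ • e)
      ≤ ENNReal.ofReal (4 / c ^ 2) * (∫⁻ τ in Ioc 0 (3 * T), wDens Ω f (x + τ • e))
        + 6 * ∫⁻ τ in Ioc (2 * T) (3 * T), {y | c * T ≤ bdist Ω y}.indicator
          (fun y => ENNReal.ofReal (f y ^ 2)) (x + τ • e) := by
  set S := {τ : ℝ | τ ∈ Ioc 0 T ∧ x + τ • e ∈ coneSet Ω e c T} with hS
  by_cases hne : S.Nonempty
  swap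
  · rw [setLIntegral_congr_fun (g := fun _ => 0) measurableSet_Ioc]
    · simp
    · intro τ hτ
      exact indicator_of_notMem (fun h => hne ⟨τ, hτ, h⟩) _
  -- The line first meets the cone set at parameter a. From points s of S arbitrarily close to a,
  -- the defining property of the cone set gives bdist ≥ c(τ - s) further along the line, hence
  -- bdist ≥ c(τ - a). So the Hardy weight τ - a is dominated by the distance to the complement, and
  -- the rest of the segment lies in Ω.
  set a := sInf S with ha
  have hbdd : BddBelow S := ⟨0, fun τ hτ => hτ.1.1.le⟩
  have ha0 : 0 ≤ a := le_csInf hne fun τ hτ => hτ.1.1.le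
  have haT : a ≤ T := by
    obtain ⟨τ, hτ⟩ := hne
    exact (csInf_le hbdd hτ).trans hτ.1.2
  have hρ : ∀ τ ∈ Ioc a (3 * T), c * (τ - a) ≤ bdist Ω (x + τ • e) := by
    intro τ hτ
    by_contra hlt
    push Not at hlt
    have h1 : a < τ - bdist Ω (x + τ • e) / c := by
      have : bdist Ω (x + τ • e) / c < τ - a := by rw [div_lt_iff₀ hc]; linarith
      linarith
    obtain ⟨s, hs, hsl⟩ := exists_lt_of_csInf_lt hne h1
    have h2 : 0 ≤ bdist Ω (x + τ • e) / c := div_nonneg Metric.infDist_nonneg hc.le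
    have h3 := hs.2.2 (τ - s) ⟨by linarith, by linarith [hs.1.1, hτ.2]⟩
    have h4 : x + s • e + (τ - s) • e = x + τ • e := by
      rw [add_assoc, ← add_smul]; congr 2; ring
    rw [h4] at h3
    have h5 : bdist Ω (x + τ • e) / c < τ - s := by linarith
    rw [div_lt_iff₀ hc] at h5
    linarith
  have hmem : ∀ τ ∈ Ioc a (3 * T), x + τ • e ∈ Ω := fun τ hτ =>
    mem_of_bdist_pos (lt_of_lt_of_le (mul_pos hc (sub_pos.2 hτ.1)) (hρ τ hτ))
  have h1 := hardy_averaged ha0 hT (fun τ hτ => hasDerivAt_segment hΩ hf x e (hmem τ hτ))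
    (continuousOn_segment hΩ hf x e hmem)
  have hL : ∫⁻ τ in Ioc 0 T, (coneSet Ω e c T).indicator (fun y => ENNReal.ofReal (f y ^ 2))
      (x + τ • e) ≤ ∫⁻ τ in Ioc a T, ENNReal.ofReal (f (x + τ • e) ^ 2) := by
    have h2 : ∀ τ ∈ Ioc 0 T, (coneSet Ω e c T).indicator (fun y => ENNReal.ofReal (f y ^ 2))
        (x + τ • e) ≤ (Icc a T).indicator (fun τ => ENNReal.ofReal (f (x + τ • e) ^ 2)) τ := by
      intro τ hτ
      by_cases hm : x + τ • e ∈ coneSet Ω e c T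
      · rw [indicator_of_mem hm, indicator_of_mem]
        exact ⟨csInf_le hbdd ⟨hτ, hm⟩, hτ.2⟩
      · rw [indicator_of_notMem hm]
        exact zero_le
    refine (setLIntegral_mono' measurableSet_Ioc h2).trans ?_
    refine (setLIntegral_le_lintegral _ _).trans_eq ?_
    rw [lintegral_indicator measurableSet_Icc, setLIntegral_congr Ioc_ae_eq_Icc]
  refine hL.trans (h1.trans (add_le_add ?_ ?_))
  · have h2 : ∫⁻ τ in Ioc a (3 * T), ENNReal.ofReal (((τ - a) * fderiv ℝ f (x + τ • e) e) ^ 2)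
        ≤ ∫⁻ τ in Ioc 0 (3 * T), ENNReal.ofReal (1 / c ^ 2) * wDens Ω f (x + τ • e) := by
      refine le_trans (setLIntegral_mono' measurableSet_Ioc fun τ hτ => ?_)
        (lintegral_mono_set (Ioc_subset_Ioc_left ha0))
      rw [wDens, indicator_of_mem (hmem τ hτ), ← ENNReal.ofReal_mul (by positivity)]
      refine ENNReal.ofReal_le_ofReal ?_
      have h3 : |fderiv ℝ f (x + τ • e) e| ≤ ‖fderiv ℝ f (x + τ • e)‖ := by
        have := (fderiv ℝ f (x + τ • e)).le_opNorm e
        rwa [he, mul_one, Real.norm_eq_abs] at this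
      have h4 : τ - a ≤ bdist Ω (x + τ • e) / c := by
        rw [le_div_iff₀ hc]; linarith [hρ τ hτ]
      have h5 : 0 ≤ τ - a := (sub_pos.2 hτ.1).le
      rw [mul_pow, ← sq_abs (fderiv ℝ f (x + τ • e) e)]
      calc (τ - a) ^ 2 * |fderiv ℝ f (x + τ • e) e| ^ 2
          ≤ (bdist Ω (x + τ • e) / c) ^ 2 * ‖fderiv ℝ f (x + τ • e)‖ ^ 2 := by gcongr
        _ = _ := by ring
    calc _ ≤ 4 * ∫⁻ τ in Ioc 0 (3 * T), ENNReal.ofReal (1 / c ^ 2) * wDens Ω f (x + τ • e) := by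
          gcongr
      _ = _ := by
          rw [lintegral_const_mul' _ _ ENNReal.ofReal_ne_top, ← mul_assoc,
            show (4 : ℝ≥0∞) = ENNReal.ofReal 4 by simp, ← ENNReal.ofReal_mul (by norm_num)]
          congr 2
          ring
  · gcongr 6 * ?_
    refine setLIntegral_mono' measurableSet_Ioc fun τ hτ => ?_
    rw [indicator_of_mem]
    -- As a ≤ T, parameters beyond 2T satisfy τ - a ≥ T, so the averaged boundary term lives in the
    -- interior of Ω.
    have := hρ τ ⟨by linarith [hτ.1], hτ.2⟩
    refine le_trans ?_ this
    gcongr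
    linarith [hτ.1]

/-- The Hardy inequality on the set of points from which a cone of fixed direction fits
into `Ω`. -/
lemma hardy_coneSet (hΩ : IsOpen Ω) {f : E d → ℝ} (hf : ContDiffOn ℝ 1 f Ω) {e : E d}
    (he : ‖e‖ = 1) {c T : ℝ} (hc : 0 < c) (hT : 0 < T) :
    ∫⁻ x in coneSet Ω e c T, ENNReal.ofReal (f x ^ 2)
      ≤ ENNReal.ofReal (12 / c ^ 2) * wEnergy Ω f
        + 6 * ∫⁻ x in {y | c * T ≤ bdist Ω y}, ENNReal.ofReal (f x ^ 2) := by
  have hsq : ContinuousOn (fun y => ENNReal.ofReal (f y ^ 2)) Ω :=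
    ENNReal.continuous_ofReal.comp_continuousOn (hf.continuousOn.pow 2)
  have hmA := measurableSet_coneSet hΩ e c T
  have hmK : MeasurableSet {y | c * T ≤ bdist Ω y} :=
    (isClosed_le continuous_const (Metric.continuous_infDist_pt _)).measurableSet
  have m1 : Measurable ((coneSet Ω e c T).indicator fun y => ENNReal.ofReal (f y ^ 2)) :=
    measurable_indicator_of_continuousOn hmA (hsq.mono fun x hx => hx.1)
  have m2 : Measurable ({y | c * T ≤ bdist Ω y}.indicator fun y => ENNReal.ofReal (f y ^ 2)) :=
    measurable_indicator_of_continuousOn hmK (hsq.mono fun x hx =>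
      mem_of_bdist_pos (lt_of_lt_of_le (mul_pos hc hT) hx))
  have m3 := measurable_wDens hΩ hf
  -- The segment inequality is integrated over all base points. By Fubini and translation invariance
  -- each inner integral becomes the segment length, T, 3T or T, times an integral over space;
  -- dividing by T leaves the constants 12/c² and 6.
  have h1 := lintegral_mono (μ := volume) fun x => hardy_segment hΩ hf he hc hT x
  rw [lintegral_segment m1, lintegral_add_left, lintegral_const_mul' _ _ ENNReal.ofReal_ne_top,
    lintegral_const_mul' _ _ (by simp), lintegral_segment m3, lintegral_segment m2,
    lintegral_indicator hmA, lintegral_indicator hmK] at h1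
  · have h2 : ENNReal.ofReal T * ∫⁻ x in coneSet Ω e c T, ENNReal.ofReal (f x ^ 2)
        ≤ ENNReal.ofReal T * (ENNReal.ofReal (12 / c ^ 2) * wEnergy Ω f
        + 6 * ∫⁻ x in {y | c * T ≤ bdist Ω y}, ENNReal.ofReal (f x ^ 2)) := by
      rw [sub_zero, sub_zero, show 3 * T - 2 * T = T by ring, ← mul_assoc, ← mul_assoc,
        ← ENNReal.ofReal_mul (by positivity)] at h1
      refine h1.trans_eq ?_
      rw [mul_add, ← mul_assoc, ← mul_assoc, ← ENNReal.ofReal_mul hT.le, wEnergy,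
        mul_comm 6 (ENNReal.ofReal T), mul_assoc (ENNReal.ofReal T) 6,
        show 4 / c ^ 2 * 3 * T = T * (12 / c ^ 2) by ring]
    exact (ENNReal.mul_le_mul_iff_right (by simpa using hT) ENNReal.ofReal_ne_top).1 h2
  · refine Measurable.const_mul ?_ _
    have : Measurable (Function.uncurry fun (x : E d) (τ : ℝ) => wDens Ω f (x + τ • e)) :=
      m3.comp (measurable_fst.add (measurable_snd.smul_const e))
    exact this.lintegral_prod_right'

end Weighted

/-! ### The improved Poincaré inequality -/

section ImprovedPoincare

variable {d : ℕ} {Ω : Set (E d)}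

lemma compl_nonempty_of_isBounded (hd : 0 < d) (hb : Bornology.IsBounded Ω) : Ωᶜ.Nonempty := by
  rw [nonempty_compl]
  rintro rfl
  have : Nonempty (Fin d) := ⟨⟨0, hd⟩⟩
  exact NormedSpace.unbounded_univ ℝ (E d) hb

lemma bdist_pos (hΩ : IsOpen Ω) (hne : Ωᶜ.Nonempty) {x : E d} (hx : x ∈ Ω) : 0 < bdist Ω x :=
  (hΩ.isClosed_compl.notMem_iff_infDist_pos hne).1 (by simpa using hx)

lemma bdist_sub_le (x y : E d) : bdist Ω x - dist x y ≤ bdist Ω y := by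
  have := Metric.infDist_le_infDist_add_dist (s := Ωᶜ) (x := x) (y := y)
  linarith

lemma sq_intervalIntegral_le {g : ℝ → ℝ} (hg : ContinuousOn g (Icc 0 1)) :
    (∫ τ in (0 : ℝ)..1, g τ) ^ 2 ≤ ∫ τ in (0 : ℝ)..1, g τ ^ 2 := by
  set m := ∫ τ in (0 : ℝ)..1, g τ with hm
  have c1 : ContinuousOn g (uIcc 0 1) := by rwa [uIcc_of_le zero_le_one]
  have c2 : ContinuousOn (fun τ => g τ ^ 2) (uIcc 0 1) := c1.pow 2
  have h := intervalIntegral.integral_nonneg (μ := volume) (zero_le_one' ℝ)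
    (fun τ _ => sq_nonneg (g τ - m))
  have e : ∀ τ, (g τ - m) ^ 2 = g τ ^ 2 - 2 * m * g τ + m ^ 2 := fun τ => by ring
  simp_rw [e] at h
  rw [intervalIntegral.integral_add (c2.intervalIntegrable.sub
    (c1.intervalIntegrable.const_mul _)) (by simp), intervalIntegral.integral_sub
    c2.intervalIntegrable (c1.intervalIntegrable.const_mul _),
    intervalIntegral.integral_const_mul, ← hm] at h
  simp at h
  nlinarith

/-- Differences along a translation are bounded by the weighted energy. -/
lemma lintegral_translate_sub_le (hΩ : IsOpen Ω) {f : E d → ℝ} (hf : ContDiffOn ℝ 1 f Ω)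
    {U : Set (E d)} (hU : MeasurableSet U) {w : E d} {c : ℝ} (hc : 0 < c)
    (h : ∀ y ∈ U, ∀ t ∈ Icc (0 : ℝ) 1, c ≤ bdist Ω (y + t • w)) :
    ∫⁻ y in U, ENNReal.ofReal ((f (y + w) - f y) ^ 2)
      ≤ ENNReal.ofReal (‖w‖ ^ 2 / c ^ 2) * wEnergy Ω f := by
  have key : ∀ y ∈ U, ENNReal.ofReal ((f (y + w) - f y) ^ 2)
      ≤ ∫⁻ τ in Ioc (0 : ℝ) 1, ENNReal.ofReal (‖w‖ ^ 2 / c ^ 2) * wDens Ω f (y + τ • w) := by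
    intro y hy
    have hm : ∀ t ∈ Icc (0 : ℝ) 1, y + t • w ∈ Ω := fun t ht =>
      mem_of_bdist_pos (hc.trans_le (h y hy t ht))
    have hcont := continuousOn_segment hΩ hf y w hm
    have hi := intervalIntegral.integral_eq_sub_of_hasDerivAt (a := 0) (b := 1)
      (f := fun τ : ℝ => f (y + τ • w))
      (fun τ hτ => hasDerivAt_segment hΩ hf y w (hm τ (by rwa [uIcc_of_le zero_le_one] at hτ)))
      (by rw [intervalIntegrable_iff_integrableOn_Icc_of_le zero_le_one]
          exact hcont.integrableOn_compact isCompact_Icc)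
    simp only [one_smul, zero_smul, add_zero] at hi
    rw [← hi]
    have hcont2 : ContinuousOn (fun τ : ℝ => (fderiv ℝ f (y + τ • w) w) ^ 2) (Icc 0 1) :=
      hcont.pow 2
    refine (ENNReal.ofReal_le_ofReal (sq_intervalIntegral_le hcont)).trans ?_
    rw [ofReal_intervalIntegral zero_le_one hcont2 fun _ => sq_nonneg _]
    refine setLIntegral_mono' measurableSet_Ioc fun τ hτ => ?_
    have hτ' := Ioc_subset_Icc_self hτ
    rw [wDens, indicator_of_mem (hm τ hτ'), ← ENNReal.ofReal_mul (by positivity)]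
    refine ENNReal.ofReal_le_ofReal ?_
    have h1 : |fderiv ℝ f (y + τ • w) w| ≤ ‖fderiv ℝ f (y + τ • w)‖ * ‖w‖ :=
      (fderiv ℝ f (y + τ • w)).le_opNorm w
    have h2 := h y hy τ hτ'
    rw [← sq_abs (fderiv ℝ f (y + τ • w) w)]
    have h3 : 1 ≤ bdist Ω (y + τ • w) / c := by rwa [le_div_iff₀ hc, one_mul]
    calc |fderiv ℝ f (y + τ • w) w| ^ 2 ≤ (1 * (‖fderiv ℝ f (y + τ • w)‖ * ‖w‖)) ^ 2 := by
          rw [one_mul]; gcongr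
      _ ≤ (bdist Ω (y + τ • w) / c * (‖fderiv ℝ f (y + τ • w)‖ * ‖w‖)) ^ 2 := by gcongr
      _ = _ := by field_simp
  refine (setLIntegral_mono' hU key).trans ((setLIntegral_le_lintegral _ _).trans_eq ?_)
  simp_rw [lintegral_const_mul' _ _ ENNReal.ofReal_ne_top]
  rw [lintegral_segment (measurable_wDens hΩ hf)]
  simp [wEnergy]

lemma ofReal_sq_le_two (a b : ℝ) : ENNReal.ofReal (a ^ 2)
    ≤ 2 * ENNReal.ofReal (b ^ 2) + 2 * ENNReal.ofReal ((b - a) ^ 2) := by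
  rw [show (2 : ℝ≥0∞) = ENNReal.ofReal 2 by simp, ← ENNReal.ofReal_mul (by norm_num),
    ← ENNReal.ofReal_mul (by norm_num), ← ENNReal.ofReal_add (by positivity) (by positivity)]
  refine ENNReal.ofReal_le_ofReal ?_
  nlinarith [sq_nonneg (a - 2 * b)]

/-- On the set `S`, the `L²` norm is controlled by the weighted energy and the `L²` norm
on `S₀`. -/
def Controlled (Ω S₀ S : Set (E d)) : Prop :=
  ∃ C : ℝ≥0∞, C ≠ ⊤ ∧ ∀ f : E d → ℝ, ContDiffOn ℝ 1 f Ω →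
    ∫⁻ x in S, ENNReal.ofReal (f x ^ 2)
      ≤ C * (wEnergy Ω f + ∫⁻ x in S₀, ENNReal.ofReal (f x ^ 2))

lemma Controlled.mono {S₀ S S' : Set (E d)} (h : Controlled Ω S₀ S) (hS : S' ⊆ S) :
    Controlled Ω S₀ S' := by
  obtain ⟨C, hC, h⟩ := h
  exact ⟨C, hC, fun f hf => (lintegral_mono_set hS).trans (h f hf)⟩

lemma Controlled.union {S₀ S S' : Set (E d)} (h : Controlled Ω S₀ S) (h' : Controlled Ω S₀ S') :
    Controlled Ω S₀ (S ∪ S') := by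
  obtain ⟨C, hC, h⟩ := h
  obtain ⟨C', hC', h'⟩ := h'
  refine ⟨C + C', by simp [hC, hC'], fun f hf => (lintegral_union_le _ _ _).trans ?_⟩
  rw [add_mul]
  exact add_le_add (h f hf) (h' f hf)

lemma controlled_empty (S₀ : Set (E d)) : Controlled Ω S₀ ∅ := ⟨0, by simp, by simp⟩

/-- The energy term is the same for all sets, so control can be passed along chains of balls and
then out to the boundary. -/
lemma Controlled.trans {S₀ S S' : Set (E d)} (h : Controlled Ω S₀ S) (h' : Controlled Ω S S') :
    Controlled Ω S₀ S' := by
  obtain ⟨C, hC, h⟩ := h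
  obtain ⟨C', hC', h'⟩ := h'
  refine ⟨C' * (1 + C), ENNReal.mul_ne_top hC' (by simp [hC]), fun f hf => (h' f hf).trans ?_⟩
  rw [mul_assoc]
  gcongr
  rw [add_mul, one_mul]
  exact add_le_add (self_le_add_right _ _) (h f hf)

/-- Compare f at z with f at z + (x - y). The segments joining such points stay within 2R of y,
hence farther than R from the complement, where the weight costs only a constant. -/
lemma controlled_ball_translate (hΩ : IsOpen Ω) {x y : E d} {r R : ℝ} (hR : 0 < R)
    (hy : 4 * R ≤ bdist Ω y) (hr : r ≤ R) (hxy : dist x y ≤ R) :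
    Controlled Ω (Metric.ball x r) (Metric.ball y r) := by
  refine ⟨2 + 2 * ENNReal.ofReal (‖x - y‖ ^ 2 / R ^ 2),
    ENNReal.add_ne_top.2 ⟨by simp, ENNReal.mul_ne_top (by simp) ENNReal.ofReal_ne_top⟩,
    fun f hf => ?_⟩
  have hsq : ContinuousOn (fun z => ENNReal.ofReal (f z ^ 2)) Ω :=
    ENNReal.continuous_ofReal.comp_continuousOn (hf.continuousOn.pow 2)
  have h1 := lintegral_translate_sub_le hΩ hf (U := Metric.ball y r) (w := x - y)
    measurableSet_ball hR (by
      intro z hz t ht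
      have h2 : dist y (z + t • (x - y)) ≤ 2 * R := by
        rw [dist_comm, dist_eq_norm, show z + t • (x - y) - y = (z - y) + t • (x - y) by abel]
        refine (norm_add_le _ _).trans ?_
        rw [norm_smul, Real.norm_of_nonneg ht.1, ← dist_eq_norm, ← dist_eq_norm]
        have := mul_le_mul ht.2 hxy dist_nonneg zero_le_one
        linarith [Metric.mem_ball.1 hz]
      linarith [bdist_sub_le (Ω := Ω) y (z + t • (x - y))])
  have h2 : ∫⁻ z in Metric.ball y r, ENNReal.ofReal (f (z + (x - y)) ^ 2)
      = ∫⁻ z in Metric.ball x r, ENNReal.ofReal (f z ^ 2) := by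
    rw [← lintegral_indicator measurableSet_ball, ← lintegral_indicator measurableSet_ball,
      ← lintegral_add_right_eq_self ((Metric.ball x r).indicator _) (x - y)]
    congr 1
    ext z
    have : z + (x - y) ∈ Metric.ball x r ↔ z ∈ Metric.ball y r := by
      rw [Metric.mem_ball, Metric.mem_ball, dist_eq_norm, dist_eq_norm]
      congr! 2
      abel
    by_cases hz : z ∈ Metric.ball y r
    · rw [indicator_of_mem hz, indicator_of_mem (this.2 hz)]
    · rw [indicator_of_notMem hz, indicator_of_notMem (mt this.1 hz)]
  have hm : AEMeasurable (fun z => 2 * ENNReal.ofReal (f (z + (x - y)) ^ 2))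
      (volume.restrict (Metric.ball y r)) := by
    refine AEMeasurable.const_mul ?_ _
    refine ContinuousOn.aemeasurable ?_ measurableSet_ball
    refine hsq.comp (by fun_prop) fun z hz => mem_of_bdist_pos ?_
    have h2 : dist y (z + (x - y)) ≤ 2 * R := by
      rw [dist_comm, dist_eq_norm, show z + (x - y) - y = (z - y) + (x - y) by abel]
      refine (norm_add_le _ _).trans ?_
      rw [← dist_eq_norm, ← dist_eq_norm]
      linarith [Metric.mem_ball.1 hz]
    linarith [bdist_sub_le (Ω := Ω) y (z + (x - y))]
  calc ∫⁻ z in Metric.ball y r, ENNReal.ofReal (f z ^ 2)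
      ≤ ∫⁻ z in Metric.ball y r, (2 * ENNReal.ofReal (f (z + (x - y)) ^ 2)
        + 2 * ENNReal.ofReal ((f (z + (x - y)) - f z) ^ 2)) :=
        lintegral_mono fun z => ofReal_sq_le_two _ _
    _ = 2 * (∫⁻ z in Metric.ball x r, ENNReal.ofReal (f z ^ 2))
        + 2 * ∫⁻ z in Metric.ball y r, ENNReal.ofReal ((f (z + (x - y)) - f z) ^ 2) := by
        rw [lintegral_add_left' hm, lintegral_const_mul' _ _ (by simp),
          lintegral_const_mul' _ _ (by simp), h2]
    _ ≤ 2 * (∫⁻ z in Metric.ball x r, ENNReal.ofReal (f z ^ 2))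
        + 2 * (ENNReal.ofReal (‖x - y‖ ^ 2 / R ^ 2) * wEnergy Ω f) := by gcongr
    _ ≤ _ := by
        rw [mul_add, add_comm, add_mul 2, ← mul_assoc, add_mul 2]
        exact add_le_add (self_le_add_left _ _) (self_le_add_right _ _)

/-- The points with a controlled ball form an open set. It is relatively closed in Ω: a limit point
y in Ω has such a point within a quarter of its distance to the complement, and translation carries
the ball to y. Connectedness concludes. -/
lemma exists_controlled_ball (hΩ : IsOpen Ω) (hconn : IsPreconnected Ω) (hne : Ωᶜ.Nonempty)
    {x₀ : E d} (hx₀ : x₀ ∈ Ω) {r₀ : ℝ} (hr₀ : 0 < r₀) {x : E d} (hx : x ∈ Ω) :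
    ∃ r > 0, Controlled Ω (Metric.ball x₀ r₀) (Metric.ball x r) := by
  set A := {x | ∃ r > 0, Controlled Ω (Metric.ball x₀ r₀) (Metric.ball x r)} with hA
  have hopen : IsOpen A := by
    rw [Metric.isOpen_iff]
    rintro x ⟨r, hr, h⟩
    refine ⟨r, hr, fun y hy => ⟨r - dist y x, sub_pos.2 hy, h.mono ?_⟩⟩
    exact Metric.ball_subset_ball' (by linarith)
  refine hconn.subset_of_closure_inter_subset hopen ⟨x₀, hx₀, r₀, hr₀, 1, by simp, fun f _ => ?_⟩
    ?_ hx
  · rw [one_mul]; exact self_le_add_left _ _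
  · rintro y ⟨hyA, hy⟩
    have hR := bdist_pos hΩ hne hy
    obtain ⟨x, ⟨r, hr, h⟩, hxy⟩ := Metric.mem_closure_iff.1 hyA (bdist Ω y / 4) (by linarith)
    refine ⟨min r (bdist Ω y / 4), lt_min hr (by linarith), ?_⟩
    refine (h.mono (Metric.ball_subset_ball (min_le_left r (bdist Ω y / 4)))).trans ?_
    exact controlled_ball_translate hΩ (R := bdist Ω y / 4) (by linarith) (by linarith)
      (min_le_right _ _) (by rw [dist_comm]; exact hxy.le)

/-- The set is compact and contained in Ω, so finitely many controlled balls cover it. -/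
lemma controlled_interior (hΩ : IsOpen Ω) (hconn : IsPreconnected Ω) (hne : Ωᶜ.Nonempty)
    (hb : Bornology.IsBounded Ω) {x₀ : E d} (hx₀ : x₀ ∈ Ω) {r₀ : ℝ} (hr₀ : 0 < r₀) {c : ℝ}
    (hc : 0 < c) : Controlled Ω (Metric.ball x₀ r₀) {y | c ≤ bdist Ω y} := by
  have hsub : {y | c ≤ bdist Ω y} ⊆ Ω := fun y hy => mem_of_bdist_pos (hc.trans_le hy)
  have hcpt : IsCompact {y | c ≤ bdist Ω y} := Metric.isCompact_of_isClosed_isBounded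
    (isClosed_le continuous_const (Metric.continuous_infDist_pt _)) (hb.subset hsub)
  refine hcpt.induction_on (p := Controlled Ω (Metric.ball x₀ r₀)) (controlled_empty _)
    (fun s t hst h => h.mono hst) (fun s t h h' => h.union h') fun x hx => ?_
  obtain ⟨r, hr, h⟩ := exists_controlled_ball hΩ hconn hne hx₀ hr₀ (hsub hx)
  exact ⟨_, mem_nhdsWithin_of_mem_nhds (Metric.ball_mem_nhds x hr), h⟩

/-- The Poincaré inequality on a small ball. -/
lemma exists_ball_poincare (hΩ : IsOpen Ω) {x₀ : E d} {r : ℝ} (hr : 0 < r)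
    (h4 : 4 * r ≤ bdist Ω x₀) : ∃ C : ℝ≥0∞, C ≠ ⊤ ∧ ∀ f : E d → ℝ, ContDiffOn ℝ 1 f Ω →
      ∃ c : ℝ, ∫⁻ x in Metric.ball x₀ r, ENNReal.ofReal ((f x - c) ^ 2) ≤ C * wEnergy Ω f := by
  set B := Metric.ball x₀ r with hB
  set W := Metric.ball (0 : E d) (2 * r) with hW
  have hv0 : volume B ≠ 0 := (Metric.measure_ball_pos volume x₀ hr).ne'
  have hv1 : volume B ≠ ⊤ := measure_ball_lt_top.ne
  refine ⟨(4 * volume W) / volume B, ENNReal.div_ne_top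
    (ENNReal.mul_ne_top (by simp) measure_ball_lt_top.ne) hv0, fun f hf => ?_⟩
  have hBΩ : ∀ y ∈ B, y ∈ Ω := fun y hy => mem_of_bdist_pos (by
    have := bdist_sub_le (Ω := Ω) x₀ y
    rw [dist_comm] at this
    linarith [Metric.mem_ball.1 hy])
  have hFm : Measurable (Ω.indicator f) := by
    classical
    rw [← piecewise_eq_indicator]
    exact hf.continuousOn.measurable_piecewise continuousOn_const hΩ.measurableSet
  set F := Ω.indicator f with hF
  have hG : Measurable fun p : E d × E d => ENNReal.ofReal ((F p.1 - F p.2) ^ 2) := by fun_prop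
  -- The double integral of (F z - F y)² over B × B, written with w = z - y, becomes a family of
  -- translation estimates, one for each w in the ball of radius 2r.
  have h1 : ∀ y ∈ B, ∫⁻ z in B, ENNReal.ofReal ((F z - F y) ^ 2)
      ≤ ∫⁻ w in W, ENNReal.ofReal ((F (y + w) - F y) ^ 2) := by
    intro y hy
    rw [← lintegral_indicator measurableSet_ball, ← lintegral_indicator measurableSet_ball,
      ← lintegral_add_left_eq_self _ y]
    refine lintegral_mono fun w => ?_
    by_cases hw : y + w ∈ B
    · rw [indicator_of_mem hw, indicator_of_mem]
      rw [mem_ball_zero_iff, show w = (y + w - x₀) - (y - x₀) by abel]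
      refine (norm_sub_le _ _).trans_lt ?_
      rw [← dist_eq_norm, ← dist_eq_norm]
      linarith [Metric.mem_ball.1 hw, Metric.mem_ball.1 hy]
    · rw [indicator_of_notMem hw]
      exact zero_le
  have h2 : ∀ w ∈ W, ∫⁻ y in B, ENNReal.ofReal ((F (y + w) - F y) ^ 2) ≤ 4 * wEnergy Ω f := by
    intro w hw
    have hw' : ‖w‖ < 2 * r := mem_ball_zero_iff.1 hw
    have h3 : ∀ y ∈ B, ∀ t ∈ Icc (0 : ℝ) 1, r ≤ bdist Ω (y + t • w) := by
      intro y hy t ht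
      have h2 : dist x₀ (y + t • w) ≤ 3 * r := by
        rw [dist_comm, dist_eq_norm, show y + t • w - x₀ = (y - x₀) + t • w by abel]
        refine (norm_add_le _ _).trans ?_
        rw [norm_smul, Real.norm_of_nonneg ht.1, ← dist_eq_norm]
        have := mul_le_mul ht.2 hw'.le (norm_nonneg _) zero_le_one
        linarith [Metric.mem_ball.1 hy]
      linarith [bdist_sub_le (Ω := Ω) x₀ (y + t • w)]
    calc ∫⁻ y in B, ENNReal.ofReal ((F (y + w) - F y) ^ 2)
        = ∫⁻ y in B, ENNReal.ofReal ((f (y + w) - f y) ^ 2) := by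
          refine setLIntegral_congr_fun measurableSet_ball fun y hy => ?_
          have h5 := mem_of_bdist_pos (hr.trans_le (h3 y hy 1 (by simp)))
          rw [one_smul] at h5
          simp only [hF, indicator_of_mem h5, indicator_of_mem (hBΩ y hy)]
      _ ≤ ENNReal.ofReal (‖w‖ ^ 2 / r ^ 2) * wEnergy Ω f :=
          lintegral_translate_sub_le hΩ hf measurableSet_ball hr h3
      _ ≤ 4 * wEnergy Ω f := by
          gcongr
          rw [show (4 : ℝ≥0∞) = ENNReal.ofReal 4 by simp]
          refine ENNReal.ofReal_le_ofReal ?_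
          rw [div_le_iff₀ (by positivity)]
          nlinarith [norm_nonneg w]
  have h3 : ∫⁻ y in B, ∫⁻ z in B, ENNReal.ofReal ((F z - F y) ^ 2)
      ≤ 4 * wEnergy Ω f * volume W := by
    refine (setLIntegral_mono' measurableSet_ball h1).trans ?_
    rw [lintegral_lintegral_swap]
    · rw [← setLIntegral_const]
      exact setLIntegral_mono' measurableSet_ball h2
    · exact (hG.comp ((measurable_fst.add measurable_snd).prodMk measurable_fst)).aemeasurable
  have hm : AEMeasurable (fun y => ∫⁻ z in B, ENNReal.ofReal ((F z - F y) ^ 2))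
      (volume.restrict B) :=
    (Measurable.lintegral_prod_right' (f := fun p : E d × E d =>
      ENNReal.ofReal ((F p.2 - F p.1) ^ 2)) (by fun_prop)).aemeasurable
  -- Instead of the mean of f, the constant is the value at a point where the inner integral does
  -- not exceed its average.
  obtain ⟨y, hy, hle⟩ := exists_le_setLAverage hv0 hv1 hm
  refine ⟨F y, ?_⟩
  calc ∫⁻ x in B, ENNReal.ofReal ((f x - F y) ^ 2)
      = ∫⁻ x in B, ENNReal.ofReal ((F x - F y) ^ 2) := by
        refine setLIntegral_congr_fun measurableSet_ball fun x hx => ?_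
        simp only [hF, indicator_of_mem (hBΩ x hx)]
    _ ≤ (4 * wEnergy Ω f * volume W) / volume B := by
        refine hle.trans ?_
        rw [setLAverage_eq]
        gcongr
    _ = _ := by
        rw [ENNReal.div_eq_inv_mul, ENNReal.div_eq_inv_mul]
        ring

/-- The axis of a cone may be tilted slightly if the cone is narrowed, so by compactness of the unit
sphere finitely many axes suffice. -/
lemma ConeCondition.exists_cover (h : ConeCondition Ω) (hne : Ωᶜ.Nonempty) :
    ∃ c > 0, ∃ T > 0, ∃ D : Finset (E d), (∀ e ∈ D, ‖e‖ = 1) ∧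
      Ω ⊆ ⋃ e ∈ D, coneSet Ω e c T := by
  obtain ⟨h, κ, hh, hκ, hκ1, hcone⟩ := h
  -- c is both the mesh of the net of axes and the new aperture. For |e - e'| < c and z within ct of
  -- x + te', e · (z - x) ≥ t(1 - 2c) ≥ κt(1 + c) ≥ κ|z - x|. The height h/6 gives t ≤ h/2, hence |z
  -- - x| < h.
  set c := (1 - κ) / 4 with hc
  have hc0 : 0 < c := by rw [hc]; linarith
  obtain ⟨D, hDs, hDf, hD⟩ := (isCompact_sphere (0 : E d) 1).finite_cover_balls hc0
  refine ⟨c, hc0, h / 6, by linarith, hDf.toFinset,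
    fun e he => by simpa using hDs (hDf.mem_toFinset.1 he), fun x hx => ?_⟩
  obtain ⟨e, he, hin⟩ := hcone x hx
  obtain ⟨e', he'D, he'⟩ := mem_iUnion₂.1 (hD (by simpa using he))
  have hn : ‖e'‖ = 1 := by simpa using hDs he'D
  refine mem_iUnion₂.2 ⟨e', hDf.mem_toFinset.2 he'D, hx, fun t ht => ?_⟩
  rw [Metric.le_infDist hne]
  intro z hz
  by_contra hlt
  push Not at hlt
  refine hz ?_
  have hzx : z = x + (z - x) := by abel
  set r := z - (x + t • e') with hr
  have hzr : z - x = t • e' + r := by rw [hr]; abel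
  have hrn : ‖r‖ < c * t := by rwa [hr, ← dist_eq_norm, dist_comm]
  have htn : ‖t • e'‖ = t := by rw [norm_smul, hn, mul_one, Real.norm_of_nonneg ht.1.le]
  have hzn : ‖z - x‖ ≤ t * (1 + c) := by
    rw [hzr]
    refine (norm_add_le _ _).trans ?_
    rw [htn]; linarith
  have ht2 : t ≤ h / 2 := by linarith [ht.2]
  rw [hzx]
  refine hin _ (hzn.trans_lt ?_) ?_
  · nlinarith [ht.1]
  · have h1 : inner ℝ e e' ≥ 1 - c := by
      have h2 : inner ℝ e (e - e') ≤ ‖e‖ * ‖e - e'‖ := real_inner_le_norm _ _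
      rw [inner_sub_right, real_inner_self_eq_norm_sq, he, ← dist_eq_norm] at h2
      linarith [Metric.mem_ball.1 he']
    have h2 : -‖r‖ ≤ inner ℝ e r := by
      have := abs_real_inner_le_norm e r
      rw [he, one_mul] at this
      exact (abs_le.1 this).1
    rw [hzr, inner_add_right, real_inner_smul_right, ← hzr]
    have h3 : κ * ‖z - x‖ ≤ κ * (t * (1 + c)) := by gcongr
    have h4 : t * (1 - c) ≤ t * inner ℝ e e' := by have := ht.1.le; gcongr
    have h5 : κ * (t * (1 + c)) ≤ t * (1 - 2 * c) := by
      have h6 : κ * (1 + c) ≤ 1 - 2 * c := by rw [hc]; nlinarith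
      nlinarith [ht.1]
    nlinarith

/-- The improved Poincaré inequality: on a bounded connected open set with the cone condition, the
gradient may be weighted with the distance to the boundary. -/
theorem improved_poincare (hd : 0 < d) (hΩ : IsOpen Ω) (hconn : IsConnected Ω)
    (hb : Bornology.IsBounded Ω) (hcone : ConeCondition Ω) :
    ∃ C : ℝ≥0∞, C ≠ ⊤ ∧ ∀ f : E d → ℝ, ContDiffOn ℝ 1 f Ω →
      ∃ c : ℝ, ∫⁻ x in Ω, ENNReal.ofReal ((f x - c) ^ 2) ≤ C * wEnergy Ω f := by
  have hne := compl_nonempty_of_isBounded hd hb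
  obtain ⟨x₀, hx₀⟩ := hconn.nonempty
  have hpos := bdist_pos hΩ hne hx₀
  obtain ⟨C₀, hC₀, hball⟩ := exists_ball_poincare hΩ (x₀ := x₀) (r := bdist Ω x₀ / 4)
    (by linarith) (by linarith)
  obtain ⟨c, hc, T, hT, D, hD1, hD⟩ := hcone.exists_cover hne
  have hin := controlled_interior hΩ hconn.isPreconnected hne hb hx₀
    (r₀ := bdist Ω x₀ / 4) (by linarith) (mul_pos hc hT)
  -- Hardy reduces each cone set to the interior region, which is controlled by the central ball.
  have hcs : ∀ e ∈ D, Controlled Ω (Metric.ball x₀ (bdist Ω x₀ / 4)) (coneSet Ω e c T) := by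
    intro e he
    refine hin.trans ⟨ENNReal.ofReal (12 / c ^ 2) + 6, by simp, fun f hf => ?_⟩
    refine (hardy_coneSet hΩ hf (hD1 e he) hc hT).trans ?_
    rw [mul_add, add_mul, add_mul]
    exact add_le_add (self_le_add_right _ _) (self_le_add_left _ _)
  have hu : Controlled Ω (Metric.ball x₀ (bdist Ω x₀ / 4)) (⋃ e ∈ D, coneSet Ω e c T) := by
    clear hD hD1
    classical
    induction D using Finset.induction_on with
    | empty => simpa using controlled_empty _
    | insert e D _ ih =>
      rw [Finset.set_biUnion_insert]
      exact (hcs e (by simp)).union (ih fun e he => hcs e (by simp [he]))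
  obtain ⟨C, hC, hctrl⟩ := hu.mono hD
  refine ⟨C * (1 + C₀), ENNReal.mul_ne_top hC (by simp [hC₀]), fun f hf => ?_⟩
  -- The control is applied to f - a, which has the same energy as f and is small on the ball by the
  -- Poincaré inequality there.
  obtain ⟨a, ha⟩ := hball f hf
  refine ⟨a, (hctrl (fun x => f x - a) (hf.sub contDiffOn_const)).trans ?_⟩
  have hw : wEnergy Ω (fun x => f x - a) = wEnergy Ω f := by
    simp only [wEnergy, wDens, fderiv_sub_const]
  rw [hw, mul_assoc, add_mul, one_mul]
  gcongr

end ImprovedPoincare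

/-! ### Radial kernels and scale-invariant means -/

section Kernel

variable {d : ℕ} {Ω : Set (E d)}

/-- A smooth kernel on the unit ball for which `η y • y` is curl free, as is the case for radial
kernels. -/
structure IsRadialKernel (η : E d → ℝ) : Prop where
  test : IsTest (Metric.closedBall 0 1) η
  mass : ∫ y, η y = 1
  curl : ∀ (i j : Fin d) (y : E d), pd j (fun z => η z * z i) y = pd i (fun z => η z * z j) y

/-- For a normalised function of |y|², ∂ⱼ(η yᵢ) consists of η on the diagonal and a multiple of
yᵢyⱼ, which is symmetric in i and j. -/
lemma exists_isRadialKernel (d : ℕ) : ∃ η : E d → ℝ, IsRadialKernel η := by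
  set χ : E d → ℝ := fun y => Real.smoothTransition (1 - ‖y‖ ^ 2) with hχ
  have hsm : ContDiff ℝ ∞ χ :=
    Real.smoothTransition.contDiff.comp (contDiff_const.sub (contDiff_norm_sq ℝ))
  have hs : Function.support χ ⊆ Metric.closedBall 0 1 := by
    intro y hy
    rw [mem_closedBall_zero_iff]
    by_contra h
    push Not at h
    exact hy (Real.smoothTransition.zero_of_nonpos (by nlinarith))
  have hc : HasCompactSupport χ :=
    HasCompactSupport.of_support_subset_isCompact (isCompact_closedBall 0 1) hs
  have ht : IsTest (Metric.closedBall 0 1) χ :=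
    ⟨hsm, hc, closure_minimal hs Metric.isClosed_closedBall⟩
  have hI : 0 < ∫ y, χ y := by
    refine hsm.continuous.integral_pos_of_hasCompactSupport_nonneg_nonzero hc
      (fun y => Real.smoothTransition.nonneg _) (x := 0) ?_
    simp [hχ]
  refine ⟨fun y => (∫ z, χ z)⁻¹ • χ y, ht.const_smul _, ?_, fun i j y => ?_⟩
  · rw [integral_smul, smul_eq_mul, inv_mul_cancel₀ hI.ne']
  · obtain ⟨c, hder⟩ : ∃ c : ℝ, HasDerivAt Real.smoothTransition c (1 - ‖y‖ ^ 2) :=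
      ⟨_, ((Real.smoothTransition.contDiff (n := 1)).differentiable
        (by simp)).differentiableAt.hasDerivAt⟩
    have h1 : HasFDerivAt (fun y : E d => 1 - ‖y‖ ^ 2) (-(2 • innerSL ℝ y)) y :=
      (hasStrictFDerivAt_norm_sq y).hasFDerivAt.const_sub 1
    have h2 := (hder.comp_hasFDerivAt y h1).const_smul (∫ z, χ z)⁻¹
    have key : ∀ i j : Fin d, pd j (fun z => (∫ z, χ z)⁻¹ • χ z * z i) y
        = (∫ z, χ z)⁻¹ * χ y * (EuclideanSpace.single j (1 : ℝ) : E d) i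
          + y i * ((∫ z, χ z)⁻¹ * (c * (-(2 * y j)))) := by
      intro i j
      have h3 : HasFDerivAt (fun z : E d => z i) (EuclideanSpace.proj (𝕜 := ℝ) i) y :=
        (EuclideanSpace.proj (𝕜 := ℝ) i : E d →L[ℝ] ℝ).hasFDerivAt
      have h4 : HasFDerivAt (fun z => (∫ z, χ z)⁻¹ • χ z * z i) _ y := h2.mul h3
      rw [pd, h4.fderiv]
      simp [EuclideanSpace.inner_single_right, hχ]
    rw [key, key, PiLp.single_apply, PiLp.single_apply]
    simp only [eq_comm (a := i)]
    ring

section Rescale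

variable {F : Type*} [NormedAddCommGroup F] [NormedSpace ℝ F] {ψ : E d → F} {s : ℝ} {x : E d}

lemma mem_closedBall_rescale (hs : 0 < s) {y : E d} :
    s • (x - y) ∈ Metric.closedBall (0 : E d) 1 ↔ y ∈ Metric.closedBall x (1 / s) := by
  rw [mem_closedBall_zero_iff, norm_smul, Real.norm_of_nonneg hs.le, Metric.mem_closedBall,
    dist_comm, dist_eq_norm, le_div_iff₀ hs, mul_comm]

lemma IsTest.rescale (h : IsTest (Metric.closedBall 0 1) ψ) (hs : 0 < s)
    (hx : Metric.closedBall x (1 / s) ⊆ Ω) : IsTest Ω fun y => ψ (s • (x - y)) := by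
  have hsup : Function.support (fun y => ψ (s • (x - y))) ⊆ Metric.closedBall x (1 / s) := by
    intro y hy
    rw [← mem_closedBall_rescale hs]
    by_contra h'
    exact hy (h.zero_of_notMem h')
  exact ⟨h.smooth.comp (by fun_prop),
    HasCompactSupport.of_support_subset_isCompact (isCompact_closedBall _ _) hsup,
    (closure_minimal hsup Metric.isClosed_closedBall).trans hx⟩

lemma fderiv_rescale (h : Differentiable ℝ ψ) (y w : E d) :
    _root_.fderiv ℝ (fun y => ψ (s • (x - y))) y w
      = -(s • _root_.fderiv ℝ ψ (s • (x - y)) w) := by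
  have h1 : HasFDerivAt (fun y : E d => s • (x - y)) (s • (-ContinuousLinearMap.id ℝ (E d))) y :=
    ((hasFDerivAt_id y).const_sub x).const_smul s
  have h2 := (h (s • (x - y))).hasFDerivAt.comp y h1
  have h3 : HasFDerivAt (fun y => ψ (s • (x - y))) _ y := h2
  rw [h3.fderiv]
  simp

end Rescale

lemma IsTest.exists_bound {F : Type*} [NormedAddCommGroup F] [NormedSpace ℝ F]
    {S : Set (E d)} {φ : E d → F} (h : IsTest S φ) : ∃ M : ℝ, 0 ≤ M ∧ ∀ y, ‖φ y‖ ≤ M := by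
  obtain ⟨M, hM⟩ := h.compact.exists_bound_of_continuous h.continuous
  exact ⟨M, (norm_nonneg _).trans (hM 0), hM⟩

/-- The vector field `η y • y`. -/
lemma IsRadialKernel.test_field {η : E d → ℝ} (h : IsRadialKernel η) :
    IsTest (Metric.closedBall 0 1) fun y => η y • y :=
  ⟨h.test.smooth.smul contDiff_id, h.test.compact.smul_right,
    (tsupport_smul_subset_left η _).trans h.test.supp⟩

lemma IsRadialKernel.div_field {η : E d → ℝ} (h : IsRadialKernel η) (y : E d) :
    ∑ i, pd i (fun z => η z * z i) y = d * η y + fderiv ℝ η y y := by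
  have h1 : ∀ i, pd i (fun z => η z * z i) y = η y + y i * pd i η y := by
    intro i
    have h3 : HasFDerivAt (fun z : E d => z i) (EuclideanSpace.proj (𝕜 := ℝ) i) y :=
      (EuclideanSpace.proj (𝕜 := ℝ) i : E d →L[ℝ] ℝ).hasFDerivAt
    have h4 : HasFDerivAt (fun z => η z * z i) _ y :=
      (h.test.differentiable y).hasFDerivAt.mul h3
    rw [pd, h4.fderiv]
    simp
  rw [fderiv_eq_sum_pd, Finset.sum_congr rfl fun i _ => h1 i, Finset.sum_add_distrib]
  simp

/-- The functional `v ↦ (g, div v)` is given by the skew part of the gradient of `v`, tested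
with `∇u`. -/
def IsResidual (u : H1 Ω) (g : L2 Ω) : Prop :=
  ∀ φ : E d → E d, IsTest Ω φ → ∫ y in Ω, g y * ∑ i, pd i (fun z => φ z i) y
    = ∑ i, ∑ j, ∫ y in Ω, grad u y (i, j) * (pd j (fun z => φ z i) y - pd i (fun z => φ z j) y)

/-- The mean of `g` around `x` at the scale `1 / s`. -/
def smear (η : E d → ℝ) (g : L2 Ω) (s : ℝ) (x : E d) : ℝ :=
  ∫ y in Ω, g y * (s ^ d * η (s • (x - y)))

variable {η : E d → ℝ} {u : H1 Ω} {g : L2 Ω}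

/-- The residual is tested with the rescaled curl-free field, for which the right-hand side
vanishes. The divergence dη + w · ∇η is the one that appears when s^d η(s(x - y)) is differentiated
in s. -/
lemma IsRadialKernel.integral_div_eq_zero (hη : IsRadialKernel η) (hg : IsResidual u g) {s : ℝ}
    (hs : 0 < s) {x : E d} (hx : Metric.closedBall x (1 / s) ⊆ Ω) :
    ∫ y in Ω, g y * (d * η (s • (x - y)) + fderiv ℝ η (s • (x - y)) (s • (x - y))) = 0 := by
  have h1 := hg _ (hη.test_field.rescale hs hx)
  have hc : ∀ i : Fin d, Differentiable ℝ fun z : E d => η z * z i := fun i =>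
    (hη.test_field.coord i).differentiable
  have h2 : ∀ (i j : Fin d) (y : E d),
      pd j (fun z => (η (s • (x - z)) • (s • (x - z)) : E d) i) y
      = -(s • pd j (fun z => η z * z i) (s • (x - y))) := fun i j y =>
    fderiv_rescale (hc i) y _
  simp only [h2] at h1
  have h3 : ∀ y, ∑ i, -(s • pd i (fun z => η z * z i) (s • (x - y)))
      = -s * (d * η (s • (x - y)) + fderiv ℝ η (s • (x - y)) (s • (x - y))) := by
    intro y
    rw [← hη.div_field, Finset.mul_sum]
    simp
  have h5 : ∀ i j, ∫ y in Ω, grad u y (i, j) * (-(s • pd j (fun z => η z * z i) (s • (x - y)))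
      - -(s • pd i (fun z => η z * z j) (s • (x - y)))) = 0 := by
    intro i j
    simp [hη.curl i j]
  simp only [h3, h5, Finset.sum_const_zero] at h1
  have h4 : ∀ y, g y * (-s * (d * η (s • (x - y)) + fderiv ℝ η (s • (x - y)) (s • (x - y))))
      = -s * (g y * (d * η (s • (x - y)) + fderiv ℝ η (s • (x - y)) (s • (x - y)))) :=
    fun y => by ring
  simp only [h4, integral_const_mul] at h1
  exact (mul_eq_zero.1 h1).resolve_left (neg_ne_zero.2 hs.ne')

lemma integrable_of_isBounded (hb : Bornology.IsBounded Ω) (g : L2 Ω) : IntegrableOn g Ω := by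
  have : IsFiniteMeasure (volume.restrict Ω) := ⟨by
    rw [Measure.restrict_apply_univ]; exact hb.measure_lt_top⟩
  exact (Lp.memLp g).integrable (by norm_num)

/-- With w = s(x - y), ∂ₛ(s^d η(w)) = (s^d / s)(dη + w · ∇η)(w), and g integrates this to zero. Near
s, for scales in (s/2, 2s), the derivative is bounded by a fixed multiple of |g|, which permits
differentiation under the integral. -/
lemma hasDerivAt_smear (hη : IsRadialKernel η) (hg : IsResidual u g)
    (hb : Bornology.IsBounded Ω) {s : ℝ} (hs : 0 < s) {x : E d}
    (hx : Metric.closedBall x (1 / s) ⊆ Ω) : HasDerivAt (fun s => smear η g s x) 0 s := by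
  have hgi := integrable_of_isBounded hb g
  have hq : Continuous fun w : E d => d * η w + fderiv ℝ η w w := by
    refine (continuous_const.mul hη.test.continuous).add ?_
    exact hη.test.fderiv.continuous.clm_apply continuous_id
  have hqc : HasCompactSupport fun w : E d => d * η w + fderiv ℝ η w w := by
    refine HasCompactSupport.of_support_subset_isCompact (isCompact_closedBall 0 1) fun w hw => ?_
    by_contra h
    refine hw ?_
    simp [hη.test.zero_of_notMem h, hη.test.fderiv.zero_of_notMem h]
  obtain ⟨M, hM⟩ := hqc.exists_bound_of_continuous hq
  have hM0 : 0 ≤ M := (norm_nonneg _).trans (hM 0)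
  have hmeas : ∀ t : ℝ, AEStronglyMeasurable (fun y => g y * (t ^ d * η (t • (x - y))))
      (volume.restrict Ω) := fun t => by
    refine hgi.aestronglyMeasurable.mul (Continuous.aestronglyMeasurable ?_)
    exact continuous_const.mul (hη.test.continuous.comp (by fun_prop))
  obtain ⟨M', hM'0, hM'⟩ := hη.test.exists_bound
  have key := hasDerivAt_integral_of_dominated_loc_of_deriv_le (μ := volume.restrict Ω)
    (F := fun t y => g y * (t ^ d * η (t • (x - y))))
    (F' := fun t y => g y * (t ^ d / t
      * (d * η (t • (x - y)) + fderiv ℝ η (t • (x - y)) (t • (x - y)))))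
    (s := Ioo (s / 2) (2 * s)) (x₀ := s)
    (bound := fun y => ‖g y‖ * ((2 * s) ^ d / (s / 2) * M))
    (Ioo_mem_nhds (by linarith) (by linarith)) (Filter.Eventually.of_forall hmeas)
    (hgi.mul_bdd (c := s ^ d * M') (Continuous.aestronglyMeasurable
      (continuous_const.mul (hη.test.continuous.comp (by fun_prop)))) (ae_of_all _ fun y => by
        rw [norm_mul, Real.norm_of_nonneg (by positivity)]
        gcongr
        exact hM' _))
    (by
      refine hgi.aestronglyMeasurable.mul (Continuous.aestronglyMeasurable ?_)
      exact continuous_const.mul (hq.comp (by fun_prop)))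
    (ae_of_all _ fun y t ht => by
      have ht0 : 0 < t := by linarith [ht.1]
      rw [norm_mul, norm_mul, Real.norm_of_nonneg (by positivity : 0 ≤ t ^ d / t)]
      have := hM (t • (x - y))
      gcongr
      · exact ht.2.le
      · exact ht.1.le)
    (hgi.norm.mul_const _)
    (ae_of_all _ fun y t ht => by
      have ht0 : 0 < t := by linarith [ht.1]
      have e1 : HasDerivAt (fun t : ℝ => t • (x - y)) (x - y) t := by
        simpa using (hasDerivAt_id t).smul_const (x - y)
      have e2 : HasDerivAt (fun t : ℝ => η (t • (x - y))) (fderiv ℝ η (t • (x - y)) (x - y)) t :=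
        (hη.test.differentiable _).hasFDerivAt.comp_hasDerivAt t e1
      have e3 := ((hasDerivAt_pow d t).fun_mul e2).const_mul (g y)
      refine e3.congr_deriv ?_
      rw [map_smul, smul_eq_mul]
      rcases Nat.eq_zero_or_pos d with rfl | hd
      · simp [ht0.ne']
      · obtain ⟨n, rfl⟩ := Nat.exists_eq_succ_of_ne_zero hd.ne'
        simp only [Nat.succ_eq_add_one, Nat.add_sub_cancel, pow_succ]
        field_simp)
  refine key.2.congr_deriv ?_
  have h4 : ∀ y, g y * (s ^ d / s
      * (d * η (s • (x - y)) + fderiv ℝ η (s • (x - y)) (s • (x - y))))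
      = s ^ d / s * (g y * (d * η (s • (x - y)) + fderiv ℝ η (s • (x - y)) (s • (x - y)))) :=
    fun y => by ring
  simp only [h4, integral_const_mul, hη.integral_div_eq_zero hg hs hx, mul_zero]

lemma closedBall_subset_of_lt_bdist {x : E d} {r : ℝ} (h : r < bdist Ω x) :
    Metric.closedBall x r ⊆ Ω := by
  intro y hy
  refine mem_of_bdist_pos ?_
  have h1 := bdist_sub_le (Ω := Ω) x y
  rw [Metric.mem_closedBall, dist_comm] at hy
  linarith

/-- The means of `g` around `x` do not depend on the scale. -/
lemma smear_eq_smear (hη : IsRadialKernel η) (hg : IsResidual u g) (hb : Bornology.IsBounded Ω)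
    {x : E d} {s t : ℝ} (hs : 0 < s) (hs' : 1 / s < bdist Ω x) (ht : 0 < t)
    (ht' : 1 / t < bdist Ω x) : smear η g s x = smear η g t x := by
  have hpos : 0 < bdist Ω x := lt_trans (by positivity) hs'
  have hm : ∀ {r : ℝ}, r ∈ Ioi (1 / bdist Ω x) → 0 < r ∧ 1 / r < bdist Ω x := by
    intro r hr
    have h0 : 0 < 1 / bdist Ω x := by positivity
    exact ⟨h0.trans hr, by rw [one_div_lt (h0.trans hr) hpos]; exact hr⟩
  refine (convex_Ioi (1 / bdist Ω x)).is_const_of_fderivWithin_eq_zero (𝕜 := ℝ)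
    (f := fun s => smear η g s x) (fun r hr => ?_) (fun r hr => ?_) ?_ ?_
  · exact (hasDerivAt_smear hη hg hb (hm hr).1
      (closedBall_subset_of_lt_bdist (hm hr).2)).differentiableAt.differentiableWithinAt
  · rw [fderivWithin_of_isOpen isOpen_Ioi hr]
    have := (hasDerivAt_smear hη hg hb (hm hr).1
      (closedBall_subset_of_lt_bdist (hm hr).2)).hasFDerivAt.fderiv
    rw [this]
    ext
    simp
  · rwa [mem_Ioi, one_div_lt hpos hs]
  · rwa [mem_Ioi, one_div_lt hpos ht]

/-- The smooth representative of `g`. -/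
def smoothRep (η : E d → ℝ) (g : L2 Ω) (x : E d) : ℝ := smear η g (4 / bdist Ω x) x

lemma smoothRep_eq (hη : IsRadialKernel η) (hg : IsResidual u g) (hb : Bornology.IsBounded Ω)
    {x : E d} {s : ℝ} (hs : 0 < s) (hs' : 1 / s < bdist Ω x) :
    smoothRep η g x = smear η g s x := by
  have hpos : 0 < bdist Ω x := lt_trans (by positivity) hs'
  refine smear_eq_smear hη hg hb (by positivity) ?_ hs hs'
  rw [one_div_div]
  linarith

end Kernel

/-! ### The smooth representative of a residual and its weighted energy -/

section SmoothRep

variable {d : ℕ} {Ω : Set (E d)} {η : E d → ℝ} {u : H1 Ω} {g : L2 Ω}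

lemma integrable_indicator_L2 (hΩ : IsOpen Ω) (hb : Bornology.IsBounded Ω) (g : L2 Ω) :
    Integrable (Ω.indicator g) :=
  (integrable_indicator_iff hΩ.measurableSet).2 (integrable_of_isBounded hb g)

lemma smear_eq_integral (hΩ : IsOpen Ω) (s : ℝ) (x : E d) : smear η g s x
    = ∫ y, Ω.indicator g y * (s ^ d * η (s • (x - y))) := by
  rw [smear, ← integral_indicator hΩ.measurableSet]
  congr 1
  ext y
  by_cases hy : y ∈ Ω <;> simp [hy]

lemma smear_eq_convolution (hΩ : IsOpen Ω) (s : ℝ) : smear η g s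
    = convolution (Ω.indicator g) (fun z => s ^ d * η (s • z)) (ContinuousLinearMap.mul ℝ ℝ)
      volume := by
  ext x
  rw [smear_eq_integral hΩ]
  rfl

lemma IsTest.kernel {S : Set (E d)} (hη : IsTest S η) {s : ℝ} (hs : 0 < s) :
    ContDiff ℝ ∞ (fun z => s ^ d * η (s • z)) ∧
      HasCompactSupport (fun z => s ^ d * η (s • z)) :=
  ⟨contDiff_const.mul (hη.smooth.comp (contDiff_const_smul s)),
    (hη.compact.comp_smul hs.ne').mul_left⟩

lemma contDiff_smear (hη : IsRadialKernel η) (hΩ : IsOpen Ω) (hb : Bornology.IsBounded Ω) {s : ℝ}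
    (hs : 0 < s) : ContDiff ℝ 1 (smear η g s) := by
  rw [smear_eq_convolution hΩ]
  exact (hη.test.kernel hs).2.contDiff_convolution_right (n := 1) _
    (integrable_indicator_L2 hΩ hb g).locallyIntegrable ((hη.test.kernel hs).1.of_le (by simp))

lemma fderiv_smear (hη : IsRadialKernel η) (hΩ : IsOpen Ω) (hb : Bornology.IsBounded Ω) {s : ℝ}
    (hs : 0 < s) (x w : E d) : fderiv ℝ (smear η g s) x w
      = s ^ (d + 1) * ∫ y in Ω, g y * fderiv ℝ η (s • (x - y)) w := by
  have hk := hη.test.kernel hs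
  have hk1 : ContDiff ℝ 1 (fun z => s ^ d * η (s • z)) := hk.1.of_le (by simp)
  have hl := (integrable_indicator_L2 hΩ hb g).locallyIntegrable
  have h1 := hk.2.hasFDerivAt_convolution_right (ContinuousLinearMap.mul ℝ ℝ) hl hk1 x
  have h2 : ∀ z, fderiv ℝ (fun z => s ^ d * η (s • z)) z w
      = s ^ (d + 1) * fderiv ℝ η (s • z) w := by
    intro z
    have e1 : HasFDerivAt (fun z : E d => s • z) (s • ContinuousLinearMap.id ℝ (E d)) z :=
      (hasFDerivAt_id z).const_smul s
    have e2 : HasFDerivAt (fun z => s ^ d * η (s • z)) _ z :=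
      ((hη.test.differentiable (s • z)).hasFDerivAt.comp z e1).const_mul (s ^ d)
    rw [e2.fderiv]
    simp
    ring
  rw [smear_eq_convolution hΩ, h1.fderiv, convolution_precompR_apply _ hl (hk.2.fderiv ℝ)
    (hk1.continuous_fderiv (by simp)), convolution_def, ← integral_const_mul,
    ← integral_indicator hΩ.measurableSet]
  congr 1
  ext y
  by_cases hy : y ∈ Ω
  · simp only [h2, indicator_of_mem hy, ContinuousLinearMap.mul_apply']
    ring
  · simp [hy]

lemma bdist_eventually {x : E d} {r : ℝ} (h : r < bdist Ω x) :
    ∀ᶠ y in nhds x, r < bdist Ω y :=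
  (Metric.continuous_infDist_pt _).continuousAt.eventually (lt_mem_nhds h)

/-- Near x the scale may be frozen, because the means do not depend on it. The function is then
locally a convolution with a fixed kernel, and its derivative does not see the variable radius. -/
lemma smoothRep_eventuallyEq (hη : IsRadialKernel η) (hg : IsResidual u g)
    (hb : Bornology.IsBounded Ω) {x : E d} (hx : 0 < bdist Ω x) :
    smoothRep η g =ᶠ[nhds x] smear η g (4 / bdist Ω x) := by
  filter_upwards [bdist_eventually (show bdist Ω x / 4 < bdist Ω x by linarith)] with y hy
  exact smoothRep_eq hη hg hb (by positivity) (by rwa [one_div_div])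

lemma contDiffOn_smoothRep (hη : IsRadialKernel η) (hg : IsResidual u g) (hΩ : IsOpen Ω)
    (hb : Bornology.IsBounded Ω) (hne : Ωᶜ.Nonempty) : ContDiffOn ℝ 1 (smoothRep η g) Ω := by
  intro x hx
  have hpos := bdist_pos hΩ hne hx
  exact ((contDiff_smear hη hΩ hb (by positivity)).contDiffAt.congr_of_eventuallyEq
    (smoothRep_eventuallyEq hη hg hb hpos)).contDiffWithinAt

/-- The pointwise norm of the gradient, extended by zero. -/
def gradENorm (u : H1 Ω) : E d → ℝ≥0∞ := Ω.indicator fun y => ‖grad u y‖ₑ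

lemma measurable_gradENorm (hΩ : IsOpen Ω) (u : H1 Ω) : Measurable (gradENorm u) :=
  (Lp.stronglyMeasurable (grad u)).measurable.enorm.indicator hΩ.measurableSet

/-- The residual is tested with the kernel times a constant vector w. The left-hand side becomes the
derivative of the mean in the direction w, while the right-hand side contains ∇u and first
derivatives of the kernel only. Each of the d² skew entries is at most 2M‖w‖. -/
lemma enorm_fderiv_smear_le (hη : IsRadialKernel η) (hg : IsResidual u g) (hΩ : IsOpen Ω)
    (hb : Bornology.IsBounded Ω) {M : ℝ} (hM0 : 0 ≤ M) (hM : ∀ y, ‖fderiv ℝ η y‖ ≤ M) {s : ℝ}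
    (hs : 0 < s) {x : E d} (hx : Metric.closedBall x (1 / s) ⊆ Ω) :
    ‖fderiv ℝ (smear η g s) x‖ₑ ≤ ENNReal.ofReal (s ^ (d + 1) * (d * (d * (2 * M))))
      * ∫⁻ y in Metric.closedBall x (1 / s), gradENorm u y := by
  refine ContinuousLinearMap.opENorm_le_bound _ fun w => ?_
  have h1 := hg _ ((hη.test.smul_const w).rescale hs hx)
  have hdiff : ∀ i, Differentiable ℝ fun z : E d => η z * w i := fun i =>
    hη.test.differentiable.mul_const _
  have hpd : ∀ (i j : Fin d) (y : E d), pd j (fun z => (η (s • (x - z)) • w : E d) i) y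
      = -(s * (pd j η (s • (x - y)) * w i)) := by
    intro i j y
    refine (fderiv_rescale (hdiff i) y _).trans ?_
    have h3 : HasFDerivAt (fun z => η z * w i) _ (s • (x - y)) :=
      (hη.test.differentiable (s • (x - y))).hasFDerivAt.mul_const (w i)
    rw [h3.fderiv]
    simp [mul_comm]
  have hdiv : ∀ y, ∑ i, -(s * (pd i η (s • (x - y)) * w i))
      = -s * fderiv ℝ η (s • (x - y)) w := by
    intro y
    rw [fderiv_eq_sum_pd, Finset.mul_sum]
    exact Finset.sum_congr rfl fun i _ => by ring
  simp only [hpd, hdiv] at h1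
  set D : Fin d → Fin d → E d → ℝ := fun i j y =>
    pd j η (s • (x - y)) * w i - pd i η (s • (x - y)) * w j with hD
  have h2 : ∫ y in Ω, g y * fderiv ℝ η (s • (x - y)) w
      = ∑ i, ∑ j, ∫ y in Ω, grad u y (i, j) * D i j y := by
    have e1 : ∀ y, g y * (-s * fderiv ℝ η (s • (x - y)) w)
        = -s * (g y * fderiv ℝ η (s • (x - y)) w) := fun y => by ring
    have e2 : ∀ i j y, grad u y (i, j) * (-(s * (pd j η (s • (x - y)) * w i))
        - -(s * (pd i η (s • (x - y)) * w j))) = -s * (grad u y (i, j) * D i j y) :=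
      fun i j y => by simp only [hD]; ring
    simp only [e1, e2, integral_const_mul, ← Finset.mul_sum] at h1
    exact mul_left_cancel₀ (neg_ne_zero.2 hs.ne') h1
  have hpdb : ∀ (i : Fin d) (y : E d), |pd i η y| ≤ M := fun i y => by
    have := (fderiv ℝ η y).le_opNorm (EuclideanSpace.single i 1)
    rw [PiLp.norm_single, norm_one, mul_one] at this
    exact this.trans (hM y)
  have hwb : ∀ i, |w i| ≤ ‖w‖ := fun i => PiLp.norm_apply_le w i
  have hDb : ∀ i j y, |D i j y| ≤ 2 * M * ‖w‖ := by
    intro i j y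
    refine (abs_sub _ _).trans ?_
    rw [abs_mul, abs_mul]
    have a1 := mul_le_mul (hpdb j (s • (x - y))) (hwb i) (abs_nonneg _) hM0
    have a2 := mul_le_mul (hpdb i (s • (x - y))) (hwb j) (abs_nonneg _) hM0
    linarith
  have hterm : ∀ i j, ‖∫ y in Ω, grad u y (i, j) * D i j y‖ₑ
      ≤ ENNReal.ofReal (2 * M * ‖w‖) * ∫⁻ y in Metric.closedBall x (1 / s), gradENorm u y := by
    intro i j
    refine (enorm_integral_le_lintegral_enorm _).trans ?_
    rw [← lintegral_const_mul' _ _ ENNReal.ofReal_ne_top,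
      ← lintegral_indicator hΩ.measurableSet, ← lintegral_indicator measurableSet_closedBall]
    refine lintegral_mono fun y => ?_
    by_cases hy : y ∈ Ω
    swap
    · rw [indicator_of_notMem hy]; exact zero_le
    rw [indicator_of_mem hy]
    by_cases hyb : y ∈ Metric.closedBall x (1 / s)
    · rw [indicator_of_mem hyb, gradENorm, indicator_of_mem hy, enorm_mul, mul_comm]
      gcongr
      · rw [Real.enorm_eq_ofReal_abs]
        exact ENNReal.ofReal_le_ofReal (hDb i j y)
      · rw [← ofReal_norm, ← ofReal_norm]
        exact ENNReal.ofReal_le_ofReal (PiLp.norm_apply_le (grad u y) (i, j))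
    · rw [← mem_closedBall_rescale hs] at hyb
      have : D i j y = 0 := by
        simp [hD, pd, hη.test.fderiv.zero_of_notMem hyb]
      simp [this]
  rw [fderiv_smear hη hΩ hb hs, h2, enorm_mul, Real.enorm_eq_ofReal (by positivity)]
  have hsum : ‖∑ i, ∑ j, ∫ y in Ω, grad u y (i, j) * D i j y‖ₑ
      ≤ d * (d * (ENNReal.ofReal (2 * M * ‖w‖)
        * ∫⁻ y in Metric.closedBall x (1 / s), gradENorm u y)) := by
    refine (enorm_sum_le _ _).trans ?_
    refine (Finset.sum_le_card_nsmul _ _ (d * (ENNReal.ofReal (2 * M * ‖w‖)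
        * ∫⁻ y in Metric.closedBall x (1 / s), gradENorm u y)) fun i _ => ?_).trans_eq (by simp)
    refine (enorm_sum_le _ _).trans ?_
    exact (Finset.sum_le_card_nsmul _ _ _ fun j _ => hterm i j).trans_eq (by simp)
  refine (mul_le_mul_right hsum _).trans_eq ?_
  rw [ENNReal.ofReal_mul (by positivity : 0 ≤ 2 * M), ENNReal.ofReal_mul (pow_nonneg hs.le _),
    ENNReal.ofReal_mul (by positivity : (0 : ℝ) ≤ d),
    ENNReal.ofReal_mul (by positivity : (0 : ℝ) ≤ d), ENNReal.ofReal_natCast, ofReal_norm]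
  ring

lemma sq_lintegral_le {μ : Measure (E d)} {A : E d → ℝ≥0∞} (hA : Measurable A) :
    (∫⁻ y, A y ∂μ) ^ 2 ≤ μ univ * ∫⁻ y, A y ^ 2 ∂μ := by
  have h := ENNReal.lintegral_mul_le_Lp_mul_Lq μ Real.HolderConjugate.two_two
    (f := fun _ => 1) (g := A) aemeasurable_const hA.aemeasurable
  simp only [Pi.mul_apply, one_mul, lintegral_const, ENNReal.rpow_two, one_pow] at h
  calc (∫⁻ y, A y ∂μ) ^ 2 ≤ (μ univ ^ (1 / 2 : ℝ) * (∫⁻ y, A y ^ 2 ∂μ) ^ (1 / 2 : ℝ)) ^ 2 := by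
        gcongr
    _ = _ := by
        rw [mul_pow, ← ENNReal.rpow_natCast, ← ENNReal.rpow_natCast, ← ENNReal.rpow_mul,
          ← ENNReal.rpow_mul]
        norm_num

lemma volume_closedBall_eq (x : E d) {r : ℝ} (hr : 0 < r) :
    volume (Metric.closedBall x r)
      = ENNReal.ofReal (r ^ d) * volume (Metric.closedBall (0 : E d) 1) := by
  have := Measure.addHaar_closedBall_mul_of_pos (volume : Measure (E d)) x hr 1
  rwa [mul_one, finrank_euclideanSpace_fin] at this

/-- The kernel which dominates the square of the weighted gradient. -/
def energyKernel (u : H1 Ω) (x y : E d) : ℝ≥0∞ :=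
  {p : E d × E d | dist p.1 p.2 ≤ bdist Ω p.2 / 3}.indicator
    (fun p => ENNReal.ofReal ((5 / bdist Ω p.2) ^ d) * gradENorm u p.2 ^ 2) (x, y)

lemma measurable_energyKernel (hΩ : IsOpen Ω) (u : H1 Ω) :
    Measurable fun p : E d × E d => energyKernel u p.1 p.2 := by
  have hb : Measurable fun p : E d × E d => bdist Ω p.2 :=
    ((Metric.continuous_infDist_pt _).comp continuous_snd).measurable
  refine Measurable.indicator ?_ ?_
  · exact (ENNReal.measurable_ofReal.comp ((measurable_const.div hb).pow_const d)).mul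
      (((measurable_gradENorm hΩ u).comp measurable_snd).pow_const 2)
  · exact measurableSet_le (by fun_prop) (hb.div_const 3)

/-- Radius and weight of the kernel depend on y alone, so the integral in x is the volume of a ball
and the powers of the distance cancel. -/
lemma lintegral_energyKernel (hΩ : IsOpen Ω) (hne : Ωᶜ.Nonempty) (u : H1 Ω) (y : E d) :
    ∫⁻ x, energyKernel u x y
      = ENNReal.ofReal ((5 / 3) ^ d) * volume (Metric.closedBall (0 : E d) 1)
        * gradENorm u y ^ 2 := by
  by_cases hy : y ∈ Ω
  · have hpos := bdist_pos hΩ hne hy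
    have h1 : ∀ x, energyKernel u x y = (Metric.closedBall y (bdist Ω y / 3)).indicator
        (fun _ => ENNReal.ofReal ((5 / bdist Ω y) ^ d) * gradENorm u y ^ 2) x := fun x => rfl
    simp_rw [h1]
    rw [lintegral_indicator measurableSet_closedBall, setLIntegral_const,
      volume_closedBall_eq y (by positivity),
      show (5 / 3 : ℝ) ^ d = (5 / bdist Ω y) ^ d * (bdist Ω y / 3) ^ d by
        rw [← mul_pow]; congr 1; field_simp, ENNReal.ofReal_mul (by positivity)]
    ring
  · have h0 : gradENorm u y = 0 := indicator_of_notMem hy _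
    have h1 : ∀ x, energyKernel u x y = 0 := fun x => by
      simp [energyKernel, indicator_apply, h0]
    simp [h1, h0]

/-- Cauchy–Schwarz on the ball of radius ρ/4 turns the gradient bound into a mean of |∇u|². With s =
4/ρ the weight cancels the excess powers of s, and the 16 is (ρs)². -/
lemma wDens_smoothRep_le (hη : IsRadialKernel η) (hg : IsResidual u g) (hΩ : IsOpen Ω)
    (hb : Bornology.IsBounded Ω) (hne : Ωᶜ.Nonempty) {M : ℝ} (hM0 : 0 ≤ M)
    (hM : ∀ y, ‖fderiv ℝ η y‖ ≤ M) (x : E d) :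
    wDens Ω (smoothRep η g) x ≤ ENNReal.ofReal (16 * (d * (d * (2 * M))) ^ 2)
      * volume (Metric.closedBall (0 : E d) 1) * ∫⁻ y, energyKernel u x y := by
  by_cases hx : x ∈ Ω
  swap
  · rw [wDens, indicator_of_notMem hx]; exact zero_le
  have hpos := bdist_pos hΩ hne hx
  set ρ := bdist Ω x with hρ
  set s := 4 / ρ with hs
  have hs0 : 0 < s := by positivity
  have hs1 : 1 / s = ρ / 4 := by rw [hs, one_div_div]
  have hball : Metric.closedBall x (1 / s) ⊆ Ω :=
    closedBall_subset_of_lt_bdist (by rw [hs1]; linarith)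
  set C := (d * (d * (2 * M)) : ℝ) with hC
  have hC0 : 0 ≤ C := by positivity
  have h1 := enorm_fderiv_smear_le hη hg hΩ hb hM0 hM hs0 hball
  rw [wDens, indicator_of_mem hx, (smoothRep_eventuallyEq hη hg hb hpos).fderiv_eq]
  have h2 := sq_lintegral_le (μ := volume.restrict (Metric.closedBall x (1 / s)))
    (measurable_gradENorm hΩ u)
  rw [Measure.restrict_apply_univ, volume_closedBall_eq x (by positivity)] at h2
  have h3 : ENNReal.ofReal (s ^ d) * ∫⁻ y in Metric.closedBall x (1 / s), gradENorm u y ^ 2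
      ≤ ∫⁻ y, energyKernel u x y := by
    rw [← lintegral_const_mul' _ _ ENNReal.ofReal_ne_top,
      ← lintegral_indicator measurableSet_closedBall]
    refine lintegral_mono fun y => ?_
    by_cases hy : y ∈ Metric.closedBall x (1 / s)
    swap
    · rw [indicator_of_notMem hy]; exact zero_le
    have hd : dist x y ≤ ρ / 4 := by rw [← hs1, dist_comm]; exact hy
    -- From |x - y| ≤ ρ/4 the distance of y lies between 3ρ/4 and 5ρ/4. Hence |x - y| is at most a
    -- third of it and 4/ρ is at most 5 divided by it, the constants of `energyKernel`.
    have h4 := bdist_sub_le (Ω := Ω) x y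
    have h5 := bdist_sub_le (Ω := Ω) y x
    rw [dist_comm y x] at h5
    rw [indicator_of_mem hy, energyKernel, indicator_of_mem]
    · gcongr ENNReal.ofReal ?_ * _
      gcongr
      rw [hs, div_le_div_iff₀ hpos (by linarith)]
      linarith
    · change dist x y ≤ bdist Ω y / 3
      linarith
  calc ENNReal.ofReal ((ρ * ‖fderiv ℝ (smear η g s) x‖) ^ 2)
      = (ENNReal.ofReal ρ * ‖fderiv ℝ (smear η g s) x‖ₑ) ^ 2 := by
        rw [ENNReal.ofReal_pow (by positivity), ENNReal.ofReal_mul hpos.le, ofReal_norm]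
    _ ≤ (ENNReal.ofReal ρ * (ENNReal.ofReal (s ^ (d + 1) * C)
        * ∫⁻ y in Metric.closedBall x (1 / s), gradENorm u y)) ^ 2 := by gcongr
    _ = ENNReal.ofReal ((ρ * (s ^ (d + 1) * C)) ^ 2)
        * (∫⁻ y in Metric.closedBall x (1 / s), gradENorm u y) ^ 2 := by
        rw [← mul_assoc, ← ENNReal.ofReal_mul hpos.le, mul_pow, ENNReal.ofReal_pow (by positivity)]
    _ ≤ ENNReal.ofReal ((ρ * (s ^ (d + 1) * C)) ^ 2)
        * (ENNReal.ofReal ((1 / s) ^ d) * volume (Metric.closedBall (0 : E d) 1)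
          * ∫⁻ y in Metric.closedBall x (1 / s), gradENorm u y ^ 2) := by gcongr
    _ = ENNReal.ofReal (16 * C ^ 2) * volume (Metric.closedBall (0 : E d) 1)
        * (ENNReal.ofReal (s ^ d)
          * ∫⁻ y in Metric.closedBall x (1 / s), gradENorm u y ^ 2) := by
        have e : (ρ * (s ^ (d + 1) * C)) ^ 2 * (1 / s) ^ d = 16 * C ^ 2 * s ^ d := by
          have e1 : ρ * s = 4 := by rw [hs]; field_simp
          calc (ρ * (s ^ (d + 1) * C)) ^ 2 * (1 / s) ^ d
              = (ρ * s) ^ 2 * C ^ 2 * s ^ d * (s * (1 / s)) ^ d := by rw [mul_pow s]; ring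
            _ = _ := by rw [e1, mul_one_div_cancel hs0.ne']; norm_num
        have e2 : ENNReal.ofReal ((ρ * (s ^ (d + 1) * C)) ^ 2) * ENNReal.ofReal ((1 / s) ^ d)
            = ENNReal.ofReal (16 * C ^ 2) * ENNReal.ofReal (s ^ d) := by
          rw [← ENNReal.ofReal_mul (by positivity), e, ENNReal.ofReal_mul (by positivity)]
        rw [← mul_assoc, ← mul_assoc, e2]
        ring
    _ ≤ _ := by gcongr

lemma wEnergy_smoothRep_le (hη : IsRadialKernel η) (hΩ : IsOpen Ω)
    (hb : Bornology.IsBounded Ω) (hne : Ωᶜ.Nonempty) : ∃ C : ℝ≥0∞, C ≠ ⊤ ∧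
      ∀ (u : H1 Ω) (g : L2 Ω), IsResidual u g →
        wEnergy Ω (smoothRep η g) ≤ C * ENNReal.ofReal (‖grad u‖ ^ 2) := by
  obtain ⟨M, hM0, hM⟩ := hη.test.fderiv.exists_bound
  have hv : volume (Metric.closedBall (0 : E d) 1) ≠ ⊤ := measure_closedBall_lt_top.ne
  refine ⟨ENNReal.ofReal (16 * (d * (d * (2 * M))) ^ 2) * volume (Metric.closedBall (0 : E d) 1)
    * (ENNReal.ofReal ((5 / 3) ^ d) * volume (Metric.closedBall (0 : E d) 1)),
    ENNReal.mul_ne_top (ENNReal.mul_ne_top ENNReal.ofReal_ne_top hv)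
      (ENNReal.mul_ne_top ENNReal.ofReal_ne_top hv), fun u g hg => ?_⟩
  have hA : ∫⁻ y, gradENorm u y ^ 2 = ENNReal.ofReal (‖grad u‖ ^ 2) := by
    have h1 : ∀ y, gradENorm u y ^ 2 = Ω.indicator (fun y => ‖grad u y‖ₑ ^ 2) y := fun y => by
      by_cases hy : y ∈ Ω <;> simp [gradENorm, hy]
    simp_rw [h1]
    rw [lintegral_indicator hΩ.measurableSet, ← real_inner_self_eq_norm_sq, L2.inner_def,
      ofReal_integral_eq_lintegral_ofReal (L2.integrable_inner _ _)
        (ae_of_all _ fun y => real_inner_self_nonneg)]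
    congr 1
    ext y
    rw [real_inner_self_eq_norm_sq, ENNReal.ofReal_pow (norm_nonneg _), ofReal_norm]
  calc wEnergy Ω (smoothRep η g) ≤ ∫⁻ x, ENNReal.ofReal (16 * (d * (d * (2 * M))) ^ 2)
      * volume (Metric.closedBall (0 : E d) 1) * ∫⁻ y, energyKernel u x y :=
        lintegral_mono fun x => wDens_smoothRep_le hη hg hΩ hb hne hM0 hM x
    _ = _ := by
        rw [lintegral_const_mul' _ _ (ENNReal.mul_ne_top ENNReal.ofReal_ne_top hv),
          lintegral_lintegral_swap (measurable_energyKernel hΩ u).aemeasurable]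
        simp_rw [lintegral_energyKernel hΩ hne]
        rw [lintegral_const_mul' _ _ (ENNReal.mul_ne_top ENNReal.ofReal_ne_top hv), hA]
        ring

/-- At a Lebesgue point the means of g tend to its value as the radius shrinks; being independent of
the radius, they equal it. -/
lemma smoothRep_ae_eq (hη : IsRadialKernel η) (hg : IsResidual u g) (hΩ : IsOpen Ω)
    (hb : Bornology.IsBounded Ω) (hne : Ωᶜ.Nonempty) :
    smoothRep η g =ᵐ[volume.restrict Ω] g := by
  have hi := integrable_indicator_L2 hΩ hb g
  obtain ⟨M, hM0, hM⟩ := hη.test.exists_bound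
  rw [Filter.EventuallyEq, ae_restrict_iff' hΩ.measurableSet]
  filter_upwards [IsUnifLocDoublingMeasure.ae_tendsto_average_norm_sub volume
    hi.locallyIntegrable 1] with x hL hx
  have hpos := bdist_pos hΩ hne hx
  have hlim := hL (l := nhdsWithin 0 (Ioi 0)) (fun _ : ℝ => x) (fun r => r) Filter.tendsto_id
    (by filter_upwards [self_mem_nhdsWithin] with r hr
        exact Metric.mem_closedBall_self (by rw [one_mul]; exact (mem_Ioi.1 hr).le))
  set V := (volume (Metric.closedBall (0 : E d) 1)).toReal with hV
  -- The kernel has mass one and is at most M r⁻ᵈ on the ball of radius r, whose volume is r^d V;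
  -- this gives the factor M V in front of the average.
  have hbound : ∀ᶠ r in nhdsWithin (0 : ℝ) (Ioi 0), |smoothRep η g x - g x|
      ≤ M * V * ⨍ y in Metric.closedBall x r, ‖Ω.indicator g y - Ω.indicator g x‖ := by
    have h0 : ∀ᶠ r in nhdsWithin (0 : ℝ) (Ioi 0), r < bdist Ω x :=
      mem_nhdsWithin_of_mem_nhds (Iio_mem_nhds hpos)
    filter_upwards [self_mem_nhdsWithin, h0] with r hr0 hr
    have hr0 : 0 < r := hr0
    have hs : 0 < 1 / r := by positivity
    have hmass : ∫ y, (1 / r) ^ d * η ((1 / r) • (x - y)) = 1 := by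
      rw [integral_const_mul, integral_sub_left_eq_self (fun y => η ((1 / r) • y)) volume x,
        Measure.integral_comp_smul, finrank_euclideanSpace_fin, hη.mass, smul_eq_mul, mul_one,
        abs_of_pos (by positivity), mul_inv_cancel₀ (by positivity)]
    have hk := hη.test.kernel hs
    have hkc : Continuous fun y => (1 / r) ^ d * η ((1 / r) • (x - y)) :=
      continuous_const.mul (hη.test.continuous.comp (by fun_prop))
    have hkb : ∀ y, ‖(1 / r) ^ d * η ((1 / r) • (x - y))‖ ≤ (1 / r) ^ d * M := fun y => by
      rw [norm_mul, Real.norm_of_nonneg (by positivity)]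
      gcongr
      exact hM _
    have hki : Integrable fun y => (1 / r) ^ d * η ((1 / r) • (x - y)) :=
      (hk.1.continuous.integrable_of_hasCompactSupport hk.2).comp_sub_left x
    have e1 : smoothRep η g x - g x = ∫ y, (Ω.indicator g y - Ω.indicator g x)
        * ((1 / r) ^ d * η ((1 / r) • (x - y))) := by
      simp_rw [sub_mul]
      rw [integral_sub (hi.mul_bdd hkc.aestronglyMeasurable (ae_of_all _ hkb))
        (hki.const_mul _), integral_const_mul, hmass, mul_one, indicator_of_mem hx,
        ← smear_eq_integral hΩ, smoothRep_eq hη hg hb hs (by rwa [one_div_one_div])]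
    have hvol : (volume (Metric.closedBall x r)).toReal = r ^ d * V := by
      rw [volume_closedBall_eq x hr0, ENNReal.toReal_mul, ENNReal.toReal_ofReal (by positivity)]
    have hV0 : 0 < V := ENNReal.toReal_pos
      (Metric.measure_closedBall_pos volume _ one_pos).ne' measure_closedBall_lt_top.ne
    have hint : IntegrableOn (fun y => ‖Ω.indicator g y - Ω.indicator g x‖)
        (Metric.closedBall x r) := by
      have : IsFiniteMeasure (volume.restrict (Metric.closedBall x r)) := ⟨by
        rw [Measure.restrict_apply_univ]; exact measure_closedBall_lt_top⟩
      exact (hi.integrableOn.sub (integrable_const _)).norm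
    rw [e1, ← Real.norm_eq_abs]
    calc ‖∫ y, (Ω.indicator g y - Ω.indicator g x) * ((1 / r) ^ d * η ((1 / r) • (x - y)))‖
        ≤ ∫ y, (Metric.closedBall x r).indicator (fun y => (1 / r) ^ d * M
          * ‖Ω.indicator g y - Ω.indicator g x‖) y := by
          refine norm_integral_le_of_norm_le
            ((integrable_indicator_iff measurableSet_closedBall).2 (hint.const_mul _))
            (ae_of_all _ fun y => ?_)
          by_cases hy : y ∈ Metric.closedBall x r
          · rw [indicator_of_mem hy, norm_mul, mul_comm]
            gcongr
            exact hkb y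
          · rw [indicator_of_notMem hy]
            have : (1 / r) • (x - y) ∉ Metric.closedBall (0 : E d) 1 := by
              rwa [mem_closedBall_rescale hs, one_div_one_div]
            rw [hη.test.zero_of_notMem this]
            simp
      _ = _ := by
          rw [integral_indicator measurableSet_closedBall, integral_const_mul, setAverage_eq,
            measureReal_def, hvol, smul_eq_mul, one_div, inv_pow]
          field_simp
  have h0 := ge_of_tendsto (hlim.const_mul (M * V)) hbound
  rw [mul_zero] at h0
  exact sub_eq_zero.1 (abs_nonpos_iff.1 h0)

end SmoothRep

/-! ### The divergence inf-sup condition -/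

section Divergence

variable {d : ℕ} {Ω : Set (E d)}

/-- (q - div u, div φ) = (∇u, ∇φ) - (div u, div φ), and `sum_inner_transpose` rewrites the last term
as the pairing of ∇u with the transpose of ∇φ. -/
lemma isResidual_of_variational (hΩ : IsOpen Ω) {u : H1 Ω} {q : L2 Ω}
    (h : ∀ v ∈ H10 Ω, inner ℝ (grad u) (grad v) = inner ℝ (divL Ω v) q) :
    IsResidual u (q - divL Ω u) := by
  intro φ hφ
  have h1 := h _ (ofTest_mem hφ)
  have h2 := sum_inner_transpose hΩ u (ofTest_mem hφ)
  have hdiv : inner ℝ (divL Ω (ofTest hφ)) (q - divL Ω u)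
      = ∫ y in Ω, (q - divL Ω u : L2 Ω) y * ∑ i, pd i (fun z => φ z i) y := by
    rw [← divForm_eq, divForm]
    apply integral_congr_ae
    have h3 : ∀ᵐ y ∂(volume.restrict Ω), ∀ i : Fin d,
        coordL Ω (i, i) (grad (ofTest hφ)) y = pd i (fun z => φ z i) y :=
      ae_all_iff.2 fun i => by rw [coordL_grad_ofTest]; exact IsTest.coe_toL2 _
    have h4 : ∀ᵐ y ∂(volume.restrict Ω), ∀ i : Fin d,
        coordL Ω (i, i) (grad (ofTest hφ)) y = grad (ofTest hφ) y (i, i) :=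
      ae_all_iff.2 fun i => coordL_coe _ _
    filter_upwards [h3, h4] with y h3 h4
    rw [mul_comm, Finset.sum_congr rfl fun i _ => (h4 i).symm.trans (h3 i)]
  have hterm : ∀ i j, ∫ y in Ω, grad u y (i, j)
        * (pd j (fun z => φ z i) y - pd i (fun z => φ z j) y)
      = inner ℝ (coordL Ω (i, j) (grad u)) (coordL Ω (i, j) (grad (ofTest hφ)))
        - inner ℝ (coordL Ω (i, j) (grad u)) (coordL Ω (j, i) (grad (ofTest hφ))) := by
    intro i j
    rw [coordL_grad_ofTest, coordL_grad_ofTest, inner_coordL_toL2, inner_coordL_toL2,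
      ← integral_sub]
    · congr 1; ext y; ring
    · exact integrable_coord_mul _ _ ((hφ.coord i).pd j).continuous ((hφ.coord i).pd j).compact
    · exact integrable_coord_mul _ _ ((hφ.coord j).pd i).continuous ((hφ.coord j).pd i).compact
  simp only [← hdiv, hterm, Finset.sum_sub_distrib]
  rw [h2, inner_sub_right, ← h1, inner_eq_sum_coordL, Fintype.sum_prod_type,
    real_inner_comm (divL Ω u)]

/-- Residuals with zero mean are controlled by the gradient. -/
lemma exists_residual_bound (hd : 0 < d) (hΩ : IsOpen Ω) (hconn : IsConnected Ω)
    (hb : Bornology.IsBounded Ω) (hcone : ConeCondition Ω) :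
    ∃ K : ℝ, 0 ≤ K ∧ ∀ (u : H1 Ω) (g : L2 Ω), IsResidual u g → g ∈ L20 Ω →
      ‖g‖ ^ 2 ≤ K * ‖grad u‖ ^ 2 := by
  have hne := compl_nonempty_of_isBounded hd hb
  obtain ⟨η, hη⟩ := exists_isRadialKernel d
  obtain ⟨C₁, hC₁, hE⟩ := wEnergy_smoothRep_le hη hΩ hb hne
  obtain ⟨C₂, hC₂, hP⟩ := improved_poincare hd hΩ hconn hb hcone
  have : IsFiniteMeasure (volume.restrict Ω) := ⟨by
    rw [Measure.restrict_apply_univ]; exact hb.measure_lt_top⟩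
  refine ⟨(C₂ * C₁).toReal, ENNReal.toReal_nonneg, fun u g hg h0 => ?_⟩
  obtain ⟨c, hc⟩ := hP _ (contDiffOn_smoothRep hη hg hΩ hb hne)
  have hae := smoothRep_ae_eq hη hg hΩ hb hne
  have hgi : Integrable g (volume.restrict Ω) := integrable_of_isBounded hb g
  have hg2 : Integrable (fun x => g x ^ 2) (volume.restrict Ω) := (Lp.memLp g).integrable_sq
  have hexp : ∀ x, (g x - c) ^ 2 = g x ^ 2 - 2 * c * g x + c ^ 2 := fun x => by ring
  have hg3 : Integrable (fun x => g x ^ 2 - 2 * c * g x) (volume.restrict Ω) :=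
    hg2.sub (hgi.const_mul _)
  have hi : Integrable (fun x => (g x - c) ^ 2) (volume.restrict Ω) := by
    simp_rw [hexp]
    exact hg3.add (integrable_const _)
  have h1 : ENNReal.ofReal (∫ x in Ω, (g x - c) ^ 2)
      ≤ ENNReal.ofReal ((C₂ * C₁).toReal * ‖grad u‖ ^ 2) := by
    rw [ofReal_integral_eq_lintegral_ofReal hi (ae_of_all _ fun x => sq_nonneg _),
      ENNReal.ofReal_mul ENNReal.toReal_nonneg,
      ENNReal.ofReal_toReal (ENNReal.mul_ne_top hC₂ hC₁)]
    calc ∫⁻ x in Ω, ENNReal.ofReal ((g x - c) ^ 2)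
        = ∫⁻ x in Ω, ENNReal.ofReal ((smoothRep η g x - c) ^ 2) := by
          apply lintegral_congr_ae
          filter_upwards [hae] with x hx
          rw [hx]
      _ ≤ C₂ * wEnergy Ω (smoothRep η g) := hc
      _ ≤ C₂ * (C₁ * ENNReal.ofReal (‖grad u‖ ^ 2)) := by gcongr; exact hE u g hg
      _ = _ := by rw [mul_assoc]
  have h2 := (ENNReal.ofReal_le_ofReal_iff (by positivity)).1 h1
  -- As g has zero mean it is orthogonal to constants, so subtracting c can only increase the norm.
  have h3 : ∫ x in Ω, (g x - c) ^ 2 = ‖g‖ ^ 2 + ∫ _ in Ω, c ^ 2 := by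
    have h4 : ‖g‖ ^ 2 = ∫ x in Ω, g x ^ 2 := by
      rw [← real_inner_self_eq_norm_sq, L2.inner_def]
      congr 1
      ext x
      rw [real_inner_self_eq_norm_sq, Real.norm_eq_abs, sq_abs]
    have h5 : ∫ x in Ω, g x = 0 := h0
    simp_rw [hexp]
    rw [integral_add hg3 (integrable_const _), integral_sub hg2 (hgi.const_mul _), integral_const_mul, h5, h4]
    ring
  have h6 : 0 ≤ ∫ _ in Ω, c ^ 2 := integral_nonneg fun _ => sq_nonneg _
  linarith

/-- Needed for q = 0: a supremum over an empty family would be -∞ rather than 0. If every test field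
vanished in L², the constant 1 would be orthogonal to all test functions, hence zero on a set of
positive measure. -/
lemma exists_ne_zero_H10 (hd : 0 < d) (hΩ : IsOpen Ω) (hne : Ω.Nonempty)
    (hb : Bornology.IsBounded Ω) : ∃ v : H10 Ω, v ≠ 0 := by
  by_contra hcon
  push Not at hcon
  have : IsFiniteMeasure (volume.restrict Ω) := ⟨by
    rw [Measure.restrict_apply_univ]; exact hb.measure_lt_top⟩
  let q : L2 Ω := (memLp_const (1 : ℝ)).toLp
  have hq : q = 0 := by
    refine ae_eq_zero_of_test hΩ fun φ hφ => ?_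
    have h1 := hcon ⟨_, ofTest_mem (hφ.smul_const (EuclideanSpace.single ⟨0, hd⟩ (1 : ℝ)))⟩
    have h2 : fn (ofTest (hφ.smul_const (EuclideanSpace.single (⟨0, hd⟩ : Fin d) (1 : ℝ)))) = 0 :=
      congrArg (fun v : H10 Ω => fn (v : H1 Ω)) h1
    rw [fn_ofTest] at h2
    have h3 : hφ.toL2 = 0 := by
      apply Lp.ext
      have h4 := IsTest.coe_toL2 (hφ.smul_const (EuclideanSpace.single (⟨0, hd⟩ : Fin d) (1 : ℝ)))
      rw [h2] at h4
      filter_upwards [h4, hφ.coe_toL2, Lp.coeFn_zero (E d) 2 (volume.restrict Ω),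
        Lp.coeFn_zero ℝ 2 (volume.restrict Ω)] with x h4 h5 h6 h7
      rw [h5, h7]
      rw [h6] at h4
      have := congrArg (fun w : E d => w ⟨0, hd⟩) h4
      simpa using this.symm
    rw [h3, inner_zero_right]
  have h1 : ∀ᵐ x ∂(volume.restrict Ω), False := by
    filter_upwards [MemLp.coeFn_toLp (memLp_const (1 : ℝ) : MemLp (fun _ : E d => (1 : ℝ)) 2
      (volume.restrict Ω)), Lp.coeFn_zero ℝ 2 (volume.restrict Ω)] with x h1 h2
    have h3 : (q : E d → ℝ) x = 1 := h1
    rw [hq, h2] at h3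
    exact zero_ne_one h3
  rw [ae_iff] at h1
  simp only [not_false_eq_true, ofPred_true, Measure.restrict_apply_univ] at h1
  exact (hΩ.measure_pos volume hne).ne' h1

lemma H10_norm_sq_le {P : ℝ} (hP : ∀ v ∈ H10 Ω, ‖fn v‖ ^ 2 ≤ P * ‖grad v‖ ^ 2) (v : H10 Ω) :
    ‖v‖ ^ 2 ≤ (1 + P) * ‖grad (v : H1 Ω)‖ ^ 2 := by
  have h1 : ‖v‖ ^ 2 = ‖fn (v : H1 Ω)‖ ^ 2 + ‖grad (v : H1 Ω)‖ ^ 2 := norm_sq_H1 (v : H1 Ω)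
  rw [h1]
  linarith [hP v v.2]

/-- The vector Laplace problem with right-hand side `-∇q`. -/
lemma exists_vector_laplace {P : ℝ} (hP0 : 0 ≤ P)
    (hP : ∀ v ∈ H10 Ω, ‖fn v‖ ^ 2 ≤ P * ‖grad v‖ ^ 2) (q : L2 Ω) :
    ∃ u : H10 Ω, ∀ v ∈ H10 Ω, inner ℝ (grad (u : H1 Ω)) (grad v) = inner ℝ (divL Ω v) q := by
  let Gr : H10 Ω →L[ℝ] L2T Ω := (gradL Ω).comp (H10 Ω).subtypeL
  let Dv : H10 Ω →L[ℝ] L2 Ω := (divL Ω).comp (H10 Ω).subtypeL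
  obtain ⟨e, he⟩ := exists_equiv_of_coercive ((ContinuousLinearMap.adjoint Gr).comp Gr)
    (a₀ := (1 + P)⁻¹) (by positivity) (fun v => by
      rw [ContinuousLinearMap.comp_apply, ContinuousLinearMap.adjoint_inner_left,
        real_inner_self_eq_norm_sq, inv_mul_le_iff₀ (by positivity)]
      exact H10_norm_sq_le hP v)
  obtain ⟨u, hu⟩ := e.surjective (ContinuousLinearMap.adjoint Dv q)
  refine ⟨u, fun v hv => ?_⟩
  have h1 : inner ℝ (e u) (⟨v, hv⟩ : H10 Ω) = inner ℝ (Gr u) (Gr ⟨v, hv⟩) := by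
    rw [he, ContinuousLinearMap.comp_apply, ContinuousLinearMap.adjoint_inner_left]
  rw [hu, ContinuousLinearMap.adjoint_inner_left, real_inner_comm] at h1
  exact h1.symm

lemma residual_mem_L20 (hΩ : IsOpen Ω) (hb : Bornology.IsBounded Ω) {u : H1 Ω} (hu : u ∈ H10 Ω)
    {q : L2 Ω} (hq : q ∈ L20 Ω) : q - divL Ω u ∈ L20 Ω := by
  have h1 : ∫ x in Ω, q x = 0 := hq
  have h2 := integral_divL hΩ hb hu
  change ∫ x in Ω, (q - divL Ω u : L2 Ω) x = 0
  rw [integral_congr_ae (Lp.coeFn_sub q (divL Ω u))]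
  simp only [Pi.sub_apply]
  rw [integral_sub (integrable_of_isBounded hb q) (integrable_of_isBounded hb _), h1, h2,
    sub_zero]

/-- Functions with zero mean are the divergence residuals of fields controlled from below. -/
lemma exists_field_bound (hd : 0 < d) (hΩ : IsOpen Ω) (hconn : IsConnected Ω)
    (hb : Bornology.IsBounded Ω) (hcone : ConeCondition Ω) :
    ∃ A P : ℝ, 0 ≤ A ∧ 0 ≤ P ∧ ∀ q ∈ L20 Ω, ∃ u : H10 Ω,
      divForm (u : H1 Ω) q = ‖grad (u : H1 Ω)‖ ^ 2 ∧ ‖u‖ ≤ P * ‖grad (u : H1 Ω)‖ ∧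
      ‖q‖ ≤ A * ‖grad (u : H1 Ω)‖ := by
  obtain ⟨K, hK0, hK⟩ := exists_residual_bound hd hΩ hconn hb hcone
  obtain ⟨P, hP0, hP⟩ := poincare hd hΩ hb
  refine ⟨Real.sqrt K + ‖divL Ω‖ * Real.sqrt (1 + P), Real.sqrt (1 + P), by positivity,
    by positivity, fun q hq => ?_⟩
  obtain ⟨u, hvar⟩ := exists_vector_laplace hP0 hP q
  have hun : ‖u‖ ≤ Real.sqrt (1 + P) * ‖grad (u : H1 Ω)‖ := by
    refine abs_le_of_sq_le_sq' ?_ (by positivity) |>.2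
    rw [mul_pow, Real.sq_sqrt (by positivity)]
    exact H10_norm_sq_le hP u
  refine ⟨u, by rw [divForm_eq, ← hvar u u.2, real_inner_self_eq_norm_sq], hun, ?_⟩
  have h1 : ‖q - divL Ω (u : H1 Ω)‖ ≤ Real.sqrt K * ‖grad (u : H1 Ω)‖ := by
    refine abs_le_of_sq_le_sq' ?_ (by positivity) |>.2
    rw [mul_pow, Real.sq_sqrt hK0]
    exact hK _ _ (isResidual_of_variational hΩ hvar) (residual_mem_L20 hΩ hb u.2 hq)
  have h2 : ‖divL Ω (u : H1 Ω)‖ ≤ ‖divL Ω‖ * (Real.sqrt (1 + P) * ‖grad (u : H1 Ω)‖) :=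
    ((divL Ω).le_opNorm _).trans (mul_le_mul_of_nonneg_left hun (norm_nonneg _))
  calc ‖q‖ = ‖(q - divL Ω (u : H1 Ω)) + divL Ω (u : H1 Ω)‖ := by rw [sub_add_cancel]
    _ ≤ _ := norm_add_le _ _
    _ ≤ _ := by linarith

/-- The inf-sup condition for the divergence on bounded domains with the cone condition. -/
theorem infSupDiv_of_cone (hd : 0 < d) (hΩ : IsOpen Ω) (hconn : IsConnected Ω)
    (hb : Bornology.IsBounded Ω) (hcone : ConeCondition Ω) : InfSupDiv Ω := by
  obtain ⟨A, P, hA0, hP0, hAP⟩ := exists_field_bound hd hΩ hconn hb hcone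
  -- The quotient at u is ‖∇u‖²/‖u‖, with ‖u‖ at most P‖∇u‖ and ‖q‖ at most A‖∇u‖. The added ones
  -- keep the constant positive.
  refine ⟨((A + 1) * (P + 1))⁻¹, by positivity, fun q hq => ?_⟩
  obtain ⟨u, hdiv, hun, hqn⟩ := hAP q hq
  have hG0 : 0 ≤ ‖grad (u : H1 Ω)‖ := norm_nonneg _
  by_cases hu0 : u = 0
  · have hG' : ‖grad (u : H1 Ω)‖ = 0 := by
      rw [hu0]
      exact (congrArg norm (map_zero (gradL Ω))).trans norm_zero
    have hq0 : q = 0 := by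
      rw [hG', mul_zero] at hqn
      exact norm_le_zero_iff.1 hqn
    obtain ⟨v, hv⟩ := exists_ne_zero_H10 hd hΩ hconn.nonempty hb
    refine le_iSup_of_le (⟨v, hv⟩ : {v : H10 Ω // v ≠ 0}) ?_
    rw [divForm_eq, hq0, norm_zero, mul_zero, inner_zero_right, zero_div]
  · refine le_iSup_of_le (⟨u, hu0⟩ : {v : H10 Ω // v ≠ 0}) ?_
    rw [EReal.coe_le_coe_iff, hdiv, le_div_iff₀ (norm_pos_iff.2 hu0)]
    have h1 : ‖q‖ ≤ (A + 1) * ‖grad (u : H1 Ω)‖ := by linarith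
    have h2 : ‖u‖ ≤ (P + 1) * ‖grad (u : H1 Ω)‖ := by linarith
    calc ((A + 1) * (P + 1))⁻¹ * ‖q‖ * ‖u‖ ≤ ((A + 1) * (P + 1))⁻¹
          * ((A + 1) * ‖grad (u : H1 Ω)‖) * ((P + 1) * ‖grad (u : H1 Ω)‖) := by
          refine mul_le_mul (mul_le_mul_of_nonneg_left h1 (by positivity)) h2 (norm_nonneg _)
            (by positivity)
      _ = ‖grad (u : H1 Ω)‖ ^ 2 := by field_simp

end Divergence

/-! ### The two choices of multiplier space -/

section BothPairings

variable {d : ℕ} {Ω B : Set (E d)}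

/-- The results for the duality pairing. -/
theorem infSupA_and_wellPosed_cDual (hΩ : IsOpen Ω) (hΩb : Bornology.IsBounded Ω) {Xb : E d → E d}
    (K : H10 Ω →L[ℝ] H1 B) (hK : ∀ v : H10 Ω, comp B Xb (v : H1 Ω) = K v)
    {ν : E d → ℝ} (hν : MemLp ν ⊤ (volume.restrict Ω)) {ν₀ : ℝ} (hν₀ : 0 < ν₀)
    (hνν₀ : ∀ᵐ x ∂(volume.restrict Ω), ν₀ ≤ ν x) {α β γ : ℝ} (hα : 0 < α) (hβ : 0 ≤ β)
    (hγ : 0 < γ) : InfSupA (cDual (B := B)) Ω Xb ν α β γ ∧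
      (InfSupDiv Ω → WellPosed (cDual (B := B)) Ω Xb ν α β γ) := by
  have hc : ∀ l Y : H1 B, cDual (InnerProductSpace.toDual ℝ (H1 B) l) Y = inner ℝ l Y :=
    fun l Y => rfl
  exact ⟨infSupA_of_riesz hΩ (InnerProductSpace.toDual ℝ (H1 B)) hc K hK hν hν₀ hνν₀ hα hβ hγ,
    wellPosed_of_riesz hΩ hΩb (InnerProductSpace.toDual ℝ (H1 B)) hc K hK hν hν₀ hνν₀ hα hβ hγ⟩

/-- The results for the scalar product of `H¹(B)^d`. -/
theorem infSupA_and_wellPosed_cInner (hΩ : IsOpen Ω) (hΩb : Bornology.IsBounded Ω)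
    {Xb : E d → E d} (K : H10 Ω →L[ℝ] H1 B) (hK : ∀ v : H10 Ω, comp B Xb (v : H1 Ω) = K v)
    {ν : E d → ℝ} (hν : MemLp ν ⊤ (volume.restrict Ω)) {ν₀ : ℝ} (hν₀ : 0 < ν₀)
    (hνν₀ : ∀ᵐ x ∂(volume.restrict Ω), ν₀ ≤ ν x) {α β γ : ℝ} (hα : 0 < α) (hβ : 0 ≤ β)
    (hγ : 0 < γ) : InfSupA (cInner (B := B)) Ω Xb ν α β γ ∧
      (InfSupDiv Ω → WellPosed (cInner (B := B)) Ω Xb ν α β γ) := by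
  have hc : ∀ l Y : H1 B, cInner (LinearIsometryEquiv.refl ℝ (H1 B) l) Y = inner ℝ l Y :=
    fun l Y => by
      rw [inner_H1, add_comm]
      rfl
  exact ⟨infSupA_of_riesz hΩ (LinearIsometryEquiv.refl ℝ (H1 B)) hc K hK hν hν₀ hνν₀ hα hβ hγ,
    wellPosed_of_riesz hΩ hΩb (LinearIsometryEquiv.refl ℝ (H1 B)) hc K hK hν hν₀ hνν₀ hα hβ hγ⟩

end BothPairings

end FSI

end

/-! ### The main theorem -/

theorem mainTheorem2 (d : ℕ) (hd : d = 2 ∨ d = 3)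
    (Ω B : Set (FSI.E d))
    (hΩ : IsOpen Ω) (hΩb : Bornology.IsBounded Ω) (hΩc : IsConnected Ω) (hB : IsOpen B)
    (Xb : FSI.E d → FSI.E d) (hXb : FSI.MemW1inf B Xb) (hmaps : Set.MapsTo Xb B Ω)
    (m : ℝ) (hm : 0 < m) (hinv : ∀ s ∈ B, ∀ t ∈ B, m * ‖s - t‖ ≤ ‖Xb s - Xb t‖)
    (ν : FSI.E d → ℝ) (hν : MeasureTheory.MemLp ν ⊤ (MeasureTheory.volume.restrict Ω))
    (ν₀ : ℝ) (hν₀ : 0 < ν₀)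
    (hνν₀ : ∀ᵐ x ∂(MeasureTheory.volume.restrict Ω), ν₀ ≤ ν x)
    (α β γ : ℝ) (hα : 0 < α) (hβ : 0 ≤ β) (hγ : 0 < γ) :
    -- the compositions `v(X̄)` are well defined elements of `H¹(B)^d`
    (∀ v : FSI.H10 Ω, ∃! w : FSI.H1 B, FSI.IsComp Xb (v : FSI.H1 Ω) w) ∧
    -- the inf-sup condition for `𝒜` on the kernel of `ℬ`, for both choices of `Λ` and `c`
    FSI.InfSupA (FSI.cDual (B := B)) Ω Xb ν α β γ ∧
    FSI.InfSupA (FSI.cInner (B := B)) Ω Xb ν α β γ ∧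
    -- together with the inf-sup condition for the divergence it gives well-posedness
    (FSI.InfSupDiv Ω →
      FSI.WellPosed (FSI.cDual (B := B)) Ω Xb ν α β γ ∧
      FSI.WellPosed (FSI.cInner (B := B)) Ω Xb ν α β γ) ∧
    -- and the latter holds as soon as `Ω` satisfies the cone condition
    (FSI.ConeCondition Ω → FSI.InfSupDiv Ω) := by
  obtain ⟨K, hK⟩ := FSI.exists_comp hΩ hB hXb hmaps hm hinv
  have hK' : ∀ v : FSI.H10 Ω, FSI.comp B Xb (v : FSI.H1 Ω) = K v := fun v =>
    FSI.comp_eq hB (hK v)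
  have hdual := FSI.infSupA_and_wellPosed_cDual hΩ hΩb K hK' hν hν₀ hνν₀ hα hβ hγ
  have hinner := FSI.infSupA_and_wellPosed_cInner hΩ hΩb K hK' hν hν₀ hνν₀ hα hβ hγ
  exact ⟨fun v => ⟨K v, hK v, fun w hw => FSI.isComp_unique hB hw (hK v)⟩, hdual.1, hinner.1,
    fun hdiv => ⟨hdual.2 hdiv, hinner.2 hdiv⟩,
    fun hcone => FSI.infSupDiv_of_cone (by omega) hΩ hΩc hΩb hcone⟩
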